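/- Let $K$ be a field of characteristic zero and $W=\langle e,f\rangle$ the $1|1$-dimensional $\mathbb Z_2$-graded space with $e$ even and $f$ odd. Let $S(W)$ be the reduced symmetric coalgebra of $W$, with basis $e^k$ ($k\ge1$) and $e^{k-1}f$ ($k\ge 1$). Define cochains in $\mathrm{Hom}(S^k(W),W)$, $k\ge1$, by $$\varphi^k_e(e^k)=k!\,e,\quad \varphi^k_f(e^{k-1}f)=(k-1)!\,f,\quad \psi^k_e(e^{k-1}f)=(k-1)!\,e,\quad \psi^k_f(e^k)=k!\,f,$$ zero on all other basis monomials, and identify (odd) cochains with (odd) coderivations of $S(W)$. Each $\psi^L_e$ is a codifferential (an odd coderivation of square zero), i.e. an $L_\infty$ structure on $W$. For fixed $L$ put $h^k=\varphi^k_e+(k-L+1)\varphi^k_f$. A local base is a $\mathbb Z_2$-graded commutative local $K$-algebra $\mathcal A$ with an augmentation $\epsilon:\mathcal A\to K$ and maximal ideal $\mathfrak m=\ker\epsilon$; it is formal if it is complete, $\mathcal A=\lim\mathcal A/\mathfrak m^n$, and infinitesimal if $\mathfrak m^2=0$. A deformation of a codifferential $d$ with base $\mathcal A$ is a codifferential on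 $S(W)\otimes\mathcal A$ that projects to $d$ under $I\otimes\epsilon$. Two deformations $d^1_{\mathcal A}$, $d^2_{\mathcal A}$ of $d$ are equivalent if $\tilde g^{-1}\circ d^1_{\mathcal A}\circ\tilde g=d^2_{\mathcal A}$ for an (even) coalgebra automorphism $\tilde g$ of $S(W)\otimes\mathcal A$ with $(I\otimes\epsilon)\circ\tilde g=I\otimes\epsilon$. A deformation $d_{\mathcal A}$ with formal base $\mathcal A$ is miniversal if for every deformation $d'$ of $d$ with a formal base $\mathcal A'$ there is a morphism $\lambda:\mathcal A\to\mathcal A'$ of augmented graded algebras such that $\lambda_*(d_{\mathcal A})$ is equivalent to $d'$, and $\lambda$ is unique whenever $\mathcal A'$ is infinitesimal. A deformation with infinitesimal base is a universal infinitesimal deformation if for every deformation with infinitesimal base such a $\lambda$ exists and is unique. Below, $\theta_i$ are odd and $t_i$ even parameters, $\mathcal A_R=K[[\theta_1,\dots,\theta_{L-1},t_1,\dots,t_{L-1}]]/(R)$, and in $L\otimes\mathcal A$ the Koszul sign rule holds: $(\varphi a)(w)=(-1)^{|a||w|}\varphi(w)a$. Put $$d^L_1=\psi^L_e+\sum_{k=1}^{L-1}h^k\theta_k+\sum_{k=1}^{L-1}\psi^k_e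 t_k .$$ 1. ($L=1$) $\psi^1_e$ is rigid: $\psi^1_e$ itself, with base $K$, is miniversal. 2. For $L=2,3,4$, $d^L_1$ with base $K[[\theta,t]]/\mathfrak m^2$ is a universal infinitesimal deformation of $\psi^L_e$. 3. ($L=2$) $d^2_1=\psi^2_e+h^1\theta_1+\psi^1_et_1$, with base $\mathcal A_R$, $R=\{\theta_1t_1\}$, is a miniversal deformation of $\psi^2_e$. 4. ($L=3$) The second-order expression $d^3_2=d^3_1+\varphi^1_f\theta_2t_2$, with base $\mathcal A_{R_3}$, $$R_3=\{\theta_1\theta_2,\;2\theta_1t_1-\theta_2t_1t_2,\;\theta_1t_2+2\theta_2t_1-\theta_2t_2^2\},$$ is a miniversal deformation of $\psi^3_e$. Modulo $\mathfrak m^3$ the relations $R_3$ become $R_2=\{\theta_1\theta_2,\theta_1t_1,\theta_1t_2+2\theta_2t_1\}$, that is, $(R_3)+\mathfrak m^3=(R_2)+\mathfrak m^3$ in $K[[\theta,t]]$, but they pick up third-order terms: $(R_3)\ne(R_2)$. 5. ($L=4$) The third-order expression $$d^4_3=d^4_1+\psi^1_f\theta_2\theta_3+\varphi^1_f(\theta_2t_3+2\theta_3t_2)+\varphi^2_f\theta_3t_3-\varphi^1_f\theta_3t_3^2,$$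 with base $\mathcal A_R$, where $R$ consists of the six relations \begin{align*} &\theta_2\theta_3t_1,\qquad -\theta_1\theta_2+\theta_2\theta_3t_2,\qquad -2\theta_1\theta_3+\theta_2\theta_3t_3,\\ &-3\theta_1t_1+\theta_2t_1t_3+2\theta_3t_1t_2-\theta_3t_1t_3^2,\\ &-2\theta_1t_2-3\theta_2t_1+\theta_2t_2t_3+2\theta_3t_2^2+\theta_3t_1t_3-\theta_3t_2t_3^2,\\ &-\theta_1t_3-2\theta_2t_2-3\theta_3t_1+\theta_2t_3^2+3\theta_3t_2t_3-\theta_3t_3^3, \end{align*} is a miniversal deformation of $\psi^4_e$. -/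

import Mathlib

universe u v w

noncomputable section

namespace LInfty

/-! ### The sign rule -/

/-- The sign `(-1)^p` of a parity `p`. -/
def sgn (p : ZMod 2) : ℤ := if p = 0 then 1 else -1

/-! ### Local bases

A `ℤ/2`-graded algebra is an algebra `A` over the field `K` with its even part `𝒜 0` and its odd
part `𝒜 1`. -/

section Bases

variable {K : Type u} [Field K]

/-- `A`, graded by `𝒜` and augmented by `ε`, is a local base: a graded commutative local algebra
whose maximal ideal is the augmentation ideal `ker ε`. -/
structure IsLocalBase {A : Type v} [Ring A] [Algebra K A] (𝒜 : ZMod 2 → Submodule K A)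
    (ε : A →ₐ[K] K) : Prop where
  internal : DirectSum.IsInternal 𝒜
  one_mem : (1 : A) ∈ 𝒜 0
  mul_mem : ∀ (i j : ZMod 2) (a b : A), a ∈ 𝒜 i → b ∈ 𝒜 j → a * b ∈ 𝒜 (i + j)
  supercomm : ∀ (i j : ZMod 2) (a b : A), a ∈ 𝒜 i → b ∈ 𝒜 j → a * b = sgn (i * j) • (b * a)
  aug_odd : ∀ a ∈ 𝒜 1, ε a = 0
  isUnit : ∀ a : A, ε a ≠ 0 → IsUnit a

/-- The augmentation ideal `𝔪 = ker ε`, as a subspace; its powers `𝔪 ^ n` (`n ≥ 1`) are the powers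
of the ideal. -/
def augIdeal {A : Type v} [Ring A] [Algebra K A] (ε : A →ₐ[K] K) : Submodule K A :=
  LinearMap.ker ε.toLinearMap

/-- A formal base: a local base that is complete, `A = lim A / 𝔪 ^ n`. -/
structure IsFormalBase {A : Type v} [Ring A] [Algebra K A] (𝒜 : ZMod 2 → Submodule K A)
    (ε : A →ₐ[K] K) : Prop extends IsLocalBase 𝒜 ε where
  separated : ∀ x : A, (∀ n : ℕ, x ∈ augIdeal ε ^ (n + 1)) → x = 0
  complete : ∀ s : ℕ → A, (∀ n : ℕ, s (n + 1) - s n ∈ augIdeal ε ^ (n + 1)) →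
    ∃ x : A, ∀ n : ℕ, s n - x ∈ augIdeal ε ^ (n + 1)

/-- An infinitesimal base: a local base with `𝔪 ^ 2 = 0`. -/
structure IsInfinitesimalBase {A : Type v} [Ring A] [Algebra K A] (𝒜 : ZMod 2 → Submodule K A)
    (ε : A →ₐ[K] K) : Prop extends IsLocalBase 𝒜 ε where
  sq_zero : ∀ x y : A, ε x = 0 → ε y = 0 → x * y = 0

/-- Morphisms of augmented `ℤ/2`-graded algebras. -/
structure IsBaseHom {A : Type v} [Ring A] [Algebra K A] (𝒜 : ZMod 2 → Submodule K A)
    (ε : A →ₐ[K] K) {B : Type w} [Ring B] [Algebra K B] (ℬ : ZMod 2 → Submodule K B)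
    (η : B →ₐ[K] K) (f : A →ₐ[K] B) : Prop where
  map_mem : ∀ (i : ZMod 2) (a : A), a ∈ 𝒜 i → f a ∈ ℬ i
  aug_comp : η.comp f = ε

/-- The ground field as a purely even algebra. -/
def groundGrading (K : Type u) [Field K] (i : ZMod 2) : Submodule K K := if i = 0 then ⊤ else ⊥

end Bases

/-! ### The coalgebra `S(W) ⊗ A` for the `1|1`-dimensional space `W = ⟨e, f⟩`

Here `e` is even and `f` is odd, so `f ^ 2 = 0` in `S(W)`. -/

/-- The basis of the reduced symmetric coalgebra `S(W)`. -/
inductive Mon : Type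
  /-- `E n` is the monomial `e ^ (n + 1)`. -/
  | E (n : ℕ) : Mon
  /-- `F n` is the monomial `e ^ n * f`. -/
  | F (n : ℕ) : Mon

/-- The parity of a monomial. -/
def Mon.par : Mon → ZMod 2
  | .E _ => 0
  | .F _ => 1

/-- The basis of `W`. -/
inductive Gen : Type
  | e : Gen
  | f : Gen

/-- `S(W) ⊗ A`, as a right `A`-module: the sum of the `w ⊗ a` is the finitely supported function
with value `a` at the monomial `w`. -/
abbrev S (A : Type v) [Ring A] : Type v := Mon →₀ A

/-- `S(W) ⊗ S(W) ⊗ A = (S(W) ⊗ A) ⊗_A (S(W) ⊗ A)`, as a right `A`-module. -/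
abbrev SS (A : Type v) [Ring A] : Type v := Mon × Mon →₀ A

/-- The right `A`-linear map with given values on a basis. -/
def extend {A : Type v} [Ring A] {X Y : Type} (b : X → Y →₀ A) :
    (X →₀ A) →ₗ[Aᵐᵒᵖ] (Y →₀ A) where
  toFun x := x.sum fun i a => MulOpposite.op a • b i
  map_add' x y := by
    classical
    exact Finsupp.sum_add_index' (fun i => by simp) (fun i a c => by simp [add_smul])
  map_smul' c x := by
    rw [Finsupp.sum_of_support_subset (s := x.support) (f := c • x) Finsupp.support_smul _
      (fun i _ => by simp), Finsupp.sum, RingHom.id_apply, Finset.smul_sum]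
    refine Finset.sum_congr rfl fun i _ => ?_
    rw [smul_smul]
    rfl

/-- Right `A`-linear endomorphisms of `S(W) ⊗ A`. -/
abbrev End (A : Type v) [Ring A] : Type v := S A →ₗ[Aᵐᵒᵖ] S A

section Coalgebra

variable {A : Type v} [Ring A]

/-- The reduced coproduct on monomials, the sum over all unshuffles into two nonempty parts:
`Δ(e^N) = ∑_{0<k<N} C(N,k) e^k ⊗ e^(N-k)` and
`Δ(e^n f) = ∑_{0≤k<n} C(n,k) e^k f ⊗ e^(n-k) + ∑_{0<k≤n} C(n,k) e^k ⊗ e^(n-k) f`. -/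
def comulBasis : Mon → SS A
  | .E n => ∑ i ∈ Finset.range n,
      Finsupp.single (.E i, .E (n - 1 - i)) (((n + 1).choose (i + 1) : ℕ) : A)
  | .F n => ∑ i ∈ Finset.range n,
      (Finsupp.single (.F i, .E (n - 1 - i)) ((n.choose i : ℕ) : A)
        + Finsupp.single (.E i, .F (n - 1 - i)) ((n.choose (i + 1) : ℕ) : A))

/-- The coproduct `Δ` of `S(W) ⊗ A`. -/
def comul : S A →ₗ[Aᵐᵒᵖ] SS A := extend comulBasis

/-- `α ⊗ β` for right `A`-linear maps `α`, `β` homogeneous of degrees `p`, `q`, with the sign rule.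
If `α(x) = ∑ z a` and `β(y) = ∑ z' b`, then
`(α ⊗ β)(x ⊗ y) = ∑ (-1)^(q|x|) (z a) ⊗ (z' b) = ∑ (-1)^(q|x| + |a||z'|) (z ⊗ z') a b`,
where `|a| = p + |x| + |z|`. -/
def tensorMap (p q : ZMod 2) (α β : End A) : SS A →ₗ[Aᵐᵒᵖ] SS A :=
  extend fun x =>
    (α (Finsupp.single x.1 1)).sum fun z a =>
      (β (Finsupp.single x.2 1)).sum fun z' b =>
        sgn (q * x.1.par + (p + x.1.par + z.par) * z'.par) • Finsupp.single (z, z') (a * b)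

/-- Odd coderivations of `S(W) ⊗ A`: `Δ ∘ δ = (δ ⊗ I + I ⊗ δ) ∘ Δ`. -/
def IsOddCoderivation (δ : End A) : Prop :=
  comul ∘ₗ δ = (tensorMap 1 0 δ LinearMap.id + tensorMap 0 1 LinearMap.id δ) ∘ₗ comul

/-- Coalgebra morphisms: `Δ ∘ g = (g ⊗ g) ∘ Δ`. -/
def IsCoalgebraMorphism (g : End A) : Prop :=
  comul ∘ₗ g = tensorMap 0 0 g g ∘ₗ comul

/-- The pushforward of an endomorphism of `S(W) ⊗ A` along `A → B`; it is the endomorphism `δ'`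
of `S(W) ⊗ B` with `(I ⊗ φ) ∘ δ = δ' ∘ (I ⊗ φ)`. -/
def push {B : Type w} [Ring B] (φ : A →+* B) (δ : End A) : End B :=
  extend fun w => (δ (Finsupp.single w 1)).mapRange φ (map_zero φ)

variable {K : Type u} [Field K] [Algebra K A]

/-- `δ` is homogeneous of degree `p`. -/
def IsHomogeneous (𝒜 : ZMod 2 → Submodule K A) (p : ZMod 2) (δ : End A) : Prop :=
  ∀ w z : Mon, δ (Finsupp.single w 1) z ∈ 𝒜 (p + w.par + z.par)

/-- Codifferentials: odd coderivations of square zero. -/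
structure IsCodifferential (𝒜 : ZMod 2 → Submodule K A) (δ : End A) : Prop where
  odd : IsHomogeneous 𝒜 1 δ
  coder : IsOddCoderivation δ
  sq_zero : δ ∘ₗ δ = 0

/-- `δ` is a deformation with base `A` of the codifferential `d` of `S(W)`. -/
structure IsDeformation (𝒜 : ZMod 2 → Submodule K A) (ε : A →ₐ[K] K) (d : End K) (δ : End A) :
    Prop extends IsCodifferential 𝒜 δ where
  base : IsCodifferential (groundGrading K) d
  proj : push (ε : A →+* K) δ = d

/-- Equivalence of deformations with base `A`: `g⁻¹ ∘ δ₁ ∘ g = δ₂` for an (even) coalgebra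
automorphism `g` of `S(W) ⊗ A` with `(I ⊗ ε) ∘ g = I ⊗ ε`. -/
def Equivalent (𝒜 : ZMod 2 → Submodule K A) (ε : A →ₐ[K] K) (δ₁ δ₂ : End A) : Prop :=
  ∃ g : S A ≃ₗ[Aᵐᵒᵖ] S A, IsHomogeneous 𝒜 0 g.toLinearMap ∧ IsCoalgebraMorphism g.toLinearMap ∧
    (∀ x : S A, (g x).mapRange ε (map_zero ε) = x.mapRange ε (map_zero ε)) ∧
    g.symm.toLinearMap ∘ₗ δ₁ ∘ₗ g.toLinearMap = δ₂

/-- The deformation `δ` of `d`, with formal base `A`, is miniversal: every formal deformation of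
`d` is equivalent to a pushforward of `δ`, and the morphism of bases is unique if the target base
is infinitesimal. -/
structure IsMiniversal (𝒜 : ZMod 2 → Submodule K A) (ε : A →ₐ[K] K) (d : End K) (δ : End A) :
    Prop where
  formal : IsFormalBase 𝒜 ε
  deformation : IsDeformation 𝒜 ε d δ
  versal : ∀ (B : Type w) [Ring B] [Algebra K B] (ℬ : ZMod 2 → Submodule K B) (η : B →ₐ[K] K)
    (δ' : End B), IsFormalBase ℬ η → IsDeformation ℬ η d δ' →
      ∃ f : A →ₐ[K] B, IsBaseHom 𝒜 ε ℬ η f ∧ Equivalent ℬ η (push (f : A →+* B) δ) δ'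
  unique : ∀ (B : Type w) [Ring B] [Algebra K B] (ℬ : ZMod 2 → Submodule K B) (η : B →ₐ[K] K)
    (δ' : End B), IsInfinitesimalBase ℬ η → IsDeformation ℬ η d δ' →
      ∀ f₁ f₂ : A →ₐ[K] B, IsBaseHom 𝒜 ε ℬ η f₁ → IsBaseHom 𝒜 ε ℬ η f₂ →
        Equivalent ℬ η (push (f₁ : A →+* B) δ) δ' → Equivalent ℬ η (push (f₂ : A →+* B) δ) δ' →
          f₁ = f₂

/-- The deformation `δ` of `d`, with infinitesimal base `A`, is universal among the infinitesimal
deformations of `d`. -/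
structure IsUniversalInfinitesimal (𝒜 : ZMod 2 → Submodule K A) (ε : A →ₐ[K] K) (d : End K)
    (δ : End A) : Prop where
  infinitesimal : IsInfinitesimalBase 𝒜 ε
  deformation : IsDeformation 𝒜 ε d δ
  universal : ∀ (B : Type w) [Ring B] [Algebra K B] (ℬ : ZMod 2 → Submodule K B) (η : B →ₐ[K] K)
    (δ' : End B), IsInfinitesimalBase ℬ η → IsDeformation ℬ η d δ' →
      ∃! f : A →ₐ[K] B, IsBaseHom 𝒜 ε ℬ η f ∧ Equivalent ℬ η (push (f : A →+* B) δ) δ'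

end Coalgebra

/-! ### Cochains -/

/-- Cochains with coefficients in `A`, the elements of `Hom(S(W), W ⊗ A) = ∏_k L_k ⊗ A`:
`c w g` is the (right) coefficient of the basis vector `g` of `W` in the value at `w`. -/
abbrev Cochain (A : Type v) : Type v := Mon → Gen → A

section Cochains

variable {K : Type u} [Field K]

/-- `φ^k_e`, with `φ^k_e(e^k) = k! e` and zero on all other monomials. -/
def phiE (k : ℕ) : Cochain K
  | .E n, .e => if n + 1 = k then (k.factorial : K) else 0
  | _, _ => 0

/-- `φ^k_f`, with `φ^k_f(e^(k-1) f) = (k-1)! f` and zero on all other monomials. -/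
def phiF (k : ℕ) : Cochain K
  | .F n, .f => if n + 1 = k then ((k - 1).factorial : K) else 0
  | _, _ => 0

/-- `ψ^k_e`, with `ψ^k_e(e^(k-1) f) = (k-1)! e` and zero on all other monomials. -/
def psiE (k : ℕ) : Cochain K
  | .F n, .e => if n + 1 = k then ((k - 1).factorial : K) else 0
  | _, _ => 0

/-- `ψ^k_f`, with `ψ^k_f(e^k) = k! f` and zero on all other monomials. -/
def psiF (k : ℕ) : Cochain K
  | .E n, .f => if n + 1 = k then (k.factorial : K) else 0
  | _, _ => 0

/-- `h^k = φ^k_e + (k - L + 1) φ^k_f`. -/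
def hh (L k : ℕ) : Cochain K := phiE k + ((k : K) - (L : K) + 1) • phiF k

variable {A : Type v} [Ring A] [Algebra K A]

/-- `φ a` for an odd parameter `a`: `(φ a)(w) = (-1)^|w| φ(w) a`. -/
def timesOdd (c : Cochain K) (a : A) : Cochain A := fun w g => sgn w.par • (c w g • a)

/-- `φ a` for an even parameter `a`: `(φ a)(w) = φ(w) a`. -/
def timesEven (c : Cochain K) (a : A) : Cochain A := fun w g => c w g • a

/-- The coderivation of `S(W) ⊗ A` associated to an odd cochain `c`, i.e.
`w_1 ⋯ w_n ↦ ∑_σ ± c(w_σ(1) ⋯ w_σ(k)) w_σ(k+1) ⋯ w_σ(n)` over all unshuffles.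
The coefficient of `e` in `c(e^k)` is odd, whence the sign in the last term:
`(e a) (e^j f) = - e^(j+1) f a`; the coefficient of `f` there contributes nothing as `f^2 = 0`. -/
def coder (c : Cochain A) : End A :=
  extend fun w => match w with
    | .E n => ∑ i ∈ Finset.range (n + 1), (n + 1).choose (i + 1) •
        (Finsupp.single (Mon.E (n - i)) (c (.E i) .e)
          + Finsupp.single (Mon.F (n - i)) (c (.E i) .f))
    | .F n => ∑ i ∈ Finset.range (n + 1), n.choose i •
        (Finsupp.single (Mon.E (n - i)) (c (.F i) .e)
          + Finsupp.single (Mon.F (n - i)) (c (.F i) .f))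
        - ∑ i ∈ Finset.range n, n.choose (i + 1) • Finsupp.single (Mon.F (n - i)) (c (.E i) .e)

/-- The codifferential `ψ^L_e` of `S(W)`. -/
def dPsi (K : Type u) [Field K] (L : ℕ) : End K := coder (psiE L)

/-! The cochains of the deformations; `θ i` and `t i` stand for `θ_{i+1}` and `t_{i+1}`. -/

/-- `ψ^L_e + ∑_{0<k<L} h^k θ_k + ∑_{0<k<L} ψ^k_e t_k`, here with `L = n + 1`. -/
def firstOrder (K : Type u) [Field K] [Algebra K A] (n : ℕ) (θ t : Fin n → A) : Cochain A :=
  timesEven (psiE (n + 1) : Cochain K) 1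
    + ∑ i : Fin n, timesOdd (hh (n + 1) (i + 1) : Cochain K) (θ i)
    + ∑ i : Fin n, timesEven (psiE (i + 1) : Cochain K) (t i)

/-- `d^3_2 = d^3_1 + φ^1_f θ_2 t_2`. -/
def d32 (K : Type u) [Field K] [Algebra K A] (θ t : Fin 2 → A) : Cochain A :=
  firstOrder K 2 θ t + timesOdd (phiF 1 : Cochain K) (θ 1 * t 1)

/-- `d^4_2 = d^4_1 + ψ^1_f θ_2 θ_3 + φ^1_f (θ_2 t_3 + 2 θ_3 t_2) + φ^2_f θ_3 t_3`. -/
def d42 (K : Type u) [Field K] [Algebra K A] (θ t : Fin 3 → A) : Cochain A :=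
  firstOrder K 3 θ t + timesEven (psiF 1 : Cochain K) (θ 1 * θ 2)
    + timesOdd (phiF 1 : Cochain K) (θ 1 * t 2 + 2 * θ 2 * t 1)
    + timesOdd (phiF 2 : Cochain K) (θ 2 * t 2)

/-- `d^4_3 = d^4_2 - φ^1_f θ_3 t_3^2`. -/
def d43 (K : Type u) [Field K] [Algebra K A] (θ t : Fin 3 → A) : Cochain A :=
  d42 K θ t - timesOdd (phiF 1 : Cochain K) (θ 2 * t 2 ^ 2)

end Cochains

/-! ### Relations -/

section Relations

variable {A : Type v} [Ring A]

/-- The relation for `L = 2`. -/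
def rel2 (θ t : Fin 1 → A) : Set A := {θ 0 * t 0}

/-- The relations modulo `𝔪 ^ 3` for `L = 3`. -/
def rel3Quadratic (θ t : Fin 2 → A) : Set A :=
  {θ 0 * θ 1, θ 0 * t 0, θ 0 * t 1 + 2 * θ 1 * t 0}

/-- The relations `R_3`. -/
def rel3 (θ t : Fin 2 → A) : Set A :=
  {θ 0 * θ 1, 2 * θ 0 * t 0 - θ 1 * t 0 * t 1, θ 0 * t 1 + 2 * θ 1 * t 0 - θ 1 * t 1 ^ 2}

/-- The relations for `L = 4`. -/
def rel4 (θ t : Fin 3 → A) : Set A :=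
  {θ 1 * θ 2 * t 0,
   -(θ 0 * θ 1) + θ 1 * θ 2 * t 1,
   -2 * θ 0 * θ 2 + θ 1 * θ 2 * t 2,
   -3 * θ 0 * t 0 + θ 1 * t 0 * t 2 + 2 * θ 2 * t 0 * t 1 - θ 2 * t 0 * t 2 ^ 2,
   -2 * θ 0 * t 1 - 3 * θ 1 * t 0 + θ 1 * t 1 * t 2 + 2 * θ 2 * t 1 ^ 2 + θ 2 * t 0 * t 2
     - θ 2 * t 1 * t 2 ^ 2,
   -(θ 0 * t 2) - 2 * θ 1 * t 1 - 3 * θ 2 * t 0 + θ 1 * t 2 ^ 2 + 3 * θ 2 * t 1 * t 2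
     - θ 2 * t 2 ^ 3}

end Relations

/-! ### The algebras `K[[θ_1, …, θ_n, t_1, …, t_n]] / R` -/

section Presented

variable (K : Type u) [Field K] (n : ℕ)

/-- `K[[θ_1, …, θ_n, t_1, …, t_n]]`, with odd `θ_i` and even `t_i`: the exterior algebra on the
`θ_i` over the power series in the `t_i`. -/
abbrev Free : Type u :=
  ExteriorAlgebra (MvPowerSeries (Fin n) K) (Fin n → MvPowerSeries (Fin n) K)

/-- The odd parameter `θ_{i+1}`. -/
def freeTheta (i : Fin n) : Free K n := ExteriorAlgebra.ι _ (Pi.single i 1)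

/-- The even parameter `t_{i+1}`. -/
def freeT (i : Fin n) : Free K n := algebraMap (MvPowerSeries (Fin n) K) _ (MvPowerSeries.X i)

/-- The even and the odd part. -/
def freeGrading (i : ZMod 2) : Submodule K (Free K n) :=
  (CliffordAlgebra.evenOdd
    (0 : QuadraticForm (MvPowerSeries (Fin n) K) (Fin n → MvPowerSeries (Fin n) K)) i).restrictScalars K

/-- The augmentation: the constant coefficient. -/
def freeAug : Free K n →ₐ[K] K :=
  AlgHom.comp
    { (MvPowerSeries.constantCoeff : MvPowerSeries (Fin n) K →+* K) with
      commutes' := fun a => by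
        simp [MvPowerSeries.algebraMap_apply] }
    ((ExteriorAlgebra.algebraMapInv :
      Free K n →ₐ[MvPowerSeries (Fin n) K] MvPowerSeries (Fin n) K).restrictScalars K)

@[simp] lemma freeAug_theta (i : Fin n) : freeAug K n (freeTheta K n i) = 0 := by
  simp [freeAug, freeTheta, ExteriorAlgebra.algebraMapInv]

@[simp] lemma freeAug_t (i : Fin n) : freeAug K n (freeT K n i) = 0 := by
  have h : (ExteriorAlgebra.algebraMapInv :
      Free K n →ₐ[MvPowerSeries (Fin n) K] MvPowerSeries (Fin n) K) (freeT K n i)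
      = MvPowerSeries.X i := by
    rw [freeT, AlgHom.commutes]; rfl
  simp [freeAug, h]

variable {K n}

/-- The quotient by the two-sided ideal generated by `R`. -/
abbrev Base (R : Set (Free K n)) : Type u := (TwoSidedIdeal.span R).ringCon.Quotient

/-- The quotient map. -/
def proj (R : Set (Free K n)) : Free K n →ₐ[K] Base R :=
  RingCon.mkₐ K (TwoSidedIdeal.span R).ringCon

/-- The parameters `θ_i` in the quotient. -/
def theta (R : Set (Free K n)) (i : Fin n) : Base R := proj R (freeTheta K n i)

/-- The parameters `t_i` in the quotient. -/
def tt (R : Set (Free K n)) (i : Fin n) : Base R := proj R (freeT K n i)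

/-- The even and the odd part of the quotient. -/
def baseGrading (R : Set (Free K n)) (i : ZMod 2) : Submodule K (Base R) :=
  (freeGrading K n i).map (proj R).toLinearMap

/-- The augmentation of the quotient. -/
def baseAug (R : Set (Free K n)) (hR : ∀ r ∈ R, freeAug K n r = 0) : Base R →ₐ[K] K :=
  RingCon.liftₐ (TwoSidedIdeal.span R).ringCon (freeAug K n) (by
    have h : TwoSidedIdeal.span R ≤ TwoSidedIdeal.ker (freeAug K n) :=
      TwoSidedIdeal.span_le.2 fun r hr => (TwoSidedIdeal.mem_ker _).2 (hR r hr)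
    intro x y hxy
    have := (TwoSidedIdeal.mem_ker _).1 (h ((TwoSidedIdeal.rel_iff _ x y).1 hxy))
    rw [map_sub, sub_eq_zero] at this
    exact this)

variable (K n)

/-- The set `𝔪 ^ k` in `K[[θ, t]]`. -/
def mPow (k : ℕ) : Set (Free K n) := ((augIdeal (freeAug K n) ^ k : Submodule K (Free K n)) : Set _)

lemma aug_mPow (k : ℕ) : ∀ r ∈ mPow K n (k + 1), freeAug K n r = 0 := by
  intro r hr
  have h : augIdeal (freeAug K n) ^ (k + 1) ≤ augIdeal (freeAug K n) := by
    rw [pow_succ]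
    refine Submodule.mul_le.2 fun a _ b hb => ?_
    have hb' : freeAug K n b = 0 := hb
    show freeAug K n (a * b) = 0
    rw [map_mul, hb', mul_zero]
  exact h hr

/-- The relation for `L = 2` in `K[[θ, t]]`. -/
def R2 : Set (Free K 1) := rel2 (freeTheta K 1) (freeT K 1)

/-- The relations modulo `𝔪 ^ 3` for `L = 3` in `K[[θ, t]]`. -/
def R3Quadratic : Set (Free K 2) := rel3Quadratic (freeTheta K 2) (freeT K 2)

/-- The relations `R_3` in `K[[θ, t]]`. -/
def R3 : Set (Free K 2) := rel3 (freeTheta K 2) (freeT K 2)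

/-- The relations for `L = 4` in `K[[θ, t]]`. -/
def R4 : Set (Free K 3) := rel4 (freeTheta K 3) (freeT K 3)

lemma aug_R2 : ∀ r ∈ R2 K, freeAug K 1 r = 0 := by
  simp [R2, rel2]

lemma aug_R3 : ∀ r ∈ R3 K, freeAug K 2 r = 0 := by
  simp [R3, rel3]

lemma aug_R4 : ∀ r ∈ R4 K, freeAug K 3 r = 0 := by
  simp [R4, rel4]

end Presented

end LInfty

end

open LInfty

/-! The argument takes place on the dual side. A functional on `S(W) ⊗ A` is a function `p(x) + q(x)
ξ` of one even and one odd formal variable, where factorials absorb the binomial coefficients of the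
coproduct. Under this duality coalgebra morphisms become substitutions and odd coderivations become
odd vector fields `(α + β ξ) ∂_x + (γ + δ ξ) ∂_ξ` (`transpose_of_isOddCoderivation`,
`transpose_coder_ser`). The codifferential `ψ^{n+1}_e` is the field with `β = x^n` and `α = γ = δ =
0`, so `L = n + 1` throughout.

Over a formal base a deformation has `β ≡ x^n` modulo the maximal ideal. By Weierstrass division `β`
is a unit times a monic polynomial `x^n + ∑ t_k x^(k-1)`. The substitutions `x ↦ x`, `ξ ↦ c + d ξ`
suffice to remove the unit from `β` and to replace `α` by a remainder `∑ θ_k x^k` with `1 ≤ k ≤ n`;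
this is `IsFormalBase.exists_normalForm`. The square of the field vanishes on `x` exactly when `α' α
+ β γ = 0` and `α' β - β' α + β δ = 0`. Since `β` can be cancelled, these two equations determine
`γ` and `δ`, and they imply the two equations that express vanishing on `ξ`
(`IsFormalBase.isCodifferential`). So a normal form is a choice of parameters `(θ, t)` for which the
two divisions by `β` leave no remainder and the quotient `γ` has no constant term. These conditions
on `(θ, t)` are the stated relations, and the quotients are the higher order terms of the stated
deformations (`square_one`, `square_two`, `square_three`).

Versality follows, because parameters in a formal base `B` that satisfy the relations are values of
a morphism from `K[[θ, t]] / (R)` to `B` (`IsFormalBase.exists_baseHom`). For uniqueness over an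
infinitesimal base, `ψ^{n+1}_e` vanishes in degrees at most `n` and coalgebra morphisms do not raise
the degree, so equivalent deformations have the same entries there
(`IsInfinitesimalBase.apply_eq_of_equivalent`); the parameters are among these entries. That `K[[θ,
t]] / (R)` is itself a formal base holds because the exterior algebra is a finite module over a
complete Noetherian local ring (`isFormalBase_base`).

The ideals of `R_3` and of its quadratic truncation differ because `θ_2 t_1 t_2` is not in the
latter. This is visible after killing all products of two odd variables (`cubic_not_mem`). -/

noncomputable section
namespace LInfty
open PowerSeries

/-! ### Functionals on `S(W) ⊗ A` as power series in `x` and `ξ` -/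

/-- The functions `p + q ξ` on the formal `1|1`-dimensional space. -/
abbrev Fn (A : Type v) [Ring A] : Type v := A⟦X⟧ × A⟦X⟧

/-- The exponent of `e` in a monomial. -/
def Mon.pow : Mon → ℕ
  | .E n => n + 1
  | .F n => n

/-- The factorial of the exponent of `e`, which normalizes the duality with power series. -/
def Mon.fac (w : Mon) : ℕ := w.pow.factorial

section Functionals

variable {A : Type v} [Ring A]

lemma extend_single {X Y : Type} (b : X → Y →₀ A) (i : X) (a : A) :
    extend b (Finsupp.single i a) = MulOpposite.op a • b i := by
  show (Finsupp.single i a).sum (fun i a => MulOpposite.op a • b i) = _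
  simp

lemma extend_single_one {X Y : Type} (b : X → Y →₀ A) (i : X) :
    extend b (Finsupp.single i 1) = b i := by
  rw [extend_single]; simp

lemma single_eq_op_smul {X : Type} (i : X) (a : A) :
    Finsupp.single i a = MulOpposite.op a • Finsupp.single i (1 : A) := by
  simp

lemma opLinear_ext {X Y : Type} {f g : (X →₀ A) →ₗ[Aᵐᵒᵖ] (Y →₀ A)}
    (h : ∀ i, f (Finsupp.single i 1) = g (Finsupp.single i 1)) : f = g := by
  refine LinearMap.ext fun s => ?_
  induction s using Finsupp.induction_linear with
  | zero => simp
  | add s t hs ht => rw [map_add, map_add, hs, ht]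
  | single i a => rw [single_eq_op_smul, map_smul, map_smul, h]

/-- The coefficient of a function at the monomial dual to `w`. -/
def Mon.coeff : Mon → Fn A →+ A
  | .E n => (PowerSeries.coeff (n + 1)).toAddMonoidHom.comp (AddMonoidHom.fst _ _)
  | .F n => (PowerSeries.coeff n).toAddMonoidHom.comp (AddMonoidHom.snd _ _)

@[simp] lemma coeff_E (n : ℕ) (φ : Fn A) : (Mon.E n).coeff φ = PowerSeries.coeff (n + 1) φ.1 := rfl
@[simp] lemma coeff_F (n : ℕ) (φ : Fn A) : (Mon.F n).coeff φ = PowerSeries.coeff n φ.2 := rfl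

/-- The value of the functional `φ` on `s`. -/
def pair (φ : Fn A) (s : S A) : A := s.sum fun w a => w.fac • (w.coeff φ * a)

lemma pair_add (φ : Fn A) (s t : S A) : pair φ (s + t) = pair φ s + pair φ t := by
  classical
  exact Finsupp.sum_add_index' (fun i => by simp) (fun i a c => by simp [mul_add])

@[simp] lemma pair_single (φ : Fn A) (w : Mon) (a : A) :
    pair φ (Finsupp.single w a) = w.fac • (w.coeff φ * a) := by
  simp [pair]

@[simp] lemma pair_zero (φ : Fn A) : pair φ 0 = 0 := by simp [pair]

lemma pair_smul (φ : Fn A) (a : A) (s : S A) :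
    pair φ (MulOpposite.op a • s) = pair φ s * a := by
  induction s using Finsupp.induction_linear with
  | zero => simp
  | add s t hs ht => rw [smul_add, pair_add, hs, ht, pair_add, add_mul]
  | single i b => rw [Finsupp.smul_single, pair_single, pair_single, smul_mul_assoc, mul_assoc]; rfl

/-- The function whose functional is `z! z^*`. -/
def Mon.hat : Mon → Fn A
  | .E n => (X ^ (n + 1), 0)
  | .F n => (0, X ^ n)

lemma coeff_hat (w z : Mon) [Decidable (w = z)] :
    w.coeff (z.hat : Fn A) = if w = z then 1 else 0 := by
  cases w <;> cases z <;> simp [Mon.hat, PowerSeries.coeff_X_pow]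

lemma pair_hat (z : Mon) (s : S A) : pair z.hat s = z.fac • s z := by
  classical
  induction s using Finsupp.induction_linear with
  | zero => simp
  | add s t hs ht => rw [pair_add, hs, ht, Finsupp.add_apply, smul_add]
  | single i b =>
    rw [pair_single, coeff_hat, Finsupp.single_apply]
    split_ifs with h <;> simp [h]

/-- Characteristic zero makes the factorials in the pairing invertible, so identities may be checked
after multiplication by them. -/
lemma fac_smul_cancel (K : Type u) [Field K] [CharZero K] [Algebra K A] {m : ℕ} {a b : A}
    (h : m.factorial • a = m.factorial • b) : a = b := by
  have hm : (m.factorial : K) ≠ 0 := Nat.cast_ne_zero.2 m.factorial_ne_zero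
  rw [← Nat.cast_smul_eq_nsmul K, ← Nat.cast_smul_eq_nsmul K] at h
  simpa [smul_smul, hm] using congrArg ((m.factorial : K)⁻¹ • ·) h

variable (K : Type u) [Field K] [Algebra K A]

/-- The transpose `φ ↦ φ ∘ δ` of an endomorphism. -/
def transpose (δ : End A) (φ : Fn A) : Fn A :=
  (PowerSeries.mk fun m => match m with
    -- The reduced coalgebra has no monomial dual to the constant function, so the pairing cannot
    -- see this coefficient; it is set to zero.
    | 0 => 0
    | m + 1 => ((m + 1).factorial : K)⁻¹ • pair φ (δ (Finsupp.single (.E m) 1)),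
   PowerSeries.mk fun m => (m.factorial : K)⁻¹ • pair φ (δ (Finsupp.single (.F m) 1)))

@[simp] lemma coeff_zero_transpose (δ : End A) (φ : Fn A) :
    PowerSeries.coeff 0 (transpose K δ φ).1 = 0 := by
  simp [transpose]

variable [CharZero K]

lemma transpose_spec (δ : End A) (φ : Fn A) (w : Mon) :
    w.fac • w.coeff (transpose K δ φ) = pair φ (δ (Finsupp.single w 1)) := by
  have h : ∀ m : ℕ, (m.factorial : K) ≠ 0 := fun m => Nat.cast_ne_zero.2 m.factorial_ne_zero
  rw [← Nat.cast_smul_eq_nsmul K]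
  cases w with
  | E n => simp [transpose, Mon.fac, Mon.pow, smul_smul, h]
  | F n => simp [transpose, Mon.fac, Mon.pow, smul_smul, h]

/-- The constant term of the even part pairs with nothing in the reduced coalgebra, hence the
separate hypothesis on it. -/
lemma Fn_ext (K : Type u) [Field K] [CharZero K] [Algebra K A] {φ ψ : Fn A} (h0 : PowerSeries.coeff 0 φ.1 = PowerSeries.coeff 0 ψ.1)
    (h : ∀ w : Mon, w.fac • w.coeff φ = w.fac • w.coeff ψ) : φ = ψ := by
  refine Prod.ext (PowerSeries.ext fun n => ?_) (PowerSeries.ext fun n => ?_)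
  · cases n with
    | zero => exact h0
    | succ n => exact fac_smul_cancel K (h (.E n))
  · exact fac_smul_cancel K (h (.F n))

lemma transpose_eq {δ : End A} {φ ψ : Fn A} (h0 : PowerSeries.coeff 0 ψ.1 = 0)
    (h : ∀ w : Mon, pair φ (δ (Finsupp.single w 1)) = w.fac • w.coeff ψ) :
    transpose K δ φ = ψ :=
  Fn_ext K (by simp [h0]) fun w => by rw [transpose_spec, h]

lemma pair_apply (δ : End A) (φ : Fn A) (s : S A) : pair φ (δ s) = pair (transpose K δ φ) s := by
  induction s using Finsupp.induction_linear with
  | zero => simp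
  | add s t hs ht => rw [map_add, pair_add, hs, ht, pair_add]
  | single i b =>
    rw [pair_single, single_eq_op_smul, map_smul, pair_smul, ← transpose_spec K, smul_mul_assoc]

lemma transpose_comp (α β : End A) (φ : Fn A) :
    transpose K (α ∘ₗ β) φ = transpose K β (transpose K α φ) :=
  transpose_eq K (by simp) fun w => by
    rw [LinearMap.comp_apply, pair_apply K, transpose_spec]

lemma transpose_id (φ : Fn A) (h : PowerSeries.coeff 0 φ.1 = 0) :
    transpose K (LinearMap.id : End A) φ = φ :=
  transpose_eq K h fun w => by simp

lemma transpose_zero (φ : Fn A) : transpose K (0 : End A) φ = 0 :=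
  transpose_eq K (by simp) fun w => by simp

/-- Coefficients of an endomorphism from its transpose. -/
lemma fac_smul_apply (δ : End A) (w z : Mon) :
    z.fac • δ (Finsupp.single w 1) z = w.fac • w.coeff (transpose K δ z.hat) := by
  rw [transpose_spec, pair_hat]

/-- The coefficients of the transpose at the dual monomials are, up to factorials, the matrix
entries. -/
lemma End_ext {α β : End A} (h : ∀ z : Mon, transpose K α z.hat = transpose K β z.hat) :
    α = β := by
  refine opLinear_ext fun w => Finsupp.ext fun z => ?_
  apply fac_smul_cancel K (m := z.pow)
  show z.fac • _ = z.fac • _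
  rw [fac_smul_apply K, fac_smul_apply K, h]

/-- A pairing as a sum over all monomials up to a large degree. -/
lemma pair_eq_sum (φ : Fn A) (s : S A) (N : ℕ)
    (h : ∀ z ∈ s.support, z.pow ≤ N) :
    pair φ s = ∑ n ∈ Finset.range N, (Mon.E n).coeff φ * pair (Mon.E n).hat s
      + ∑ n ∈ Finset.range (N + 1), (Mon.F n).coeff φ * pair (Mon.F n).hat s := by
  classical
  have hs : s.support ⊆ (Finset.range N).image Mon.E ∪ (Finset.range (N + 1)).image Mon.F := by
    intro z hz
    have := h z hz
    cases z with
    | E n => simp [Mon.pow] at this ⊢; omega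
    | F n => simp [Mon.pow] at this ⊢; omega
  rw [pair, Finsupp.sum_of_support_subset s hs _ (by simp), Finset.sum_union, Finset.sum_image,
    Finset.sum_image]
  · simp only [pair_hat, mul_smul_comm]
  · intro a _ b _ h; simpa using h
  · intro a _ b _ h; simpa using h
  · rw [Finset.disjoint_left]
    intro z hz hz'
    simp only [Finset.mem_image] at hz hz'
    obtain ⟨a, -, rfl⟩ := hz
    obtain ⟨b, -, hb⟩ := hz'
    exact Mon.noConfusion hb

lemma coeff_mul_eq_sum (p r : A⟦X⟧) (m N : ℕ) (h : m ≤ N) :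
    PowerSeries.coeff m (p * r)
      = ∑ n ∈ Finset.range (N + 1), PowerSeries.coeff n p * PowerSeries.coeff m (X ^ n * r) := by
  rw [PowerSeries.coeff_mul, Finset.Nat.sum_antidiagonal_eq_sum_range_succ_mk,
    ← Finset.sum_subset (Finset.range_mono (Nat.succ_le_succ h))]
  · refine Finset.sum_congr rfl fun n hn => ?_
    rw [PowerSeries.coeff_X_pow_mul', if_pos (by simpa [Nat.lt_succ_iff] using hn)]
  · intro n _ hn
    rw [PowerSeries.coeff_X_pow_mul', if_neg (by simpa [Nat.lt_succ_iff] using hn), mul_zero]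

/-- Maps of functions that are determined by their values on monomials, through locally finite
sums. -/
def IsLocal (T : Fn A → Fn A) : Prop :=
  ∀ (φ : Fn A) (w : Mon), ∃ N₀, ∀ N ≥ N₀, w.coeff (T φ)
    = ∑ n ∈ Finset.range N, PowerSeries.coeff (n + 1) φ.1 * w.coeff (T (Mon.E n).hat)
      + ∑ n ∈ Finset.range (N + 1), PowerSeries.coeff n φ.2 * w.coeff (T (Mon.F n).hat)

/-- The image of a single monomial under `δ` has finite support, so each coefficient of the
transpose involves only finitely many coefficients of `φ`. This replaces continuity when passing
from monomials to power series. -/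
lemma isLocal_transpose (δ : End A) : IsLocal (transpose K δ) := by
  intro φ w
  refine ⟨(δ (Finsupp.single w 1)).support.sup Mon.pow, fun N hN =>
    fac_smul_cancel K (m := w.pow) ?_⟩
  show w.fac • _ = w.fac • _
  rw [transpose_spec, pair_eq_sum _ _ N fun z hz => (Finset.le_sup (f := Mon.pow) hz).trans hN]
  simp only [smul_add, Finset.smul_sum, ← transpose_spec K, coeff_E, coeff_F, mul_smul_comm]

lemma IsLocal.eq (K : Type u) [Field K] [CharZero K] [Algebra K A] {T T' : Fn A → Fn A} (hT : IsLocal T) (hT' : IsLocal T')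
    (h0 : ∀ φ, PowerSeries.coeff 0 (T φ).1 = PowerSeries.coeff 0 (T' φ).1)
    (h : ∀ z : Mon, T z.hat = T' z.hat) (φ : Fn A) : T φ = T' φ := by
  refine Fn_ext K (h0 φ) fun w => ?_
  obtain ⟨N, hN⟩ := hT φ w
  obtain ⟨N', hN'⟩ := hT' φ w
  rw [hN _ (le_max_left N N'), hN' _ (le_max_right N N')]
  simp only [h]

end Functionals

end LInfty
end

noncomputable section
namespace LInfty
open PowerSeries

/-! ### Coderivations and coalgebra morphisms through their transposes -/

section Transposes

variable {A : Type v} [Ring A]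

/-- The product of functions, up to signs `s`, `t` which depend on the parities involved. -/
def mulFn (s t : ℤ) (φ ψ : Fn A) : Fn A :=
  (s • (φ.1 * ψ.1), t • (φ.2 * ψ.1) + s • (φ.1 * ψ.2))

/-- The coefficient of `tensorMap p q α β` at `x ↦ z`, `y ↦ z'` has the sign
`tensorSign p q x.par z z'`. -/
def tensorSign (p q i : ZMod 2) (z z' : Mon) : ℤ := sgn (q * i + (p + i + z.par) * z'.par)

lemma tensorMap_single_apply (p q : ZMod 2) (α β : End A) (x y z z' : Mon) (a : A) :
    tensorMap p q α β (Finsupp.single (x, y) a) (z, z')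
      = tensorSign p q x.par z z' •
        (α (Finsupp.single x 1) z * β (Finsupp.single y 1) z' * a) := by
  classical
  rw [tensorMap, extend_single, Finsupp.smul_apply, MulOpposite.smul_eq_mul_unop,
    MulOpposite.unop_op]
  rw [← smul_mul_assoc]
  congr 1
  rw [Finsupp.sum, Finsupp.finsetSum_apply]
  rw [Finset.sum_eq_single z]
  · rw [Finsupp.sum, Finsupp.finsetSum_apply, Finset.sum_eq_single z']
    · simp [tensorSign]
    · intro b _ hb
      simp [hb]
    · intro h
      rw [Finsupp.notMem_support_iff.1 h]
      simp
  · intro b _ hb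
    rw [Finsupp.sum, Finsupp.finsetSum_apply]
    refine Finset.sum_eq_zero fun c _ => ?_
    simp [hb]
  · intro h
    rw [Finsupp.notMem_support_iff.1 h]
    simp [Finsupp.sum]

variable (K : Type u) [Field K] [CharZero K] [Algebra K A]

lemma fac_smul_mul (α β : End A) (x y z z' : Mon) :
    (z.fac * z'.fac) • (α (Finsupp.single x 1) z * β (Finsupp.single y 1) z')
      = (x.fac * y.fac) •
        (x.coeff (transpose K α z.hat) * y.coeff (transpose K β z'.hat)) := by
  rw [mul_smul, ← mul_smul_comm, ← smul_mul_assoc, fac_smul_apply K, fac_smul_apply K,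
    smul_mul_assoc, mul_smul_comm, ← mul_smul]

/-- The coordinate of a weighted coproduct, as a coefficient of a product of functions. -/
lemma fac_smul_tensorMap_comul (p q : ZMod 2) (α β : End A) (w z z' : Mon) :
    (z.fac * z'.fac) • tensorMap p q α β (comul (Finsupp.single w 1)) (z, z')
      = w.fac • w.coeff (mulFn (tensorSign p q 0 z z') (tensorSign p q 1 z z')
        (transpose K α z.hat) (transpose K β z'.hat)) := by
  -- A term of the coproduct has a binomial coefficient `c`, and `c` times the factorials of the two
  -- factors is the factorial of `w`. This turns the coproduct into the plain Cauchy product.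
  have key : ∀ (x y : Mon) (c : ℕ), c * (x.fac * y.fac) = w.fac →
      (z.fac * z'.fac) • tensorMap p q α β (Finsupp.single (x, y) (c : A)) (z, z')
        = w.fac • tensorSign p q x.par z z' •
          (x.coeff (transpose K α z.hat) * y.coeff (transpose K β z'.hat)) := by
    intro x y c h
    rw [tensorMap_single_apply, smul_comm, ← nsmul_eq_mul', smul_comm _ c,
      fac_smul_mul K, ← mul_smul, h, smul_comm]
  have h0 := coeff_zero_transpose K α z.hat
  have h0' := coeff_zero_transpose K β z'.hat
  rw [comul, extend_single_one]
  cases w with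
  | E n =>
    rw [comulBasis, map_sum, Finsupp.finsetSum_apply, Finset.smul_sum, coeff_E, mulFn]
    simp only [map_zsmul]
    -- The Cauchy product has two boundary terms which the reduced coproduct lacks; they vanish
    -- since transposes have no constant term.
    rw [PowerSeries.coeff_mul, Finset.Nat.sum_antidiagonal_eq_sum_range_succ_mk,
      Finset.sum_range_succ, Finset.sum_range_succ']
    simp only [h0, h0', tsub_self, zero_mul, mul_zero, add_zero, Finset.smul_sum]
    refine Finset.sum_congr rfl fun i hi => ?_
    rw [Finset.mem_range] at hi
    rw [key]
    · rw [coeff_E, coeff_E, show n + 1 - (i + 1) = n - 1 - i + 1 by omega]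
      rfl
    · show _ * ((i + 1).factorial * (n - 1 - i + 1).factorial) = (n + 1).factorial
      rw [show n - 1 - i + 1 = n + 1 - (i + 1) by omega, ← mul_assoc]
      exact Nat.choose_mul_factorial_mul_factorial (by omega)
  | F n =>
    rw [comulBasis, map_sum, Finsupp.finsetSum_apply, Finset.smul_sum, coeff_F, mulFn]
    simp only [map_zsmul, map_add, Finsupp.add_apply, smul_add, Finset.sum_add_distrib]
    congr 1
    · rw [PowerSeries.coeff_mul, Finset.Nat.sum_antidiagonal_eq_sum_range_succ_mk,
        Finset.sum_range_succ]
      simp only [h0', tsub_self, mul_zero, add_zero, Finset.smul_sum]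
      refine Finset.sum_congr rfl fun i hi => ?_
      rw [Finset.mem_range] at hi
      rw [key]
      · rw [coeff_E, coeff_F, show n - 1 - i + 1 = n - i by omega]
        rfl
      · show _ * (i.factorial * (n - 1 - i + 1).factorial) = n.factorial
        rw [show n - 1 - i + 1 = n - i by omega, ← mul_assoc]
        exact Nat.choose_mul_factorial_mul_factorial (by omega)
    · rw [PowerSeries.coeff_mul, Finset.Nat.sum_antidiagonal_eq_sum_range_succ_mk,
        Finset.sum_range_succ']
      simp only [h0, zero_mul, add_zero, Finset.smul_sum]
      refine Finset.sum_congr rfl fun i hi => ?_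
      rw [Finset.mem_range] at hi
      rw [key]
      · rw [coeff_E, coeff_F, show n - (i + 1) = n - 1 - i by omega]
        rfl
      · show _ * ((i + 1).factorial * (n - 1 - i).factorial) = n.factorial
        rw [show n - 1 - i = n - (i + 1) by omega, ← mul_assoc]
        exact Nat.choose_mul_factorial_mul_factorial (by omega)

lemma constantCoeff_mulFn {s t : ℤ} {φ ψ : Fn A} (h : PowerSeries.coeff 0 φ.1 = 0) :
    PowerSeries.coeff 0 (mulFn s t φ ψ).1 = 0 := by
  simp only [PowerSeries.coeff_zero_eq_constantCoeff] at h
  simp [mulFn, h]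

lemma coeff_zero_hat (z : Mon) : PowerSeries.coeff 0 (z.hat : Fn A).1 = 0 := by
  cases z <;> simp [Mon.hat]

lemma transpose_id_hat (z : Mon) :
    transpose K (LinearMap.id : End A) z.hat = z.hat :=
  transpose_id K _ (coeff_zero_hat z)

lemma sgn_eq_one {p : ZMod 2} (h : p = 0) : sgn p = 1 := by simp [sgn, h]

lemma tensorMap_id_id :
    tensorMap 0 0 (LinearMap.id : End A) LinearMap.id = LinearMap.id := by
  refine opLinear_ext fun ⟨x, y⟩ => Finsupp.ext fun ⟨z, z'⟩ => ?_
  classical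
  rw [tensorMap_single_apply]
  simp only [LinearMap.id_apply, Finsupp.single_apply, Prod.mk.injEq]
  by_cases hx : x = z
  · by_cases hy : y = z'
    · have h : tensorSign 0 0 x.par z z' = 1 := by
        apply sgn_eq_one
        rw [hx, zero_mul, zero_add, zero_add, CharTwo.add_self_eq_zero, zero_mul]
      simp [hx, hy] at h ⊢
      simp [h]
    · simp [hy]
  · simp [hx]

/-- The function of `Δ^*(z^* ⊗ z'^*)`. -/
def hatMul (z z' : Mon) : Fn A :=
  mulFn (tensorSign 0 0 0 z z') (tensorSign 0 0 1 z z') z.hat z'.hat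

lemma fac_smul_comul (K : Type u) [Field K] [CharZero K] [Algebra K A] (s : S A) (z z' : Mon) :
    (z.fac * z'.fac) • comul s (z, z') = pair (hatMul z z') s := by
  induction s using Finsupp.induction_linear with
  | zero => simp
  | add s t hs ht => rw [map_add, Finsupp.add_apply, smul_add, hs, ht, pair_add]
  | single i a =>
    rw [single_eq_op_smul, map_smul, pair_smul, Finsupp.smul_apply,
      MulOpposite.smul_eq_mul_unop, MulOpposite.unop_op, ← smul_mul_assoc]
    congr 1
    have h := fac_smul_tensorMap_comul K 0 0 (LinearMap.id : End A) LinearMap.id i z z'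
    rw [tensorMap_id_id, LinearMap.id_apply, transpose_id_hat, transpose_id_hat] at h
    rw [h, pair_single, mul_one]
    rfl


lemma fac_mul_cancel (K : Type u) [Field K] [CharZero K] [Algebra K A] {z z' : Mon} {a b : A}
    (h : (z.fac * z'.fac) • a = (z.fac * z'.fac) • b) : a = b := by
  rw [mul_smul, mul_smul] at h
  exact fac_smul_cancel K (fac_smul_cancel K h)

/-- Dualizing the coproduct gives the product of functions, so the coderivation identity is the
signed Leibniz rule. Testing it on pairs of monomials suffices, because these detect all coordinates
of `S(W) ⊗ S(W) ⊗ A`. -/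
lemma isOddCoderivation_iff (δ : End A) : IsOddCoderivation δ ↔ ∀ z z' : Mon,
    transpose K δ (hatMul z z')
      = mulFn (tensorSign 1 0 0 z z') (tensorSign 1 0 1 z z') (transpose K δ z.hat) z'.hat
        + mulFn (tensorSign 0 1 0 z z') (tensorSign 0 1 1 z z') z.hat (transpose K δ z'.hat) := by
  have key : ∀ w z z' : Mon, (z.fac * z'.fac) •
      ((tensorMap 1 0 δ LinearMap.id + tensorMap 0 1 LinearMap.id δ) ∘ₗ comul)
        (Finsupp.single w 1) (z, z') = w.fac • w.coeff
      (mulFn (tensorSign 1 0 0 z z') (tensorSign 1 0 1 z z') (transpose K δ z.hat) z'.hat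
        + mulFn (tensorSign 0 1 0 z z') (tensorSign 0 1 1 z z') z.hat (transpose K δ z'.hat)) := by
    intro w z z'
    rw [LinearMap.comp_apply, LinearMap.add_apply, Finsupp.add_apply, smul_add,
      fac_smul_tensorMap_comul K, fac_smul_tensorMap_comul K, transpose_id_hat, transpose_id_hat,
      map_add, smul_add]
  constructor
  · intro h z z'
    refine transpose_eq K ?_ fun w => ?_
    · rw [Prod.fst_add, map_add, constantCoeff_mulFn (coeff_zero_transpose K _ _),
        constantCoeff_mulFn (coeff_zero_hat z), add_zero]
    · rw [← fac_smul_comul K, ← key, ← h]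
      rfl
  · intro h
    refine opLinear_ext fun w => Finsupp.ext fun ⟨z, z'⟩ => fac_mul_cancel K (z := z) (z' := z') ?_
    rw [key, ← h, transpose_spec, ← fac_smul_comul K]
    rfl

/-- For the same reason, coalgebra morphisms are dual to multiplicative maps of functions. -/
lemma isCoalgebraMorphism_iff (g : End A) : IsCoalgebraMorphism g ↔ ∀ z z' : Mon,
    transpose K g (hatMul z z')
      = mulFn (tensorSign 0 0 0 z z') (tensorSign 0 0 1 z z') (transpose K g z.hat)
        (transpose K g z'.hat) := by
  constructor
  · intro h z z'
    refine transpose_eq K (constantCoeff_mulFn (coeff_zero_transpose K _ _)) fun w => ?_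
    rw [← fac_smul_comul K, ← fac_smul_tensorMap_comul K, ← LinearMap.comp_apply, h]
    rfl
  · intro h
    refine opLinear_ext fun w => Finsupp.ext fun ⟨z, z'⟩ => fac_mul_cancel K (z := z) (z' := z') ?_
    rw [LinearMap.comp_apply, LinearMap.comp_apply, fac_smul_tensorMap_comul K, ← h,
      transpose_spec, ← fac_smul_comul K]

end Transposes

end LInfty
end

noncomputable section
namespace LInfty
open PowerSeries

/-! ### Vector fields -/

section VectorFields

variable {A : Type v} [Ring A]

/-- The derivative of a power series. -/
def dX : A⟦X⟧ →+ A⟦X⟧ where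
  toFun p := PowerSeries.mk fun n => (n + 1) • PowerSeries.coeff (n + 1) p
  map_zero' := by ext; simp
  map_add' p q := by ext; simp

@[simp] lemma coeff_dX (n : ℕ) (p : A⟦X⟧) :
    PowerSeries.coeff n (dX p) = (n + 1) • PowerSeries.coeff (n + 1) p := by
  simp [dX]

lemma dX_mul (p q : A⟦X⟧) : dX (p * q) = dX p * q + p * dX q := by
  ext n
  rw [coeff_dX, map_add, PowerSeries.coeff_mul, PowerSeries.coeff_mul, PowerSeries.coeff_mul]
  -- The weight `n + 1` is the sum of the two exponents of each term; one summand differentiates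
  -- `p`, the other `q`.
  have h : (n + 1) • ∑ x ∈ Finset.HasAntidiagonal.antidiagonal (n + 1),
      PowerSeries.coeff x.1 p * PowerSeries.coeff x.2 q
      = ∑ x ∈ Finset.HasAntidiagonal.antidiagonal (n + 1),
        x.1 • (PowerSeries.coeff x.1 p * PowerSeries.coeff x.2 q)
      + ∑ x ∈ Finset.HasAntidiagonal.antidiagonal (n + 1),
        x.2 • (PowerSeries.coeff x.1 p * PowerSeries.coeff x.2 q) := by
    rw [Finset.smul_sum, ← Finset.sum_add_distrib]
    refine Finset.sum_congr rfl fun x hx => ?_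
    rw [← add_smul, Finset.HasAntidiagonal.mem_antidiagonal.1 hx]
  rw [h, Finset.Nat.sum_antidiagonal_succ, Finset.Nat.sum_antidiagonal_succ']
  simp only [zero_smul, zero_add, coeff_dX, smul_mul_assoc, mul_smul_comm]

@[simp] lemma dX_X_pow (n : ℕ) : dX (X ^ n : A⟦X⟧) = n • X ^ (n - 1) := by
  ext m
  cases n with
  | zero => simp [PowerSeries.coeff_one]
  | succ n =>
    rw [coeff_dX, map_nsmul, PowerSeries.coeff_X_pow, PowerSeries.coeff_X_pow]
    by_cases h : m = n <;> simp [h]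

lemma dX_X : dX (X : A⟦X⟧) = 1 := by
  simpa using dX_X_pow (A := A) 1

lemma dX_one : dX (1 : A⟦X⟧) = 0 := by
  simpa using dX_X_pow (A := A) 0

lemma coeff_mul_range (p r : A⟦X⟧) (m : ℕ) : PowerSeries.coeff m (p * r)
    = ∑ i ∈ Finset.range (m + 1), PowerSeries.coeff (m - i) p * PowerSeries.coeff i r := by
  rw [PowerSeries.coeff_mul, ← Finset.Nat.sum_antidiagonal_swap,
    Finset.Nat.sum_antidiagonal_eq_sum_range_succ_mk]
  rfl

lemma coeff_mul_range_pos (p : A⟦X⟧) {r : A⟦X⟧} (h : PowerSeries.coeff 0 r = 0) (m : ℕ) :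
    PowerSeries.coeff m (p * r) = ∑ i ∈ Finset.range m,
      PowerSeries.coeff (m - (i + 1)) p * PowerSeries.coeff (i + 1) r := by
  rw [coeff_mul_range, Finset.sum_range_succ', h, mul_zero, add_zero]

/-- The transpose of the coderivation with cochain `(α + β ξ) ∂_x + (γ + δ ξ) ∂_ξ`. -/
def vf (α β γ δ : A⟦X⟧) (φ : Fn A) : Fn A :=
  (dX φ.1 * α + φ.2 * γ, dX φ.1 * β - dX φ.2 * α + φ.2 * δ)

/-- The cochain with the given coefficient series. -/
def ser (α β γ δ : A⟦X⟧) : Cochain A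
  | .E n, .e => (n + 1).factorial • PowerSeries.coeff (n + 1) α
  | .F n, .e => n.factorial • PowerSeries.coeff n β
  | .E n, .f => (n + 1).factorial • PowerSeries.coeff (n + 1) γ
  | .F n, .f => n.factorial • PowerSeries.coeff n δ

lemma choose_mul_aux {n i : ℕ} (h : i ≤ n) :
    (n + 1).choose (i + 1) * ((n - i).factorial * (i + 1).factorial) = (n + 1).factorial := by
  rw [← Nat.choose_mul_factorial_mul_factorial (Nat.succ_le_succ h), Nat.succ_sub_succ,
    Nat.succ_eq_add_one]
  ring

lemma choose_mul_aux' {n i : ℕ} (h : i ≤ n) :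
    n.choose i * ((n - i).factorial * i.factorial) = n.factorial := by
  rw [← Nat.choose_mul_factorial_mul_factorial h]
  ring

variable (K : Type u) [Field K] [CharZero K] [Algebra K A]

/-- The pairing as a group homomorphism. -/
def pairHom (φ : Fn A) : S A →+ A := ⟨⟨pair φ, pair_zero φ⟩, pair_add φ⟩

lemma pairHom_apply (φ : Fn A) (s : S A) : pairHom φ s = pair φ s := rfl

/-- This is the dictionary between cochains and vector fields: the four series are the generating
series of the four types of cochain. The constant terms of `α` and `γ` must vanish since `ser` does
not record them. -/
lemma transpose_coder_ser {α β γ δ : A⟦X⟧} (hα : PowerSeries.coeff 0 α = 0)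
    (hγ : PowerSeries.coeff 0 γ = 0) (φ : Fn A) :
    transpose K (coder (ser α β γ δ)) φ = vf α β γ δ φ := by
  refine transpose_eq K ?_ fun w => ?_
  · rw [vf, map_add, coeff_mul_range_pos _ hα, coeff_mul_range_pos _ hγ]
    simp
  rw [coder, extend_single_one, ← pairHom_apply]
  cases w with
  | E n =>
    simp only [map_sum, map_nsmul, map_add, pairHom_apply, pair_single, coeff_E, coeff_F, vf]
    rw [coeff_mul_range_pos _ hα, coeff_mul_range_pos _ hγ, ← Finset.sum_add_distrib,
      Finset.smul_sum]
    refine Finset.sum_congr rfl fun i hi => ?_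
    have hi : i ≤ n := Nat.lt_succ_iff.1 (Finset.mem_range.1 hi)
    simp only [Mon.fac, Mon.pow, ser, smul_add, coeff_dX, Nat.succ_sub_succ, mul_smul_comm,
      smul_mul_assoc, smul_smul, ← choose_mul_aux hi, Nat.factorial_succ (n - i)]
    congr 2
    all_goals ring
  | F n =>
    simp only [map_sum, map_nsmul, map_add, map_sub, pairHom_apply, pair_single, coeff_E, coeff_F,
      vf]
    rw [coeff_mul_range _ β, coeff_mul_range _ δ, coeff_mul_range_pos _ hα, sub_add_eq_add_sub,
      ← Finset.sum_add_distrib, smul_sub, Finset.smul_sum, Finset.smul_sum]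
    congr 1
    · refine Finset.sum_congr rfl fun i hi => ?_
      have hi : i ≤ n := Nat.lt_succ_iff.1 (Finset.mem_range.1 hi)
      simp only [Mon.fac, Mon.pow, ser, smul_add, coeff_dX, mul_smul_comm,
        smul_mul_assoc, smul_smul, ← choose_mul_aux' hi, Nat.factorial_succ (n - i)]
      congr 2
      all_goals ring
    · refine Finset.sum_congr rfl fun i hi => ?_
      have hi : i + 1 ≤ n := Finset.mem_range.1 hi
      obtain ⟨m, rfl⟩ := Nat.exists_eq_add_of_le hi
      have h1 : i + 1 + m - i = m + 1 := by omega
      have h2 : i + 1 + m - (i + 1) = m := by omega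
      have h3 := choose_mul_aux' hi
      rw [h2] at h3
      rw [coeff_dX, h2]
      simp only [Mon.fac, Mon.pow, ser, mul_smul_comm, h1,
        smul_mul_assoc, smul_smul, ← h3, Nat.factorial_succ m]
      congr 1; ring

lemma vf_coeff_zero {α β γ δ : A⟦X⟧} (hα : PowerSeries.coeff 0 α = 0)
    (hγ : PowerSeries.coeff 0 γ = 0) (φ : Fn A) : PowerSeries.coeff 0 (vf α β γ δ φ).1 = 0 := by
  rw [vf, map_add, coeff_mul_range_pos _ hα, coeff_mul_range_pos _ hγ]
  simp

/-- A coefficient of `vf` at `w` only involves the coefficients of `φ` of exponent at most one above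
that of `w`. -/
lemma isLocal_vf {α β γ δ : A⟦X⟧} : IsLocal (vf α β γ δ) := by
  have key : ∀ (p r : A⟦X⟧) (m N : ℕ), m < N → PowerSeries.coeff m (dX p * r)
      = ∑ n ∈ Finset.range N, PowerSeries.coeff (n + 1) p *
        PowerSeries.coeff m (dX (X ^ (n + 1)) * r) := by
    intro p r m N h
    obtain ⟨N, rfl⟩ := Nat.exists_eq_succ_of_ne_zero (Nat.ne_of_gt (Nat.zero_lt_of_lt h))
    rw [coeff_mul_eq_sum _ _ m N (Nat.le_of_lt_succ h)]
    refine Finset.sum_congr rfl fun n _ => ?_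
    rw [dX_X_pow, coeff_dX, smul_mul_assoc, smul_mul_assoc, map_nsmul, mul_smul_comm]
    rfl
  have key' : ∀ (p r : A⟦X⟧) (m N : ℕ), m < N → PowerSeries.coeff m (dX p * r)
      = ∑ n ∈ Finset.range (N + 1), PowerSeries.coeff n p *
        PowerSeries.coeff m (dX (X ^ n) * r) := by
    intro p r m N h
    rw [Finset.sum_range_succ', ← key p r m N h]
    simp [dX_one]
  intro φ w
  refine ⟨w.pow + 1, fun N hN => ?_⟩
  cases w with
  | E m =>
    have hN : m + 1 < N := hN
    simp only [coeff_E, vf, Mon.hat, map_add, key φ.1 _ _ N hN, coeff_mul_eq_sum φ.2 _ _ N hN.le]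
    simp
  | F m =>
    have hN : m < N := hN
    simp only [coeff_F, vf, Mon.hat, map_add, map_sub, key φ.1 _ _ N hN, key' φ.2 _ _ N hN,
      coeff_mul_eq_sum φ.2 _ _ N hN.le]
    simp only [map_zero, zero_mul, sub_zero, add_zero, zero_sub, mul_add, mul_neg,
      Finset.sum_add_distrib, Finset.sum_neg_distrib]
    abel

/-! Products of monomials. -/

lemma hatMul_EE (a b : ℕ) :
    hatMul (A := A) (.E a) (.E b) = (X ^ (a + 1) * X ^ (b + 1), 0) := by
  simp [hatMul, mulFn, Mon.hat, tensorSign, Mon.par, sgn]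

lemma hatMul_EF (a b : ℕ) : hatMul (A := A) (.E a) (.F b) = (0, X ^ (a + 1) * X ^ b) := by
  simp [hatMul, mulFn, Mon.hat, tensorSign, Mon.par, sgn]

lemma hatMul_FE (a b : ℕ) : hatMul (A := A) (.F a) (.E b) = (0, X ^ a * X ^ (b + 1)) := by
  simp [hatMul, mulFn, Mon.hat, tensorSign, Mon.par, sgn]

lemma hatMul_FF (a b : ℕ) : hatMul (A := A) (.F a) (.F b) = 0 := by
  simp [hatMul, mulFn, Mon.hat]

lemma sgn_zero : sgn 0 = 1 := rfl
lemma sgn_one : sgn 1 = -1 := rfl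

/-- Vector fields satisfy the Leibniz rule on products of monomials. No commutativity of `A` is
needed, because powers of `X` commute with every series. -/
lemma isOddCoderivation_of_transpose {D : End A} {α β γ δ : A⟦X⟧}
    (h : ∀ φ, transpose K D φ = vf α β γ δ φ) : IsOddCoderivation D := by
  rw [isOddCoderivation_iff K]
  have h2 : (1 + 1 : ZMod 2) = 0 := rfl
  have e : ∀ (n : ℕ) (p : A⟦X⟧), p * X ^ n = X ^ n * p := fun n p => PowerSeries.X_pow_mul.symm
  rintro (a | a) (b | b)
  · rw [hatMul_EE]
    have e1 := e (b + 1)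
    simp only [h, vf, Mon.hat, mulFn, tensorSign, Mon.par, mul_zero, add_zero, zero_add,
      sgn_zero, zero_mul, one_smul, map_zero, sub_zero, smul_zero, dX_mul]
    generalize (X ^ (b + 1) : A⟦X⟧) = v at *
    ext1
    · simp only [Prod.fst_add]
      rw [e1, e1 (_ * _)]; noncomm_ring
    · simp only [Prod.snd_add]
      rw [e1, e1 (_ * _)]
      simp; noncomm_ring
  · rw [hatMul_EF]
    have e1 := e b
    simp only [h, vf, Mon.hat, mulFn, tensorSign, Mon.par, mul_zero, add_zero, zero_add, mul_one,
      sgn_zero, sgn_one, h2, zero_mul, one_smul, map_zero, sub_zero, smul_zero, dX_mul]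
    generalize (X ^ b : A⟦X⟧) = v at *
    ext1
    · simp only [Prod.fst_add]
      noncomm_ring
    · simp only [Prod.snd_add]
      rw [e1, e1 (_ * _)]
      noncomm_ring
  · rw [hatMul_FE]
    have e1 := e (b + 1)
    simp only [h, vf, Mon.hat, mulFn, tensorSign, Mon.par, mul_zero, add_zero, zero_add, mul_one,
      sgn_zero, sgn_one, h2, zero_mul, one_smul, map_zero, sub_zero, smul_zero, dX_mul]
    generalize (X ^ (b + 1) : A⟦X⟧) = v at *
    ext1
    · simp only [Prod.fst_add]
      rw [e1, e1 (_ * _)]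
      noncomm_ring
    · simp only [Prod.snd_add]
      have h5 : (0 - dX (X ^ a) * α + X ^ a * δ) * v
          = - (v * (dX (X ^ a) * α)) + X ^ a * (v * δ) := by
        rw [add_mul, mul_assoc (X ^ a), e1 δ, zero_sub, neg_mul, e1 (_ * _)]
      rw [h5, e1]
      noncomm_ring
  -- Here `ξ ^ 2 = 0`, so the Leibniz rule must give zero: the two contributions of `γ` occur with
  -- opposite signs and cancel.
  · rw [hatMul_FF]
    have e1 := e b
    simp only [h, vf, Mon.hat, mulFn, tensorSign, Mon.par, mul_zero, add_zero, zero_add, mul_one,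
      sgn_zero, sgn_one, h2, zero_mul, one_smul, map_zero, smul_zero]
    generalize (X ^ b : A⟦X⟧) = v at *
    ext1
    · simp
    · simp only [Prod.snd_add]
      rw [e1 (_ * _), ← mul_assoc, ← mul_assoc, e1]
      simp

/-- A derivation is determined by its values on the coordinates `x` and `ξ`: the Leibniz rule gives
its values on all monomials by induction, and locality extends this to power series. -/
lemma transpose_of_isOddCoderivation {D : End A} (h : IsOddCoderivation D) (φ : Fn A) :
    transpose K D φ = vf (transpose K D (X, 0)).1 (transpose K D (X, 0)).2
      (transpose K D (0, 1)).1 (transpose K D (0, 1)).2 φ := by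
  rw [isOddCoderivation_iff K] at h
  obtain ⟨α, β, h1⟩ : ∃ α β, transpose K D (X, 0) = (α, β) := ⟨_, _, rfl⟩
  obtain ⟨γ, δ, h2⟩ : ∃ γ δ, transpose K D (0, 1) = (γ, δ) := ⟨_, _, rfl⟩
  have hα : PowerSeries.coeff 0 α = 0 := by
    simpa only [h1] using coeff_zero_transpose K D (X, 0)
  have hγ : PowerSeries.coeff 0 γ = 0 := by
    simpa only [h2] using coeff_zero_transpose K D (0, 1)
  rw [h1, h2]
  have e : ∀ (n : ℕ) (p : A⟦X⟧), p * X ^ n = X ^ n * p := fun n p => PowerSeries.X_pow_mul.symm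
  have e1 : ∀ p : A⟦X⟧, p * X = X * p := fun p => by simpa using e 1 p
  have hE : ∀ n, transpose K D (Mon.E n).hat = vf α β γ δ (Mon.E n).hat := by
    intro n
    induction n with
    | zero => simp [Mon.hat, vf, h1, dX_X]
    | succ n ih =>
      have := h (.E n) (.E 0)
      rw [hatMul_EE, ih] at this
      have h3 : (Mon.E (n + 1)).hat = ((X ^ (n + 1) * X ^ (0 + 1), 0) : Fn A) := by
        simp [Mon.hat, pow_succ]
      rw [h3, this]
      simp only [Mon.hat, zero_add, pow_one, h1, vf, mulFn, tensorSign, Mon.par, mul_zero, zero_mul,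
        add_zero, sgn_zero, one_smul, map_zero, sub_zero, smul_zero, dX_mul, dX_X, mul_one]
      ext1
      · simp only [Prod.fst_add]
        rw [e1 (_ * _), e1 (dX _)]; noncomm_ring
      · simp only [Prod.snd_add]
        rw [e1 (_ * _), e1 (dX _)]; noncomm_ring
  refine IsLocal.eq K (isLocal_transpose K D) isLocal_vf (fun φ => ?_) (fun z => ?_) φ
  · rw [coeff_zero_transpose, vf_coeff_zero hα hγ]
  · cases z with
    | E n => exact hE n
    | F n =>
      cases n with
      | zero => simp [Mon.hat, vf, h2, dX_one]
      | succ n =>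
        have := h (.E n) (.F 0)
        rw [hatMul_EF, hE n] at this
        have h3 : (Mon.F (n + 1)).hat = ((0, X ^ (n + 1) * X ^ 0) : Fn A) := by
          simp [Mon.hat]
        rw [h3, this]
        simp only [Mon.hat, pow_zero, h2, vf, mulFn, tensorSign, Mon.par, mul_zero, zero_mul,
          add_zero, zero_add, sgn_zero, sgn_one, one_smul, map_zero, sub_zero, smul_zero, mul_one]
        ext1
        · simp
        · simp

end VectorFields

end LInfty
end

noncomputable section
namespace LInfty
open PowerSeries

/-! ### Local bases -/

section Parity

variable {K : Type u} [Field K] {A : Type v} [Ring A] [Algebra K A]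
  {𝒜 : ZMod 2 → Submodule K A} {ε : A →ₐ[K] K}

lemma IsLocalBase.exists_add (h : IsLocalBase 𝒜 ε) (a : A) :
    ∃ b ∈ 𝒜 0, ∃ c ∈ 𝒜 1, a = b + c := by
  classical
  have htop := h.internal.submodule_iSup_eq_top
  have h2 : (⨆ i, 𝒜 i) = 𝒜 0 ⊔ 𝒜 1 := by
    apply le_antisymm
    · refine iSup_le fun i => ?_
      fin_cases i
      · exact le_sup_left
      · exact le_sup_right
    · exact sup_le (le_iSup 𝒜 0) (le_iSup 𝒜 1)
  obtain ⟨b, hb, c, hc, hbc⟩ :=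
    Submodule.mem_sup.1 (show a ∈ 𝒜 0 ⊔ 𝒜 1 from h2 ▸ htop ▸ Submodule.mem_top)
  exact ⟨b, hb, c, hc, hbc.symm⟩

lemma IsLocalBase.eq_zero (h : IsLocalBase 𝒜 ε) {a : A} (h0 : a ∈ 𝒜 0) (h1 : a ∈ 𝒜 1) :
    a = 0 := by
  have := h.internal.submodule_iSupIndep.pairwiseDisjoint (i := 0) (j := 1) (by decide)
  exact Submodule.disjoint_def.1 this a h0 h1

lemma IsLocalBase.central (h : IsLocalBase 𝒜 ε) {a : A} (ha : a ∈ 𝒜 0) (b : A) :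
    a * b = b * a := by
  obtain ⟨b, hb, c, hc, rfl⟩ := h.exists_add b
  have h1 := h.supercomm 0 0 a b ha hb
  have h2 := h.supercomm 0 1 a c ha hc
  simp only [zero_mul, sgn_zero, one_smul] at h1 h2
  rw [mul_add, add_mul, h1, h2]

lemma IsLocalBase.anticomm (h : IsLocalBase 𝒜 ε) {a b : A} (ha : a ∈ 𝒜 1) (hb : b ∈ 𝒜 1) :
    a * b = -(b * a) := by
  have h1 := h.supercomm 1 1 a b ha hb
  simpa only [mul_one, sgn_one, neg_smul, one_smul] using h1

lemma eq_zero_of_eq_neg (K : Type u) [Field K] [CharZero K] {V : Type v} [AddCommGroup V]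
    [Module K V] {a : V} (h : a = -a) : a = 0 := by
  have h2 : (2 : K) • a = 0 := by
    rw [two_smul]
    nth_rewrite 2 [h]
    simp
  simpa using h2

lemma IsLocalBase.mul_self [CharZero K] (h : IsLocalBase 𝒜 ε) {a : A} (ha : a ∈ 𝒜 1) :
    a * a = 0 :=
  eq_zero_of_eq_neg K (h.anticomm ha ha)

/-- Power series with coefficients in `M`. -/
def SerMem (M : Submodule K A) : Submodule K A⟦X⟧ where
  carrier := {p | ∀ n, PowerSeries.coeff n p ∈ M}
  zero_mem' n := by simp
  add_mem' hp hq n := by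
    rw [map_add]; exact add_mem (hp n) (hq n)
  smul_mem' c p hp n := by
    show c • PowerSeries.coeff n p ∈ M
    exact M.smul_mem c (hp n)

lemma SerMem.dX {M : Submodule K A} {p : A⟦X⟧} (hp : p ∈ SerMem M) : dX p ∈ SerMem M := by
  intro n
  rw [coeff_dX]
  exact nsmul_mem (hp _) _

lemma IsLocalBase.serMem_mul (h : IsLocalBase 𝒜 ε) {i j : ZMod 2} {p q : A⟦X⟧}
    (hp : p ∈ SerMem (𝒜 i)) (hq : q ∈ SerMem (𝒜 j)) : p * q ∈ SerMem (𝒜 (i + j)) := by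
  intro n
  rw [PowerSeries.coeff_mul]
  exact sum_mem fun x _ => h.mul_mem _ _ _ _ (hp _) (hq _)

lemma IsLocalBase.serMem_X_pow (h : IsLocalBase 𝒜 ε) (n : ℕ) :
    (X ^ n : A⟦X⟧) ∈ SerMem (𝒜 0) := by
  intro m
  rw [PowerSeries.coeff_X_pow]
  split_ifs
  · exact h.one_mem
  · exact zero_mem _

lemma IsLocalBase.serCentral (h : IsLocalBase 𝒜 ε) {p : A⟦X⟧} (hp : p ∈ SerMem (𝒜 0)) (q : A⟦X⟧) :
    p * q = q * p := by
  ext n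
  rw [PowerSeries.coeff_mul, PowerSeries.coeff_mul, ← Finset.Nat.sum_antidiagonal_swap]
  exact Finset.sum_congr rfl fun x _ => h.central (hp _) _

lemma IsLocalBase.serAnticomm (h : IsLocalBase 𝒜 ε) {p q : A⟦X⟧} (hp : p ∈ SerMem (𝒜 1))
    (hq : q ∈ SerMem (𝒜 1)) : p * q = -(q * p) := by
  ext n
  rw [map_neg, PowerSeries.coeff_mul, PowerSeries.coeff_mul, ← Finset.Nat.sum_antidiagonal_swap,
    ← Finset.sum_neg_distrib]
  exact Finset.sum_congr rfl fun x _ => h.anticomm (hp _) (hq _)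

lemma IsLocalBase.serMul_self [CharZero K] (h : IsLocalBase 𝒜 ε) {p : A⟦X⟧}
    (hp : p ∈ SerMem (𝒜 1)) : p * p = 0 :=
  eq_zero_of_eq_neg K (h.serAnticomm hp hp)

/-! ### Codifferentials from series -/

variable [CharZero K]

lemma isHomogeneous_iff (p : ZMod 2) (δ : End A) : IsHomogeneous 𝒜 p δ ↔
    ∀ w z : Mon, w.coeff (transpose K δ z.hat) ∈ 𝒜 (p + w.par + z.par) := by
  have key : ∀ (m : ℕ) (i : ZMod 2) (a : A), m.factorial • a ∈ 𝒜 i → a ∈ 𝒜 i := by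
    intro m i a h
    rw [← Nat.cast_smul_eq_nsmul K] at h
    exact ((𝒜 i).smul_mem_iff (Nat.cast_ne_zero.2 m.factorial_ne_zero)).1 h
  constructor
  · intro h w z
    apply key w.pow
    have := fac_smul_apply K δ w z
    rw [Mon.fac, Mon.fac] at this
    rw [← this]
    exact nsmul_mem (h w z) _
  · intro h w z
    apply key z.pow
    have := fac_smul_apply K δ w z
    rw [Mon.fac, Mon.fac] at this
    rw [this]
    exact nsmul_mem (h w z) _

/-- The square of an odd vector field is again a derivation, so it vanishes if it kills `x` (`h1`,
`h2`) and `ξ` (`h3`, `h4`). In the expansion the second derivatives disappear by `α ^ 2 = 0` and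
centrality of `β`, and the terms in `dX q` by centrality of `γ`, anticommutation of `α` and `δ`, and
`h1`. -/
lemma IsLocalBase.vf_vf (h : IsLocalBase 𝒜 ε) {α β γ δ : A⟦X⟧} (hα : α ∈ SerMem (𝒜 1))
    (hβ : β ∈ SerMem (𝒜 0)) (hγ : γ ∈ SerMem (𝒜 0)) (hδ : δ ∈ SerMem (𝒜 1))
    (h1 : dX α * α + β * γ = 0) (h2 : dX α * β - dX β * α + β * δ = 0)
    (h3 : dX γ * α + δ * γ = 0) (h4 : dX γ * β - dX δ * α + δ * δ = 0) (φ : Fn A) :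
    vf α β γ δ (vf α β γ δ φ) = 0 := by
  obtain ⟨p, q⟩ := φ
  have cβ := h.serCentral hβ
  have cγ := h.serCentral hγ
  have cβ' := h.serCentral (SerMem.dX hβ)
  have cγ' := h.serCentral (SerMem.dX hγ)
  have hαα := h.serMul_self hα
  have hδα := h.serAnticomm hδ hα
  have e1 : dX (dX p * α + q * γ) * α + (dX p * β - dX q * α + q * δ) * γ
      = dX (dX p) * (α * α) + dX p * (dX α * α + β * γ) + dX q * (γ * α - α * γ)
        + q * (dX γ * α + δ * γ) := by
    rw [map_add, dX_mul, dX_mul]; noncomm_ring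
  have e2 : dX (dX p * α + q * γ) * β - dX (dX p * β - dX q * α + q * δ) * α
        + (dX p * β - dX q * α + q * δ) * δ
      = dX (dX p) * (α * β - β * α) + dX p * (dX α * β - dX β * α + β * δ)
        + dX q * (γ * β + dX α * α - (δ * α + α * δ)) + dX (dX q) * (α * α)
        + q * (dX γ * β - dX δ * α + δ * δ) := by
    simp only [map_add, map_sub, dX_mul]; noncomm_ring
  have e3 : γ * β + dX α * α - (δ * α + α * δ) = 0 := by
    rw [hδα, ← cβ, add_comm (β * γ), h1]; simp
  simp only [vf]
  rw [e1, e2, e3, h1, h2, h3, h4, hαα, cγ, cβ]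
  simp

lemma IsLocalBase.isCodifferential_ser (h : IsLocalBase 𝒜 ε) {α β γ δ : A⟦X⟧}
    (hα : α ∈ SerMem (𝒜 1))
    (hβ : β ∈ SerMem (𝒜 0)) (hγ : γ ∈ SerMem (𝒜 0)) (hδ : δ ∈ SerMem (𝒜 1))
    (hα0 : PowerSeries.coeff 0 α = 0) (hγ0 : PowerSeries.coeff 0 γ = 0)
    (h1 : dX α * α + β * γ = 0) (h2 : dX α * β - dX β * α + β * δ = 0)
    (h3 : dX γ * α + δ * γ = 0) (h4 : dX γ * β - dX δ * α + δ * δ = 0) :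
    IsCodifferential 𝒜 (coder (ser α β γ δ)) where
  odd := by
    rw [isHomogeneous_iff]
    intro w z
    rw [transpose_coder_ser K hα0 hγ0]
    have hX : ∀ n : ℕ, (X ^ n : A⟦X⟧) ∈ SerMem (𝒜 0) := h.serMem_X_pow
    have two : (1 + 1 : ZMod 2) = 0 := rfl
    rcases w with n | n <;> rcases z with m | m <;>
      simp only [coeff_E, coeff_F, vf, Mon.hat, Mon.par, zero_mul, map_zero, add_zero, zero_add,
        sub_zero, two]
    · exact h.serMem_mul (SerMem.dX (hX _)) hα _
    · exact h.serMem_mul (hX _) hγ _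
    · exact h.serMem_mul (SerMem.dX (hX _)) hβ _
    · rw [zero_sub]
      exact add_mem (neg_mem (h.serMem_mul (SerMem.dX (hX m)) hα))
        (h.serMem_mul (hX m) hδ) _
  coder := isOddCoderivation_of_transpose K (transpose_coder_ser K hα0 hγ0)
  sq_zero := by
    refine End_ext K fun z => ?_
    rw [transpose_comp, transpose_coder_ser K hα0 hγ0, transpose_coder_ser K hα0 hγ0,
      h.vf_vf hα hβ hγ hδ h1 h2 h3 h4, transpose_zero]

end Parity

/-! ### Changes of the odd coordinate -/

section Gauge

variable {A : Type v} [Ring A]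

/-- The transpose of the change of coordinates `x ↦ x`, `ξ ↦ c + d ξ`. -/
def gT (c d : A⟦X⟧) (φ : Fn A) : Fn A :=
  -- The constant term is removed because transposes of endomorphisms of the reduced coalgebra have
  -- none.
  (φ.1 - PowerSeries.C (PowerSeries.coeff 0 φ.1) + φ.2 * c, φ.2 * d)

/-- The endomorphism of `S(W) ⊗ A` given by the change of coordinates `x ↦ x`, `ξ ↦ c + d ξ`. -/
def gEnd (c d : A⟦X⟧) : End A :=
  extend fun w => match w with
    | .E n => Finsupp.single (.E n) 1 + ∑ i ∈ Finset.range (n + 1),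
        -- The falling factorial is the quotient `(n + 1)! / (n - i)!` of the normalizing factorials
        -- of source and target.
        (n + 1).descFactorial (i + 1) • Finsupp.single (.F (n - i)) (PowerSeries.coeff (i + 1) c)
    | .F n => ∑ i ∈ Finset.range (n + 1),
        n.descFactorial i • Finsupp.single (.F (n - i)) (PowerSeries.coeff i d)

variable (K : Type u) [Field K] [CharZero K] [Algebra K A]

lemma transpose_gEnd {c : A⟦X⟧} (hc : PowerSeries.coeff 0 c = 0) (d : A⟦X⟧) (φ : Fn A) :
    transpose K (gEnd c d) φ = gT c d φ := by
  refine transpose_eq K ?_ fun w => ?_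
  · rw [gT, map_add, coeff_mul_range_pos _ hc]
    simp
  rw [gEnd, extend_single_one, ← pairHom_apply]
  cases w with
  | E n =>
    simp only [map_sum, map_nsmul, map_add, map_sub, pairHom_apply, pair_single, coeff_E, coeff_F,
      gT, mul_one, smul_add]
    rw [coeff_mul_range_pos _ hc, Finset.smul_sum]
    congr 1
    · simp
    refine Finset.sum_congr rfl fun i hi => ?_
    have hi : i + 1 ≤ n + 1 := Finset.mem_range.1 hi
    simp only [Mon.fac, Mon.pow, smul_smul, ← Nat.factorial_mul_descFactorial hi,
      Nat.succ_sub_succ]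
    rw [mul_comm]
  | F n =>
    simp only [map_sum, map_nsmul, pairHom_apply, pair_single, coeff_F, gT]
    rw [coeff_mul_range, Finset.smul_sum]
    refine Finset.sum_congr rfl fun i hi => ?_
    have hi : i ≤ n := Nat.lt_succ_iff.1 (Finset.mem_range.1 hi)
    simp only [Mon.fac, Mon.pow, smul_smul, ← Nat.factorial_mul_descFactorial hi]
    rw [mul_comm]

/-- Composing the substitutions sends `ξ` to `(c + d c') + d d' ξ`, so the hypotheses say that the
composite is the identity. -/
lemma gT_gT {c c' d d' : A⟦X⟧} (hc : PowerSeries.coeff 0 c = 0) (h1 : c + d * c' = 0)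
    (h2 : d * d' = 1) (φ : Fn A) (hφ : PowerSeries.coeff 0 φ.1 = 0) :
    gT c' d' (gT c d φ) = φ := by
  have h0 : PowerSeries.coeff 0 (φ.2 * c) = 0 := by
    rw [coeff_mul_range_pos _ hc]; simp
  ext1
  · simp only [gT, map_add, hφ, h0, map_zero, sub_zero, add_zero]
    rw [add_assoc, mul_assoc, ← mul_add, h1]
    simp
  · simp only [gT]
    rw [mul_assoc, h2, mul_one]

lemma gEnd_comp (K : Type u) [Field K] [CharZero K] [Algebra K A] {c c' d d' : A⟦X⟧} (hc : PowerSeries.coeff 0 c = 0)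
    (hc' : PowerSeries.coeff 0 c' = 0) (h1 : c + d * c' = 0) (h2 : d * d' = 1) :
    gEnd c d ∘ₗ gEnd c' d' = LinearMap.id := by
  refine End_ext K fun z => ?_
  rw [transpose_comp, transpose_gEnd K hc, transpose_gEnd K hc', transpose_id_hat,
    gT_gT hc h1 h2 _ (coeff_zero_hat z)]

variable {K} {𝒜 : ZMod 2 → Submodule K A} {ε : A →ₐ[K] K}

lemma gT_hat_E (c d : A⟦X⟧) (n : ℕ) : gT c d (Mon.E n).hat = (X ^ (n + 1), 0) := by
  simp [gT, Mon.hat]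

lemma gT_hat_F (c d : A⟦X⟧) (n : ℕ) : gT c d (Mon.F n).hat = (X ^ n * c, X ^ n * d) := by
  simp [gT, Mon.hat]

/-- A substitution is multiplicative. The only point to verify is that the image of `ξ` still
squares to zero, `(c + d ξ) ^ 2 = 0`; this uses that `c` is odd and `d` is even. -/
lemma IsLocalBase.isCoalgebraMorphism_gEnd (h : IsLocalBase 𝒜 ε) {c d : A⟦X⟧}
    (hc : c ∈ SerMem (𝒜 1)) (hd : d ∈ SerMem (𝒜 0)) (hc0 : PowerSeries.coeff 0 c = 0) :
    IsCoalgebraMorphism (gEnd c d) := by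
  rw [isCoalgebraMorphism_iff K]
  have two : (1 + 1 : ZMod 2) = 0 := rfl
  have e : ∀ (n : ℕ) (p : A⟦X⟧), p * X ^ n = X ^ n * p := fun n p => PowerSeries.X_pow_mul.symm
  rintro (a | a) (b | b)
  · rw [hatMul_EE]
    simp only [transpose_gEnd K hc0, gT_hat_E]
    simp [gT, mulFn, tensorSign, sgn, Mon.par]
  · rw [hatMul_EF]
    simp only [transpose_gEnd K hc0, gT_hat_E, gT_hat_F]
    simp [gT, mulFn, tensorSign, sgn, Mon.par, mul_assoc]
  · rw [hatMul_FE]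
    simp only [transpose_gEnd K hc0, gT_hat_E, gT_hat_F]
    simp [gT, mulFn, tensorSign, sgn, Mon.par, mul_assoc,
      e (b + 1)]
  · rw [hatMul_FF]
    simp only [transpose_gEnd K hc0, gT_hat_F, mulFn, tensorSign, Mon.par, mul_one, zero_mul,
      zero_add, two, sgn_zero, sgn_one, one_smul]
    have e1 : X ^ a * c * (X ^ b * c) = X ^ a * X ^ b * (c * c) := by
      rw [mul_assoc, ← mul_assoc c, e b c]; noncomm_ring
    have e2 : X ^ a * d * (X ^ b * c) + -1 • (X ^ a * c * (X ^ b * d))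
        = X ^ a * X ^ b * (d * c - c * d) := by
      rw [mul_assoc, ← mul_assoc d, e b d, mul_assoc _ c, ← mul_assoc c, e b c]; noncomm_ring
    rw [e1, e2, h.serMul_self hc, h.serCentral hd, sub_self]
    simp [gT]

lemma IsLocalBase.isHomogeneous_gEnd (h : IsLocalBase 𝒜 ε) {c d : A⟦X⟧}
    (hc : c ∈ SerMem (𝒜 1)) (hd : d ∈ SerMem (𝒜 0)) (hc0 : PowerSeries.coeff 0 c = 0) :
    IsHomogeneous 𝒜 0 (gEnd c d) := by
  rw [isHomogeneous_iff]
  have hX : ∀ n : ℕ, (X ^ n : A⟦X⟧) ∈ SerMem (𝒜 0) := h.serMem_X_pow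
  have two : (1 + 1 : ZMod 2) = 0 := rfl
  rintro (n | n) (m | m)
  · simp only [transpose_gEnd K hc0, gT_hat_E]
    exact hX _ _
  · simp only [transpose_gEnd K hc0, gT_hat_F]
    exact h.serMem_mul (hX _) hc _
  · simp only [transpose_gEnd K hc0, gT_hat_E]
    simp
  · simp only [transpose_gEnd K hc0, gT_hat_F, Mon.par, zero_add, two]
    exact h.serMem_mul (hX _) hd _

lemma aug_gEnd {c d : A⟦X⟧} (hc0 : PowerSeries.coeff 0 c = 0)
    (hcε : ∀ n, ε (PowerSeries.coeff n c) = 0)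
    (hdε : ∀ n, ε (PowerSeries.coeff n d) = if n = 0 then 1 else 0) (x : S A) (z : Mon) :
    ε (gEnd c d x z) = ε (x z) := by
  classical
  have key : ∀ w, ε (gEnd c d (Finsupp.single w 1) z) = if w = z then 1 else 0 := by
    intro w
    have h1 := congrArg ε (fac_smul_apply K (gEnd c d) w z)
    rw [map_nsmul, map_nsmul, transpose_gEnd K hc0] at h1
    apply fac_smul_cancel K (m := z.pow)
    show z.fac • _ = z.fac • _
    rw [h1]
    rcases w with n | n <;> rcases z with m | m
    · rw [gT_hat_E]
      by_cases h : n = m <;> simp [PowerSeries.coeff_X_pow, h]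
    · rw [gT_hat_F]
      simp only [coeff_E, PowerSeries.coeff_X_pow_mul']
      split_ifs <;> simp_all
    · rw [gT_hat_E]
      simp
    · rw [gT_hat_F]
      simp only [coeff_F, PowerSeries.coeff_X_pow_mul']
      rcases lt_trichotomy m n with h | h | h
      · rw [if_pos h.le, hdε, if_neg (by omega), if_neg (by simp; omega)]; simp
      · subst h
        have := hdε 0
        simp only [PowerSeries.coeff_zero_eq_constantCoeff] at this
        simp [this]
      · rw [if_neg (by omega), if_neg (by simp; omega)]; simp
  induction x using Finsupp.induction_linear with
  | zero => simp
  | add s t hs ht => simp only [map_add, Finsupp.add_apply, hs, ht]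
  | single w a =>
    rw [single_eq_op_smul, map_smul, Finsupp.smul_apply, Finsupp.smul_apply,
      MulOpposite.smul_eq_mul_unop, MulOpposite.smul_eq_mul_unop, map_mul, map_mul, key,
      Finsupp.single_apply]
    split_ifs <;> simp

/-- Transposition reverses composition, so the intertwining relation is tested on functions with the
factors in the opposite order. The conditions on `ε` say that the substitution is the identity
modulo the maximal ideal. -/
lemma IsLocalBase.equivalent_of_gauge (h : IsLocalBase 𝒜 ε) {c d d' : A⟦X⟧}
    (hc : c ∈ SerMem (𝒜 1)) (hd : d ∈ SerMem (𝒜 0)) (hc0 : PowerSeries.coeff 0 c = 0)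
    (hcε : ∀ n, ε (PowerSeries.coeff n c) = 0)
    (hdε : ∀ n, ε (PowerSeries.coeff n d) = if n = 0 then 1 else 0) (hdd : d * d' = 1)
    {δ₁ δ₂ : End A}
    (hδ : ∀ z : Mon, gT c d (transpose K δ₁ z.hat) = transpose K δ₂ (gT c d z.hat)) :
    Equivalent 𝒜 ε δ₁ δ₂ := by
  have hc0' : PowerSeries.coeff 0 (-(d' * c)) = 0 := by
    rw [map_neg, coeff_mul_range_pos _ hc0]; simp
  have hdd' : d' * d = 1 := by rw [← h.serCentral hd, hdd]
  -- Solving `ξ' = c + d ξ` for `ξ` gives the inverse substitution `ξ ↦ -d' c + d' ξ`.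
  let g : S A ≃ₗ[Aᵐᵒᵖ] S A := LinearEquiv.ofLinearMap (gEnd c d) (gEnd (-(d' * c)) d')
    (gEnd_comp K hc0 hc0' (by rw [mul_neg, ← mul_assoc, hdd]; simp) hdd)
    (gEnd_comp K hc0' hc0 (by simp) hdd')
  refine ⟨g, h.isHomogeneous_gEnd hc hd hc0, h.isCoalgebraMorphism_gEnd hc hd hc0, ?_, ?_⟩
  · intro x
    ext z
    simp only [Finsupp.mapRange_apply]
    exact aug_gEnd hc0 hcε hdε x z
  · have key : δ₁ ∘ₗ gEnd c d = gEnd c d ∘ₗ δ₂ := by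
      refine End_ext K fun z => ?_
      rw [transpose_comp, transpose_comp, transpose_gEnd K hc0, transpose_gEnd K hc0, hδ]
    have hg : g.toLinearMap = gEnd c d := rfl
    rw [hg, key, ← hg, ← LinearMap.comp_assoc, LinearEquiv.symm_comp, LinearMap.id_comp]

end Gauge

end LInfty
end

noncomputable section
namespace LInfty
open PowerSeries

/-! ### Powers of the augmentation ideal -/

section Powers

variable {K : Type u} [Field K] {A : Type v} [Ring A] [Algebra K A]
  {𝒜 : ZMod 2 → Submodule K A} {ε : A →ₐ[K] K}

lemma mem_augIdeal {a : A} : a ∈ augIdeal ε ↔ ε a = 0 := Iff.rfl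

lemma augIdeal_pow_mul {k : ℕ} {a : A} (ha : a ∈ augIdeal ε ^ (k + 1)) (b : A) :
    a * b ∈ augIdeal ε ^ (k + 1) := by
  rw [pow_succ] at ha ⊢
  induction ha using Submodule.mul_induction_on' with
  | mem_mul_mem x hx y hy =>
    rw [mul_assoc]
    refine Submodule.mul_mem_mul hx ?_
    rw [mem_augIdeal] at hy ⊢
    rw [map_mul, hy, zero_mul]
  | add x _ y _ hx hy => rw [add_mul]; exact add_mem hx hy

lemma augIdeal_mul_pow {k : ℕ} {a : A} (ha : a ∈ augIdeal ε ^ (k + 1)) (b : A) :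
    b * a ∈ augIdeal ε ^ (k + 1) := by
  rw [pow_succ'] at ha ⊢
  induction ha using Submodule.mul_induction_on' with
  | mem_mul_mem x hx y hy =>
    rw [← mul_assoc]
    refine Submodule.mul_mem_mul ?_ hy
    rw [mem_augIdeal] at hx ⊢
    rw [map_mul, hx, mul_zero]
  | add x _ y _ hx hy => rw [mul_add]; exact add_mem hx hy

lemma augIdeal_pow_succ_le (k : ℕ) : augIdeal ε ^ (k + 2) ≤ augIdeal ε ^ (k + 1) := by
  rw [pow_succ, Submodule.mul_le]
  exact fun a ha b _ => augIdeal_pow_mul ha b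

lemma augIdeal_pow_anti {k l : ℕ} (h : k ≤ l) :
    augIdeal ε ^ (l + 1) ≤ augIdeal ε ^ (k + 1) := by
  induction l, h using Nat.le_induction with
  | base => exact le_rfl
  | succ l _ ih => exact (augIdeal_pow_succ_le l).trans ih

lemma serMem_mul_pow {k : ℕ} {p q : A⟦X⟧} (hp : p ∈ SerMem (augIdeal ε))
    (hq : q ∈ SerMem (augIdeal ε ^ (k + 1))) : p * q ∈ SerMem (augIdeal ε ^ (k + 2)) := by
  intro n
  rw [PowerSeries.coeff_mul]
  refine sum_mem fun x _ => ?_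
  rw [pow_succ' _ (k + 1)]
  exact Submodule.mul_mem_mul (hp _) (hq _)

lemma serMem_mul_left {p q : A⟦X⟧} (hp : p ∈ SerMem (augIdeal ε)) :
    p * q ∈ SerMem (augIdeal ε ^ 1) := by
  intro n
  rw [PowerSeries.coeff_mul]
  refine sum_mem fun x _ => augIdeal_pow_mul (k := 0) ?_ _
  simpa using hp _

/-- The powers of the augmentation ideal are graded. -/
lemma IsLocalBase.exists_add_pow (h : IsLocalBase 𝒜 ε) (k : ℕ) {a : A}
    (ha : a ∈ augIdeal ε ^ (k + 1)) : ∃ b ∈ 𝒜 0, ∃ c ∈ 𝒜 1,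
      b ∈ augIdeal ε ^ (k + 1) ∧ c ∈ augIdeal ε ^ (k + 1) ∧ a = b + c := by
  have base : ∀ a ∈ augIdeal ε, ∃ b ∈ 𝒜 0, ∃ c ∈ 𝒜 1,
      b ∈ augIdeal ε ∧ c ∈ augIdeal ε ∧ a = b + c := by
    intro a ha
    obtain ⟨b, hb, c, hc, rfl⟩ := h.exists_add a
    have hc' := h.aug_odd c hc
    refine ⟨b, hb, c, hc, ?_, hc', rfl⟩
    rw [mem_augIdeal, map_add, hc', add_zero] at ha
    exact ha
  induction k generalizing a with
  | zero => simpa using base a (by simpa using ha)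
  | succ k ih =>
    rw [pow_succ] at ha ⊢
    induction ha using Submodule.mul_induction_on' with
    | mem_mul_mem x hx y hy =>
      obtain ⟨b, hb, c, hc, hb', hc', rfl⟩ := ih hx
      obtain ⟨d, hd, e, he, hd', he', rfl⟩ := base y hy
      have two : (1 + 1 : ZMod 2) = 0 := rfl
      refine ⟨b * d + c * e, add_mem (h.mul_mem 0 0 _ _ hb hd) (two ▸ h.mul_mem 1 1 _ _ hc he),
        b * e + c * d, add_mem (h.mul_mem 0 1 _ _ hb he) (h.mul_mem 1 0 _ _ hc hd),
        add_mem (Submodule.mul_mem_mul hb' hd') (Submodule.mul_mem_mul hc' he'),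
        add_mem (Submodule.mul_mem_mul hb' he') (Submodule.mul_mem_mul hc' hd'), by noncomm_ring⟩
    | add x _ y _ hx hy =>
      obtain ⟨b, hb, c, hc, hb', hc', rfl⟩ := hx
      obtain ⟨d, hd, e, he, hd', he', rfl⟩ := hy
      exact ⟨b + d, add_mem hb hd, c + e, add_mem hc he, add_mem hb' hd', add_mem hc' he',
        by abel⟩

lemma IsLocalBase.eq_zero' (h : IsLocalBase 𝒜 ε) {i : ZMod 2} {a : A} (h0 : a ∈ 𝒜 i)
    (h1 : a ∈ 𝒜 (i + 1)) : a = 0 := by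
  fin_cases i
  · exact h.eq_zero h0 h1
  · exact h.eq_zero h1 h0

lemma IsLocalBase.exists_add_ser (h : IsLocalBase 𝒜 ε) (i : ZMod 2) (q : A⟦X⟧) :
    ∃ u ∈ SerMem (𝒜 i), ∃ v ∈ SerMem (𝒜 (i + 1)), q = u + v := by
  choose b hb c hc hbc using h.exists_add
  have e : ∀ f : A → A, ∀ n, PowerSeries.coeff n (PowerSeries.mk fun n =>
    f (PowerSeries.coeff n q)) = f (PowerSeries.coeff n q) := fun f n => by simp
  fin_cases i
  · refine ⟨PowerSeries.mk fun n => b (PowerSeries.coeff n q), fun n => ?_,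
      PowerSeries.mk fun n => c (PowerSeries.coeff n q), fun n => ?_, ?_⟩
    · rw [e]; exact hb _
    · rw [e]; exact hc _
    · ext n; rw [map_add, e, e, ← hbc]
  · refine ⟨PowerSeries.mk fun n => c (PowerSeries.coeff n q), fun n => ?_,
      PowerSeries.mk fun n => b (PowerSeries.coeff n q), fun n => ?_, ?_⟩
    · rw [e]; exact hc _
    · rw [e]; exact hb _
    · ext n; rw [map_add, e, e, add_comm, ← hbc]

/-! ### Weierstrass division -/

/-- The series is congruent to `X ^ n` modulo the augmentation ideal. -/
def IsWeierstrass (ε : A →ₐ[K] K) (n : ℕ) (β : A⟦X⟧) : Prop :=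
  β - X ^ n ∈ SerMem (augIdeal ε)

/-- Up to an error with coefficients in the maximal ideal, multiplication by `β` is a shift by `n`.
Existence and uniqueness of Weierstrass division come from iterating this identity. -/
lemma IsWeierstrass.coeff_mul {n : ℕ} {β : A⟦X⟧} (q : A⟦X⟧) (k : ℕ) :
    PowerSeries.coeff (n + k) (β * q)
      = PowerSeries.coeff k q + PowerSeries.coeff (n + k) ((β - X ^ n) * q) := by
  rw [sub_mul, map_sub, PowerSeries.coeff_X_pow_mul', if_pos (by omega), Nat.add_sub_cancel_left]
  abel

/-- The hypothesis expresses each coefficient of `q` through `(β - X ^ n) * q`, so `q` lies in every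
power of the maximal ideal. This is the uniqueness of division, and in particular `β` can be
cancelled. -/
lemma IsFormalBase.eq_zero_of_weierstrass (h : IsFormalBase 𝒜 ε) {n : ℕ} {β q : A⟦X⟧}
    (hβ : IsWeierstrass ε n β) (hq : ∀ k, PowerSeries.coeff (n + k) (β * q) = 0) : q = 0 := by
  have e : ∀ k, PowerSeries.coeff k q = -PowerSeries.coeff (n + k) ((β - X ^ n) * q) := by
    intro k
    have := hq k
    rw [IsWeierstrass.coeff_mul] at this
    exact eq_neg_of_add_eq_zero_left this
  have key : ∀ N, q ∈ SerMem (augIdeal ε ^ (N + 1)) := by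
    intro N
    induction N with
    | zero =>
      intro k
      rw [e]
      exact neg_mem (serMem_mul_left hβ _)
    | succ N ih =>
      intro k
      rw [e]
      exact neg_mem (serMem_mul_pow hβ ih _)
  ext k
  exact h.separated _ fun N => key N k

/-- The quotient is the fixed point of a map that is contracting for the topology of the maximal
ideal; completeness supplies it coefficient by coefficient. -/
lemma IsFormalBase.exists_div (h : IsFormalBase 𝒜 ε) {n : ℕ} {β : A⟦X⟧}
    (hβ : IsWeierstrass ε n β) (f : A⟦X⟧) :
    ∃ q, ∀ k, PowerSeries.coeff (n + k) (f - β * q) = 0 := by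
  let sh : A⟦X⟧ → A⟦X⟧ := fun g => PowerSeries.mk fun k => PowerSeries.coeff (n + k) g
  have hsh : ∀ g k, PowerSeries.coeff k (sh g) = PowerSeries.coeff (n + k) g := by
    intro g k; simp [sh]
  -- Successive approximations: `q` is the fixed point of `q ↦ sh f - sh ((β - X ^ n) * q)`, where
  -- `sh` drops the first `n` coefficients.
  obtain ⟨s, hs0, hs⟩ : ∃ s : ℕ → A⟦X⟧, s 0 = sh f ∧ ∀ N k, PowerSeries.coeff k (s (N + 1))
      = PowerSeries.coeff (n + k) f - PowerSeries.coeff (n + k) ((β - X ^ n) * s N) := by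
    refine ⟨fun N => Nat.rec (sh f) (fun _ q => sh f - sh ((β - X ^ n) * q)) N, rfl,
      fun N k => ?_⟩
    rw [map_sub, hsh, hsh]
  have hs' : ∀ N, s (N + 1) - s N ∈ SerMem (augIdeal ε ^ (N + 1)) := by
    intro N
    induction N with
    | zero =>
      intro k
      have : PowerSeries.coeff k (s 0) = PowerSeries.coeff (n + k) f := by
        rw [hs0, hsh]
      rw [map_sub, hs, this, sub_sub_cancel_left]
      exact neg_mem (serMem_mul_left hβ _)
    | succ N ih =>
      intro k
      rw [map_sub, hs, hs, sub_sub_sub_cancel_left, ← neg_sub, ← map_sub, ← mul_sub]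
      exact neg_mem (serMem_mul_pow hβ ih _)
  choose l hl using fun k => h.complete (fun N => PowerSeries.coeff k (s N))
    (fun N => by rw [← map_sub]; exact hs' N k)
  refine ⟨PowerSeries.mk l, fun k => ?_⟩
  have hq : ∀ N, s N - PowerSeries.mk l ∈ SerMem (augIdeal ε ^ (N + 1)) := by
    intro N k
    rw [map_sub, PowerSeries.coeff_mk]
    exact hl k N
  rw [map_sub, IsWeierstrass.coeff_mul]
  refine h.separated _ fun N => ?_
  have e : PowerSeries.coeff (n + k) f - (PowerSeries.coeff k (PowerSeries.mk l)
      + PowerSeries.coeff (n + k) ((β - X ^ n) * PowerSeries.mk l))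
      = PowerSeries.coeff k (s (N + 1) - PowerSeries.mk l)
        + PowerSeries.coeff (n + k) ((β - X ^ n) * (s N - PowerSeries.mk l)) := by
    rw [mul_sub, map_sub, map_sub, hs]
    abel
  rw [e]
  exact augIdeal_pow_succ_le _ (add_mem (hq (N + 1) k) (serMem_mul_pow hβ (hq N) _))

/-- The part of the quotient of the wrong parity is a quotient of zero, so uniqueness of the
division kills it. -/
lemma IsFormalBase.serMem_div (h : IsFormalBase 𝒜 ε) {n : ℕ} {β f q : A⟦X⟧} {i : ZMod 2}
    (hβ : IsWeierstrass ε n β) (hβ0 : β ∈ SerMem (𝒜 0)) (hf : f ∈ SerMem (𝒜 i))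
    (hq : ∀ k, PowerSeries.coeff (n + k) (f - β * q) = 0) : q ∈ SerMem (𝒜 i) := by
  obtain ⟨p, hp, r, hr, rfl⟩ := h.exists_add_ser i q
  have hr0 : r = 0 := by
    refine h.eq_zero_of_weierstrass hβ fun k => h.eq_zero' (i := i) ?_ ?_
    · have h1 := hq k
      rw [mul_add, ← sub_sub, map_sub, sub_eq_zero] at h1
      rw [← h1]
      exact sub_mem hf (by simpa using h.serMem_mul hβ0 hp) _
    · simpa using h.serMem_mul hβ0 hr _
  rw [hr0, add_zero]
  exact hp

lemma isWeierstrass_iff {n : ℕ} {β : A⟦X⟧} :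
    IsWeierstrass ε n β ↔ PowerSeries.map (ε : A →+* K) β = X ^ n := by
  rw [← sub_eq_zero, ← PowerSeries.map_X (ε : A →+* K), ← map_pow, ← map_sub]
  constructor
  · intro h
    ext k
    simpa [mem_augIdeal] using h k
  · intro h k
    simpa [mem_augIdeal] using congrArg (PowerSeries.coeff k) h

lemma X_pow_mul_eq_zero {k : Type*} [Ring k] {n : ℕ} {p : k⟦X⟧}
    (h : ∀ m, PowerSeries.coeff (n + m) (X ^ n * p) = 0) : p = 0 := by
  ext m
  have := h m
  rwa [PowerSeries.coeff_X_pow_mul', if_pos (by omega), Nat.add_sub_cancel_left] at this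

end Powers

end LInfty
end

noncomputable section
namespace LInfty
open PowerSeries

/-! ### The normal form of a deformation -/

section Push

variable {K : Type u} [Field K] {A : Type v} [Ring A] [Algebra K A]
  {B : Type w} [Ring B] [Algebra K B]

lemma push_single (φ : A →+* B) (δ : End A) (w z : Mon) :
    push φ δ (Finsupp.single w 1) z = φ (δ (Finsupp.single w 1) z) := by
  rw [push, extend_single_one, Finsupp.mapRange_apply]

/-- The field is `x^n ξ ∂_x`; the exponent is one less than the index since `ξ` uses up one input.
-/
lemma psiE_eq_ser (n : ℕ) : (psiE (n + 1) : Cochain K) = ser 0 (X ^ n) 0 0 := by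
  funext w g
  rcases w with m | m <;> rcases g with _ | _ <;>
    simp only [psiE, ser, PowerSeries.coeff_X_pow, map_zero, smul_zero, add_left_inj,
      Nat.add_sub_cancel]
  split_ifs with h <;> simp [h]

variable [CharZero K]

lemma coeff_transpose_push (φ : A →ₐ[K] B) (δ : End A) (w z : Mon) :
    w.coeff (transpose K (push (φ : A →+* B) δ) z.hat) = φ (w.coeff (transpose K δ z.hat)) := by
  apply fac_smul_cancel K (m := w.pow)
  show w.fac • _ = w.fac • _
  rw [← fac_smul_apply K, push_single, ← map_nsmul φ, ← fac_smul_apply K δ, map_nsmul]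
  rfl

lemma transpose_dPsi (n : ℕ) (φ : Fn K) :
    transpose K (dPsi K (n + 1)) φ = vf 0 (X ^ n) 0 0 φ := by
  rw [dPsi, psiE_eq_ser, transpose_coder_ser K (by simp) (by simp)]

end Push

section NormalForm

variable {K : Type u} [Field K] {A : Type v} [Ring A] [Algebra K A]
  {𝒜 : ZMod 2 → Submodule K A} {ε : A →ₐ[K] K}

/-- The polynomial `∑_{0<k≤n} θ_k x^k`. -/
def alphaSer {n : ℕ} (θ : Fin n → A) : A⟦X⟧ := ∑ i : Fin n, PowerSeries.monomial (i + 1) (θ i)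

/-- The polynomial `x^n + ∑_{0<k≤n} t_k x^(k-1)`. -/
def betaSer {n : ℕ} (t : Fin n → A) : A⟦X⟧ := X ^ n + ∑ i : Fin n, PowerSeries.monomial i (t i)

lemma serMem_monomial {M : Submodule K A} {a : A} (ha : a ∈ M) (n : ℕ) :
    PowerSeries.monomial n a ∈ SerMem M := by
  intro m
  rw [PowerSeries.coeff_monomial]
  split_ifs
  · exact ha
  · exact zero_mem _

lemma serMem_alphaSer {n : ℕ} {θ : Fin n → A} (hθ : ∀ i, θ i ∈ 𝒜 1) :
    alphaSer θ ∈ SerMem (𝒜 1) :=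
  sum_mem fun i _ => serMem_monomial (hθ i) _

lemma IsLocalBase.serMem_betaSer (h : IsLocalBase 𝒜 ε) {n : ℕ} {t : Fin n → A}
    (ht : ∀ i, t i ∈ 𝒜 0) : betaSer t ∈ SerMem (𝒜 0) :=
  add_mem (h.serMem_X_pow n) (sum_mem fun i _ => serMem_monomial (ht i) _)

lemma isWeierstrass_betaSer {n : ℕ} {t : Fin n → A} (ht : ∀ i, ε (t i) = 0) :
    IsWeierstrass ε n (betaSer t) := by
  rw [IsWeierstrass, betaSer, add_sub_cancel_left]
  exact sum_mem fun i _ => serMem_monomial (M := augIdeal ε) (ht i) _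

variable [CharZero K]

lemma coeff_zero_alphaSer {n : ℕ} (θ : Fin n → A) : PowerSeries.coeff 0 (alphaSer θ) = 0 := by
  rw [alphaSer, map_sum]
  refine Finset.sum_eq_zero fun i _ => ?_
  rw [PowerSeries.coeff_monomial, if_neg (by omega)]

lemma eq_sum_monomial {n : ℕ} {r : A⟦X⟧} (hr : ∀ k, PowerSeries.coeff (n + k) r = 0) :
    r = ∑ i : Fin n, PowerSeries.monomial i (PowerSeries.coeff i r) := by
  ext k
  rw [map_sum]
  simp only [PowerSeries.coeff_monomial]
  by_cases hk : k < n
  · rw [Finset.sum_eq_single (⟨k, hk⟩ : Fin n)]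
    · simp
    · intro b _ hb
      rw [if_neg]
      exact fun h => hb (Fin.ext h.symm)
    · simp
  · obtain ⟨m, rfl⟩ := Nat.exists_eq_add_of_le (not_lt.1 hk)
    rw [hr, Finset.sum_eq_zero]
    intro b _
    rw [if_neg (by omega)]

/-- The components of a coderivation in a changed coordinate. -/
lemma IsLocalBase.gT_vf (h : IsLocalBase 𝒜 ε) {α β γ δ α₁ β₁ γ₁ δ₁ c d : A⟦X⟧}
    (hα₁ : α₁ ∈ SerMem (𝒜 1)) (hβ₁ : β₁ ∈ SerMem (𝒜 0)) (hc : c ∈ SerMem (𝒜 1))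
    (hd : d ∈ SerMem (𝒜 0)) (hα₁0 : PowerSeries.coeff 0 α₁ = 0)
    (hγ₁0 : PowerSeries.coeff 0 γ₁ = 0)
    (h1 : α = α₁ + β₁ * c) (h2 : β = β₁ * d)
    (h3 : γ₁ + δ₁ * c = dX c * α + d * γ) (h4 : δ₁ * d = dX c * β - dX d * α + d * δ)
    (φ : Fn A) :
    gT c d (vf α₁ β₁ γ₁ δ₁ φ) = vf α β γ δ (gT c d φ) := by
  obtain ⟨p, q⟩ := φ
  have hv := vf_coeff_zero (β := β₁) (δ := δ₁) hα₁0 hγ₁0 (p, q)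
  have hC : ∀ a : A, dX (PowerSeries.C a) = 0 := by
    intro a
    ext k
    rw [coeff_dX, PowerSeries.coeff_C, if_neg (by omega)]
    simp
  have hca : c * α = -(α₁ * c) := by
    rw [h1, mul_add, h.serAnticomm hc hα₁, ← mul_assoc, ← h.serCentral hβ₁, mul_assoc,
      h.serMul_self hc, mul_zero, add_zero]
  have hda : d * α = α₁ * d + c * β := by
    rw [h1, h2, h.serCentral hd, add_mul, ← mul_assoc c, ← h.serCentral hβ₁]
  rw [gT, hv, map_zero, sub_zero]
  simp only [vf, gT]
  rw [map_add, map_sub, hC, sub_zero, dX_mul, dX_mul]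
  ext1
  · have e : (dX p * α₁ + q * γ₁ + (dX p * β₁ - dX q * α₁ + q * δ₁) * c)
        = dX p * (α₁ + β₁ * c) + dX q * (-(α₁ * c)) + q * (γ₁ + δ₁ * c) := by noncomm_ring
    simp only
    rw [e, ← h1, ← hca, h3]
    noncomm_ring
  · have e : (dX p * β₁ - dX q * α₁ + q * δ₁) * d
        = dX p * (β₁ * d) + dX q * (c * β - (α₁ * d + c * β)) + q * (δ₁ * d) := by noncomm_ring
    simp only
    rw [e, ← h2, ← hda, h4]
    noncomm_ring

lemma eq_zero_of_gT {c d d' : A⟦X⟧} {φ : Fn A} (hφ : PowerSeries.coeff 0 φ.1 = 0)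
    (hdd : d * d' = 1) (h : gT c d φ = 0) : φ = 0 := by
  have h2 : φ.2 = 0 := by
    rw [← mul_one φ.2, ← hdd, ← mul_assoc]
    have : φ.2 * d = 0 := congrArg Prod.snd h
    rw [this, zero_mul]
  have h1 := congrArg Prod.fst h
  simp only [gT, hφ, h2, map_zero, sub_zero, zero_mul, add_zero] at h1
  exact Prod.ext h1 h2

lemma mem_of_coeff_transpose {δ : End A} {p : ZMod 2} (h : IsHomogeneous 𝒜 p δ) (z : Mon) :
    (transpose K δ z.hat).1 ∈ SerMem (𝒜 (p + z.par)) ∧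
      (transpose K δ z.hat).2 ∈ SerMem (𝒜 (p + 1 + z.par)) := by
  rw [isHomogeneous_iff] at h
  constructor
  · rintro (_ | n)
    · rw [coeff_zero_transpose]; exact zero_mem _
    · simpa [Mon.par] using h (.E n) z
  · exact fun n => h (.F n) z

/-- Every formal deformation of `ψ^{n+1}_e` is equivalent to one in normal form. -/
theorem IsFormalBase.exists_normalForm (h : IsFormalBase 𝒜 ε) {n : ℕ} {δ' : End A}
    (hδ' : IsDeformation 𝒜 ε (dPsi K (n + 1)) δ') :
    ∃ θ t : Fin n → A, (∀ i, θ i ∈ 𝒜 1) ∧ (∀ i, t i ∈ 𝒜 0) ∧ (∀ i, ε (t i) = 0) ∧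
      ∃ γ δ : A⟦X⟧, PowerSeries.coeff 0 γ = 0 ∧
        dX (alphaSer θ) * alphaSer θ + betaSer t * γ = 0 ∧
        dX (alphaSer θ) * betaSer t - dX (betaSer t) * alphaSer θ + betaSer t * δ = 0 ∧
        Equivalent 𝒜 ε (coder (ser (alphaSer θ) (betaSer t) γ δ)) δ' := by
  have h0 := h.toIsLocalBase
  have hX0 : (Mon.E 0).hat = ((X, 0) : Fn A) := by simp [Mon.hat]
  have hF0 : (Mon.F 0).hat = ((0, 1) : Fn A) := by simp [Mon.hat]
  obtain ⟨α, β, hαβ⟩ : ∃ α β, transpose K δ' (X, 0) = (α, β) := ⟨_, _, rfl⟩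
  obtain ⟨γ, δ, hγδ⟩ : ∃ γ δ, transpose K δ' (0, 1) = (γ, δ) := ⟨_, _, rfl⟩
  have hT := transpose_of_isOddCoderivation K hδ'.coder
  rw [hαβ, hγδ] at hT
  have hα0 : PowerSeries.coeff 0 α = 0 := by
    simpa only [hαβ] using coeff_zero_transpose K δ' (X, 0)
  have hγ0 : PowerSeries.coeff 0 γ = 0 := by
    simpa only [hγδ] using coeff_zero_transpose K δ' (0, 1)
  have hα : α ∈ SerMem (𝒜 1) := by
    simpa [hX0, hαβ, Mon.par] using (mem_of_coeff_transpose hδ'.odd (.E 0)).1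
  have hβ : β ∈ SerMem (𝒜 0) := by
    have := (mem_of_coeff_transpose hδ'.odd (.E 0)).2
    rw [hX0, hαβ] at this
    exact this
  have hε : ∀ w z : Mon, ε (w.coeff (transpose K δ' z.hat))
      = w.coeff (vf 0 (X ^ n) 0 0 z.hat : Fn K) := by
    intro w z
    rw [← coeff_transpose_push, hδ'.proj, transpose_dPsi]
  have hβε : IsWeierstrass ε n β := by
    rw [isWeierstrass_iff]
    ext m
    have := hε (.F m) (.E 0)
    rw [hX0, hαβ] at this
    simpa [vf, Mon.hat, dX_X] using this
  have hαε : PowerSeries.map (ε : A →+* K) α = 0 := by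
    ext m
    cases m with
    | zero =>
      rw [PowerSeries.coeff_map, hα0]; simp
    | succ m =>
      have := hε (.E m) (.E 0)
      rw [hX0, hαβ] at this
      simpa [vf, Mon.hat, dX_X] using this
  have hβε' := isWeierstrass_iff.1 hβε
  -- the monic polynomial associated to `β`
  obtain ⟨q, hq⟩ := h.exists_div hβε (X ^ n)
  have hq0 := h.serMem_div hβε hβ (h0.serMem_X_pow n) hq
  have hqε : PowerSeries.map (ε : A →+* K) q = 1 := by
    rw [← sub_eq_zero, ← neg_sub, neg_eq_zero]
    refine X_pow_mul_eq_zero (n := n) fun m => ?_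
    have := congrArg ε (hq m)
    rw [map_zero] at this
    rw [mul_sub, mul_one, ← hβε', ← map_mul, hβε', ← PowerSeries.map_X (ε : A →+* K), ← map_pow,
      ← map_sub, PowerSeries.coeff_map]
    exact this
  obtain ⟨t, ht⟩ : ∃ t : Fin n → A, t = fun i : Fin n => PowerSeries.coeff i (β * q - X ^ n) :=
    ⟨_, rfl⟩
  have hβ₁ : betaSer t = β * q := by
    have := eq_sum_monomial (n := n) (r := β * q - X ^ n) fun k => by
      rw [← neg_sub, map_neg, hq, neg_zero]
    rw [betaSer, ht, ← this]
    abel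
  have ht0 : ∀ i, t i ∈ 𝒜 0 := by
    intro i
    rw [ht]
    exact sub_mem (h0.serMem_mul hβ hq0) (h0.serMem_X_pow n) i
  have htε : ∀ i, ε (t i) = 0 := by
    intro i
    have : PowerSeries.map (ε : A →+* K) (β * q - X ^ n) = 0 := by
      rw [map_sub, map_mul, hβε', hqε, map_pow, PowerSeries.map_X, mul_one, sub_self]
    have := congrArg (PowerSeries.coeff i) this
    rw [PowerSeries.coeff_map, map_zero] at this
    rw [ht]
    exact this
  have hB := isWeierstrass_betaSer htε
  have hB0 := h0.serMem_betaSer ht0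
  have hBε := isWeierstrass_iff.1 hB
  obtain ⟨d, hd⟩ := h.exists_div hB β
  have hd0 := h.serMem_div hB hB0 hβ hd
  -- The product `β (1 - q d)` is a remainder of degree less than `n`, so uniqueness of division
  -- gives `q d = 1`. Thus `β` is a unit times the monic polynomial.
  have hqd : q * d = 1 := by
    rw [← sub_eq_zero, ← neg_sub, neg_eq_zero]
    refine h.eq_zero_of_weierstrass hβε fun k => ?_
    rw [mul_sub, mul_one, ← mul_assoc, ← hβ₁, hd]
  have hdq : d * q = 1 := by rw [h0.serCentral hd0, hqd]
  have hβd : β = betaSer t * d := by rw [hβ₁, mul_assoc, hqd, mul_one]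
  have hdε : PowerSeries.map (ε : A →+* K) d = 1 := by
    have := congrArg (PowerSeries.map (ε : A →+* K)) hqd
    rwa [map_mul, hqε, one_mul, map_one] at this
  -- the remainder of `α`
  obtain ⟨α', hα'⟩ : ∃ α' : A⟦X⟧, α = X * α' := by
    refine ⟨PowerSeries.mk fun k => PowerSeries.coeff (k + 1) α, ?_⟩
    ext k
    cases k with
    | zero => rw [hα0]; simp
    | succ k => simp [PowerSeries.coeff_succ_X_mul]
  have hα'1 : α' ∈ SerMem (𝒜 1) := by
    intro k
    have := hα (k + 1)
    rwa [hα', PowerSeries.coeff_succ_X_mul] at this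
  obtain ⟨c', hc'⟩ := h.exists_div hB α'
  have hc'1 := h.serMem_div hB hB0 hα'1 hc'
  have hc'ε : PowerSeries.map (ε : A →+* K) c' = 0 := by
    refine X_pow_mul_eq_zero (n := n) fun m => ?_
    have h1 : PowerSeries.map (ε : A →+* K) α' = 0 := by
      ext k
      have := congrArg (PowerSeries.coeff (k + 1)) hαε
      rw [hα', map_mul, PowerSeries.map_X, PowerSeries.coeff_succ_X_mul] at this
      exact this
    have h2 := congrArg ε (hc' m)
    rw [map_zero] at h2
    rw [← hBε, ← map_mul, ← neg_eq_zero, ← map_neg, ← zero_sub, ← h1, ← map_sub,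
      PowerSeries.coeff_map]
    exact h2
  obtain ⟨θ, hθ⟩ : ∃ θ : Fin n → A, θ = fun i : Fin n => PowerSeries.coeff i (α' - betaSer t * c') :=
    ⟨_, rfl⟩
  have hα₁ : alphaSer θ = X * (α' - betaSer t * c') := by
    conv_rhs => rw [eq_sum_monomial hc', Finset.mul_sum]
    rw [alphaSer, hθ]
    refine Finset.sum_congr rfl fun i _ => ?_
    rw [PowerSeries.X_eq, PowerSeries.monomial_mul_monomial, one_mul, add_comm]
  have hθ1 : ∀ i, θ i ∈ 𝒜 1 := by
    intro i
    rw [hθ]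
    have := h0.serMem_mul hB0 hc'1
    rw [zero_add] at this
    exact sub_mem hα'1 this i
  obtain ⟨c, hc⟩ : ∃ c, c = X * c' := ⟨_, rfl⟩
  have hc0 : PowerSeries.coeff 0 c = 0 := by simp [hc]
  have hc1 : c ∈ SerMem (𝒜 1) := by
    have := h0.serMem_mul (h0.serMem_X_pow 1) hc'1
    rwa [zero_add, pow_one, ← hc] at this
  have hαc : α = alphaSer θ + betaSer t * c := by
    rw [hα₁, hc, ← mul_assoc (betaSer t), ← PowerSeries.X_mul, mul_assoc, ← mul_add, hα']
    congr 1
    abel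
  -- The components `γ₁` and `δ₁` are obtained by solving the last two hypotheses of `gT_vf`, with
  -- `q` the inverse of `d`.
  obtain ⟨δ₁, hδ₁⟩ : ∃ δ₁, δ₁ = (dX c * β - dX d * α + d * δ) * q := ⟨_, rfl⟩
  obtain ⟨γ₁, hγ₁⟩ : ∃ γ₁, γ₁ = dX c * α + d * γ - δ₁ * c := ⟨_, rfl⟩
  have hγ₁0 : PowerSeries.coeff 0 γ₁ = 0 := by
    rw [hγ₁, map_sub, map_add, coeff_mul_range_pos _ hα0, coeff_mul_range_pos _ hγ0,
      coeff_mul_range_pos _ hc0]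
    simp
  have hα₁1 := serMem_alphaSer hθ1
  have hα₁0 := coeff_zero_alphaSer θ
  have key := h0.gT_vf (γ := γ) (δ := δ) (γ₁ := γ₁) (δ₁ := δ₁) hα₁1 hB0 hc1 hd0 hα₁0 hγ₁0 hαc hβd
    (by rw [hγ₁]; abel) (by rw [hδ₁, mul_assoc, hqd, mul_one])
  -- Only the square on the coordinate `x` is needed. It vanishes because the substitution is
  -- injective and intertwines this field with the transpose of `δ'`.
  have hsq : vf (alphaSer θ) (betaSer t) γ₁ δ₁ (vf (alphaSer θ) (betaSer t) γ₁ δ₁ (X, 0)) = 0 := by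
    refine eq_zero_of_gT (c := c) (d := d) (vf_coeff_zero hα₁0 hγ₁0 _) hdq ?_
    rw [key, key, ← hT, ← hT, ← transpose_comp, hδ'.sq_zero, transpose_zero]
  have e : vf (alphaSer θ) (betaSer t) γ₁ δ₁ (X, 0) = (alphaSer θ, betaSer t) := by
    simp [vf, dX_X]
  rw [e] at hsq
  refine ⟨θ, t, hθ1, ht0, htε, γ₁, δ₁, hγ₁0, congrArg Prod.fst hsq, congrArg Prod.snd hsq, ?_⟩
  refine h0.equivalent_of_gauge hc1 hd0 hc0 (fun m => ?_) (fun m => ?_) hdq fun z => ?_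
  · have := congrArg (PowerSeries.coeff m) (show PowerSeries.map (ε : A →+* K) c = 0 by
      rw [hc, map_mul, hc'ε, mul_zero])
    simpa using this
  · have := congrArg (PowerSeries.coeff m) hdε
    simpa [PowerSeries.coeff_one] using this
  · rw [transpose_coder_ser K hα₁0 hγ₁0, key, hT]

end NormalForm

end LInfty
end

noncomputable section
namespace LInfty
open PowerSeries

/-! ### Ground field, infinitesimal bases, and normal forms as deformations -/

section Deformation

variable {K : Type u} [Field K]

lemma groundGrading_zero : groundGrading K 0 = ⊤ := rfl
lemma groundGrading_one : groundGrading K 1 = ⊥ := rfl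

lemma zmod_two_cases : ∀ i : ZMod 2, i = 0 ∨ i = 1 := by decide

/-- The ground field is a local base. -/
lemma isLocalBase_ground : IsLocalBase (groundGrading K) (AlgHom.id K K) where
  internal := by
    rw [DirectSum.isInternal_submodule_iff_isCompl _ (i := 0) (j := 1) (by decide)]
    · rw [groundGrading_zero, groundGrading_one]; exact isCompl_top_bot
    · ext i; fin_cases i <;> simp <;> tauto
  one_mem := by simp [groundGrading_zero]
  mul_mem := by
    intro i j a b ha hb
    rcases zmod_two_cases i with rfl | rfl <;> rcases zmod_two_cases j with rfl | rfl <;>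
      simp_all [groundGrading]
  supercomm := by
    intro i j a b ha hb
    rcases zmod_two_cases i with rfl | rfl <;> rcases zmod_two_cases j with rfl | rfl <;>
      simp_all [groundGrading, sgn, mul_comm]
  aug_odd := by simp [groundGrading]
  isUnit := by
    intro a ha
    exact isUnit_iff_ne_zero.2 ha

/-- The ground field is a formal base. -/
lemma isFormalBase_ground : IsFormalBase (groundGrading K) (AlgHom.id K K) where
  toIsLocalBase := isLocalBase_ground
  separated := by
    intro x hx
    simpa [mem_augIdeal] using hx 0
  complete := by
    intro s hs
    have h0 : ∀ n, augIdeal (AlgHom.id K K) ^ (n + 1) = ⊥ := by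
      intro n
      have : augIdeal (AlgHom.id K K) = ⊥ := by
        ext x; simp [augIdeal]
      rw [this, Submodule.bot_pow (Nat.succ_ne_zero n)]
    refine ⟨s 0, fun n => ?_⟩
    rw [h0, Submodule.mem_bot, sub_eq_zero]
    induction n with
    | zero => rfl
    | succ n ih =>
      have := hs n
      rw [h0, Submodule.mem_bot, sub_eq_zero] at this
      rw [this, ih]

/-- Infinitesimal bases are formal. -/
lemma IsInfinitesimalBase.isFormalBase {A : Type v} [Ring A] [Algebra K A]
    {𝒜 : ZMod 2 → Submodule K A} {ε : A →ₐ[K] K} (h : IsInfinitesimalBase 𝒜 ε) :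
    IsFormalBase 𝒜 ε where
  toIsLocalBase := h.toIsLocalBase
  separated := by
    have h2 : augIdeal ε ^ 2 ≤ ⊥ := by
      rw [pow_two, Submodule.mul_le]
      exact fun a ha b hb => h.sq_zero a b ha hb
    exact fun x hx => h2 (hx 1)
  complete := by
    have h2 : augIdeal ε ^ 2 ≤ ⊥ := by
      rw [pow_two, Submodule.mul_le]
      exact fun a ha b hb => h.sq_zero a b ha hb
    intro s hs
    have hs' : ∀ n, s (n + 1) = s 1 := by
      intro n
      induction n with
      | zero => rfl
      | succ n ih =>
        rw [← ih, ← sub_eq_zero]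
        exact h2 (augIdeal_pow_anti (by omega) (hs (n + 1)))
    refine ⟨s 1, fun n => ?_⟩
    cases n with
    | zero => rw [← neg_sub]; exact neg_mem (hs 0)
    | succ n => rw [hs', sub_self]; exact zero_mem _

variable {A : Type v} [Ring A]

lemma push_coder {B : Type w} [Ring B] (φ : A →+* B) (c : Cochain A) :
    push φ (coder c) = coder fun w g => φ (c w g) := by
  classical
  refine opLinear_ext fun w => Finsupp.ext fun z => ?_
  rw [push_single, coder, coder, extend_single_one, extend_single_one]
  have hs : ∀ (w : Mon) (a : A), φ (Finsupp.single w a z) = Finsupp.single w (φ a) z := by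
    intro w a
    simp only [Finsupp.single_apply]
    split_ifs <;> simp
  cases w with
  | E n =>
    simp only [Finsupp.finsetSum_apply, map_sum, Finsupp.smul_apply, map_nsmul, Finsupp.add_apply,
      map_add, hs]
  | F n =>
    simp only [Finsupp.finsetSum_apply, map_sum, Finsupp.smul_apply, map_nsmul, Finsupp.add_apply,
      map_add, hs, Finsupp.sub_apply, map_sub]

lemma ser_map {B : Type w} [Ring B] (φ : A →+* B) (α β γ δ : A⟦X⟧) :
    (fun w g => φ (ser α β γ δ w g))
      = ser (α.map φ) (β.map φ) (γ.map φ) (δ.map φ) := by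
  funext w g
  rcases w with m | m <;> rcases g with _ | _ <;> simp [ser]

variable [CharZero K] [Algebra K A]
  {𝒜 : ZMod 2 → Submodule K A} {ε : A →ₐ[K] K}

lemma isCodifferential_dPsi (n : ℕ) : IsCodifferential (groundGrading K) (dPsi K (n + 1)) := by
  rw [dPsi, psiE_eq_ser]
  exact isLocalBase_ground.isCodifferential_ser (zero_mem _)
    (isLocalBase_ground.serMem_X_pow n) (zero_mem _) (zero_mem _) (by simp) (by simp)
    (by simp) (by simp) (by simp) (by simp)

lemma IsFormalBase.cancel {K : Type u} [Field K] [Algebra K A]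
    {𝒜 : ZMod 2 → Submodule K A} {ε : A →ₐ[K] K} (h : IsFormalBase 𝒜 ε) {n : ℕ} {β p : A⟦X⟧}
    (hβ : IsWeierstrass ε n β) (hp : β * p = 0) : p = 0 :=
  h.eq_zero_of_weierstrass hβ fun k => by rw [hp, map_zero]

/-- The first two components of the square of a vector field determine the others. -/
lemma IsFormalBase.isCodifferential (h : IsFormalBase 𝒜 ε) {n : ℕ} {α β γ δ : A⟦X⟧}
    (hα : α ∈ SerMem (𝒜 1))
    (hβ : β ∈ SerMem (𝒜 0)) (hγ : γ ∈ SerMem (𝒜 0)) (hδ : δ ∈ SerMem (𝒜 1))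
    (hβε : IsWeierstrass ε n β)
    (hα0 : PowerSeries.coeff 0 α = 0) (hγ0 : PowerSeries.coeff 0 γ = 0)
    (h1 : dX α * α + β * γ = 0) (h2 : dX α * β - dX β * α + β * δ = 0) :
    IsCodifferential 𝒜 (coder (ser α β γ δ)) := by
  have h0 := h.toIsLocalBase
  have cβ := h0.serCentral hβ
  have cγ := h0.serCentral hγ
  have cβ' := h0.serCentral (SerMem.dX hβ)
  have hαα := h0.serMul_self hα
  have hα'α' := h0.serMul_self (SerMem.dX hα)
  have hδδ := h0.serMul_self hδ
  have e1 : β * γ = -(dX α * α) := (neg_eq_of_add_eq_zero_right h1).symm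
  have e2 : β * δ = dX β * α - dX α * β := by
    rw [← sub_eq_zero, ← h2]; abel
  -- Differentiating the two equations expresses `β γ'` and `β δ'` without dividing. The two missing
  -- equations then hold after multiplication by `β`, which can be cancelled.
  have e1' : β * dX γ = -(dX (dX α) * α) - dX β * γ := by
    have := congrArg dX h1
    rw [map_add, dX_mul, dX_mul, hα'α', map_zero, add_zero] at this
    rw [← sub_eq_zero, ← this]; abel
  have e2' : β * dX δ = dX (dX β) * α - dX (dX α) * β - dX β * δ := by
    have := congrArg dX h2
    rw [map_add, map_sub, dX_mul, dX_mul, dX_mul, cβ' (dX α), map_zero] at this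
    rw [← sub_eq_zero, ← this]; abel
  have e3 : δ * α = β * γ := by
    rw [← sub_eq_zero]
    refine h.cancel hβε ?_
    rw [mul_sub, ← mul_assoc, e2, sub_mul, mul_assoc, hαα, e1, mul_assoc, cβ α, mul_neg,
      cβ (dX α * α)]
    noncomm_ring
  refine h0.isCodifferential_ser hα hβ hγ hδ hα0 hγ0 h1 h2 (h.cancel hβε ?_) (h.cancel hβε ?_)
  · have : β * (dX γ * α + δ * γ) = (β * dX γ) * α + (β * δ) * γ := by noncomm_ring
    rw [this, e1', e2, sub_mul, sub_mul, neg_mul, mul_assoc, hαα, mul_assoc (dX α), e1,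
      mul_assoc (dX β), cγ α, mul_neg, ← mul_assoc (dX α) (dX α), hα'α']
    noncomm_ring
  · have : β * (dX γ * β - dX δ * α + δ * δ) = (β * dX γ) * β - (β * dX δ) * α + β * (δ * δ) := by
      noncomm_ring
    rw [this, e1', e2', hδδ]
    have e4 : (-(dX (dX α) * α) - dX β * γ) * β
        - (dX (dX β) * α - dX (dX α) * β - dX β * δ) * α + β * 0
        = dX (dX α) * (β * α - α * β) - dX (dX β) * (α * α) + dX β * (δ * α - γ * β) := by
      noncomm_ring
    rw [e4, cβ α, hαα, e3, cγ β]
    simp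

/-- A normal form is a deformation of `ψ^{n+1}_e`. -/
lemma IsFormalBase.isDeformation (h : IsFormalBase 𝒜 ε) {n : ℕ} {α β γ δ : A⟦X⟧}
    (hα : α ∈ SerMem (𝒜 1))
    (hβ : β ∈ SerMem (𝒜 0)) (hγ : γ ∈ SerMem (𝒜 0)) (hδ : δ ∈ SerMem (𝒜 1))
    (hβε : IsWeierstrass ε n β)
    (hα0 : PowerSeries.coeff 0 α = 0) (hγ0 : PowerSeries.coeff 0 γ = 0)
    (h1 : dX α * α + β * γ = 0) (h2 : dX α * β - dX β * α + β * δ = 0) :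
    IsDeformation 𝒜 ε (dPsi K (n + 1)) (coder (ser α β γ δ)) where
  toIsCodifferential := h.isCodifferential hα hβ hγ hδ hβε hα0 hγ0 h1 h2
  base := isCodifferential_dPsi n
  proj := by
    have hodd : ∀ {p : A⟦X⟧}, p ∈ SerMem (𝒜 1) → PowerSeries.map (ε : A →+* K) p = 0 := by
      intro p hp
      ext k
      simpa using h.aug_odd _ (hp k)
    have hβ' := isWeierstrass_iff.1 hβε
    -- Unlike `α` and `δ`, the series `γ` is even and need not reduce to zero for parity reasons.
    -- The first equation reduces to `x^n γ = 0`.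
    have hγ' : PowerSeries.map (ε : A →+* K) γ = 0 := by
      refine X_pow_mul_eq_zero (n := n) fun m => ?_
      have := congrArg (PowerSeries.map (ε : A →+* K)) h1
      rw [map_add, map_mul, map_mul, hodd hα, mul_zero, zero_add, hβ', map_zero] at this
      rw [this, map_zero]
    rw [push_coder, ser_map, hodd hα, hodd hδ, hγ', hβ', dPsi, psiE_eq_ser]

end Deformation

end LInfty
end

noncomputable section
namespace LInfty
open PowerSeries

/-! ### The explicit normal forms -/

section Explicit

variable (K : Type u) [Field K] {A : Type v} [Ring A] [Algebra K A]

/-- The series of `∂_ξ` in `∑ h^k θ_k`. -/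
def deltaSer {n : ℕ} (θ : Fin n → A) : A⟦X⟧ :=
  -- With `k = i + 1` and `L = n + 1` the coefficient `k - L + 1` of `h^k` is `i + 1 - n`; the
  -- Koszul sign on `e^i f` reverses it.
  ∑ i : Fin n, PowerSeries.monomial i (((n : K) - (i : K) - 1) • θ i)

lemma ser_add (α β γ δ α' β' γ' δ' : A⟦X⟧) :
    ser (α + α') (β + β') (γ + γ') (δ + δ') = ser α β γ δ + ser α' β' γ' δ' := by
  funext w g
  rcases w with m | m <;> rcases g with _ | _ <;> simp [ser]

lemma firstOrder_eq_ser {n : ℕ} (θ t : Fin n → A) :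
    firstOrder K n θ t = ser (alphaSer θ) (betaSer t) 0 (deltaSer K θ) := by
  funext w g
  rcases w with m | m <;> rcases g with _ | _
  · simp only [firstOrder, timesEven, timesOdd, Pi.add_apply, Finset.sum_apply, psiE, hh,
      Pi.smul_apply, phiE, phiF, ser, alphaSer, map_sum, PowerSeries.coeff_monomial,
      Finset.smul_sum, Mon.par, sgn_zero]
    simp only [zero_smul, Finset.sum_const_zero, add_zero, zero_add, smul_zero, one_smul]
    refine Finset.sum_congr rfl fun i _ => ?_
    split_ifs with h
    · rw [h, Nat.cast_smul_eq_nsmul]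
    · simp
  · simp [firstOrder, timesEven, timesOdd, psiE, hh, phiE, phiF, ser]
  · simp only [firstOrder, timesEven, timesOdd, Pi.add_apply, Finset.sum_apply, psiE, hh,
      Pi.smul_apply, phiE, phiF, ser, betaSer, map_sum, map_add, PowerSeries.coeff_monomial,
      Finset.smul_sum, smul_add, PowerSeries.coeff_X_pow, add_left_inj]
    simp only [zero_smul, Finset.sum_const_zero, add_zero, smul_zero]
    congr 1
    · split_ifs with h
      · rw [h, Nat.cast_smul_eq_nsmul]; simp
      · simp
    refine Finset.sum_congr rfl fun i _ => ?_
    split_ifs with h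
    · rw [h, Nat.cast_smul_eq_nsmul]; simp
    · simp
  · simp only [firstOrder, timesEven, timesOdd, Pi.add_apply, Finset.sum_apply, psiE, hh,
      Pi.smul_apply, phiE, phiF, ser, deltaSer, map_sum, PowerSeries.coeff_monomial,
      Finset.smul_sum, Mon.par, sgn_one, add_left_inj]
    simp only [zero_smul, Finset.sum_const_zero, add_zero, zero_add]
    refine Finset.sum_congr rfl fun i _ => ?_
    split_ifs with h
    · rw [h, ← Nat.cast_smul_eq_nsmul K, smul_smul, neg_smul, one_smul, ← neg_smul]
      congr 1
      push_cast [smul_eq_mul, Nat.add_sub_cancel]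
      ring
    · simp

lemma timesOdd_phiF (k : ℕ) (a : A) :
    timesOdd (phiF (k + 1) : Cochain K) a = ser 0 0 0 (PowerSeries.monomial k (-a)) := by
  funext w g
  rcases w with m | m <;> rcases g with _ | _ <;>
    simp only [timesOdd, phiF, ser, Mon.par, sgn_one, PowerSeries.coeff_monomial, map_zero,
      smul_zero, zero_smul, add_left_inj, Nat.add_sub_cancel]
  split_ifs with h
  · rw [h, Nat.cast_smul_eq_nsmul]; simp
  · simp

lemma timesEven_psiF (k : ℕ) (a : A) :
    timesEven (psiF (k + 1) : Cochain K) a = ser 0 0 (PowerSeries.monomial (k + 1) a) 0 := by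
  funext w g
  rcases w with m | m <;> rcases g with _ | _ <;>
    simp only [timesEven, psiF, ser, PowerSeries.coeff_monomial, map_zero,
      smul_zero, zero_smul, add_left_inj]
  split_ifs with h
  · rw [h, Nat.cast_smul_eq_nsmul]
  · simp

/-- The series of `∂_ξ` in `d^3_2`. -/
def delta3 (θ t : Fin 2 → A) : A⟦X⟧ := deltaSer K θ + PowerSeries.monomial 0 (-(θ 1 * t 1))

/-- The series of `∂_ξ` in `d^4_3`. -/
def delta4 (θ t : Fin 3 → A) : A⟦X⟧ :=
  deltaSer K θ + PowerSeries.monomial 0 (-(θ 1 * t 2 + 2 * θ 2 * t 1))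
    + PowerSeries.monomial 1 (-(θ 2 * t 2)) + PowerSeries.monomial 0 (θ 2 * t 2 ^ 2)

lemma d32_eq_ser (θ t : Fin 2 → A) :
    d32 K θ t = ser (alphaSer θ) (betaSer t) 0 (delta3 K θ t) := by
  rw [d32, firstOrder_eq_ser, timesOdd_phiF K 0, ← ser_add, delta3]
  simp

lemma d43_eq_ser (θ t : Fin 3 → A) :
    d43 K θ t = ser (alphaSer θ) (betaSer t) (PowerSeries.monomial 1 (θ 1 * θ 2))
      (delta4 K θ t) := by
  have hneg : -(ser 0 0 0 (PowerSeries.monomial 0 (-(θ 2 * t 2 ^ 2))) : Cochain A)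
      = ser 0 0 0 (PowerSeries.monomial 0 (θ 2 * t 2 ^ 2)) := by
    rw [neg_eq_iff_add_eq_zero, ← ser_add]
    rw [← map_add, neg_add_cancel, map_zero]
    funext w g
    rcases w with m | m <;> rcases g with _ | _ <;> simp [ser]
  rw [d43, d42, firstOrder_eq_ser, timesOdd_phiF K 0, timesOdd_phiF K 0, timesOdd_phiF K 1,
    timesEven_psiF K 0, sub_eq_add_neg, hneg, ← ser_add, ← ser_add, ← ser_add, ← ser_add, delta4]
  simp

variable {K} [CharZero K] {𝒜 : ZMod 2 → Submodule K A} {ε : A →ₐ[K] K}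

/-- The remaining components of a normal form are given by polynomial division. -/
lemma IsFormalBase.eq_of_remainder {K : Type u} [Field K] [Algebra K A]
    {𝒜 : ZMod 2 → Submodule K A} {ε : A →ₐ[K] K} (h : IsFormalBase 𝒜 ε) {n : ℕ} {β γ γ' p r : A⟦X⟧}
    (hβ : IsWeierstrass ε n β) (h1 : p + β * γ = 0) (h2 : p + β * γ' = r)
    (hr : ∀ k, PowerSeries.coeff (n + k) r = 0) : γ' = γ ∧ r = 0 := by
  have h3 : r = β * (γ' - γ) := by
    rw [mul_sub, ← h2, ← sub_eq_zero, ← h1]; abel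
  have h4 : γ' - γ = 0 := h.eq_zero_of_weierstrass hβ fun k => by rw [← h3, hr]
  exact ⟨sub_eq_zero.1 h4, by rw [h3, h4, mul_zero]⟩

lemma dX_monomial (k : ℕ) (a : A) :
    dX (PowerSeries.monomial k a) = PowerSeries.monomial (k - 1) (k • a) := by
  ext m
  rw [coeff_dX, PowerSeries.coeff_monomial, PowerSeries.coeff_monomial]
  cases k with
  | zero => simp
  | succ k =>
    by_cases h : m = k
    · simp [h]
    · simp [h]

/-- A polynomial of degree at most two. -/
def quad (a b c : A) : A⟦X⟧ :=
  PowerSeries.monomial 0 a + PowerSeries.monomial 1 b + PowerSeries.monomial 2 c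

lemma deltaSer_two (θ : Fin 2 → A) : deltaSer K θ = PowerSeries.monomial 0 (θ 0) := by
  have h1 : (2 : K) - 1 = 1 := by norm_num
  simp [deltaSer, Fin.sum_univ_two, h1]

lemma deltaSer_three (θ : Fin 3 → A) :
    deltaSer K θ = PowerSeries.monomial 0 (θ 0 + θ 0) + PowerSeries.monomial 1 (θ 1) := by
  have h1 : (3 : K) - 1 = 2 := by norm_num
  have h2 : (2 : K) - 1 = 1 := by norm_num
  have h3 : (3 : K) - 2 = 1 := by norm_num
  simp [deltaSer, Fin.sum_univ_three, h1, h2, h3, two_smul]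

lemma three_mul_eq (a : A) : 3 * a = a + a + a := by
  rw [← one_mul a, ← mul_assoc, ← add_mul, ← add_mul]; norm_num

lemma three_nsmul_eq (a : A) : 3 • a = a + a + a := by
  rw [succ_nsmul, two_nsmul]

/-- For one pair of parameters `α' α` is zero, and the second division leaves the constant remainder
`θ_1 t_1`, the only relation. -/
lemma IsLocalBase.square_one (h : IsLocalBase 𝒜 ε) {θ t : Fin 1 → A} (hθ : ∀ i, θ i ∈ 𝒜 1) :
    dX (alphaSer θ) * alphaSer θ + betaSer t * 0 = 0 ∧
    dX (alphaSer θ) * betaSer t - dX (betaSer t) * alphaSer θ + betaSer t * deltaSer K θ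
      = quad (θ 0 * t 0) 0 0 := by
  have h00 := h.mul_self (hθ 0)
  constructor
  · simp only [alphaSer, Fin.sum_univ_one, dX_monomial, PowerSeries.monomial_mul_monomial,
      smul_mul_assoc, h00, smul_zero, map_zero, mul_zero, add_zero]
  · simp only [alphaSer, betaSer, deltaSer, Fin.sum_univ_one, Fin.val_zero, map_add, dX_monomial,
      zero_add, PowerSeries.X_pow_eq, add_mul, mul_add, PowerSeries.monomial_mul_monomial, quad,
      one_smul, zero_smul, map_zero, mul_one, one_mul, Nat.sub_self, add_zero]
    simp

/-- These are the two divisions by `x^2 + t_2 x + t_1`. Here `α' α = -θ_1 θ_2 x^2`, so the first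
quotient is the constant `θ_1 θ_2`; it must vanish since `γ` has no constant term, and then so does
the first remainder. The second remainder gives the other two relations. -/
lemma IsLocalBase.square_two (h : IsLocalBase 𝒜 ε) {θ t : Fin 2 → A} (hθ : ∀ i, θ i ∈ 𝒜 1)
    (ht : ∀ i, t i ∈ 𝒜 0) :
    dX (alphaSer θ) * alphaSer θ + betaSer t * PowerSeries.monomial 0 (θ 0 * θ 1)
      = quad (t 0 * (θ 0 * θ 1)) (t 1 * (θ 0 * θ 1)) 0 ∧
    dX (alphaSer θ) * betaSer t - dX (betaSer t) * alphaSer θ + betaSer t * delta3 K θ t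
      = quad (2 * θ 0 * t 0 - θ 1 * t 0 * t 1) (θ 0 * t 1 + 2 * θ 1 * t 0 - θ 1 * t 1 ^ 2) 0 := by
  have hc : ∀ i j, t i * θ j = θ j * t i := fun i j => h.central (ht i) _
  have hc' : ∀ i j w, t i * (θ j * w) = θ j * (t i * w) := fun i j w => by
    rw [← mul_assoc, hc, mul_assoc]
  have h10 := h.central (ht 1) (t 0)
  have h00 := h.mul_self (hθ 0)
  have h11 := h.mul_self (hθ 1)
  have ha : θ 1 * θ 0 = - (θ 0 * θ 1) := h.anticomm (hθ 1) (hθ 0)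
  constructor
  · simp only [alphaSer, betaSer, Fin.sum_univ_two, Fin.val_zero, Fin.val_one, map_add, dX_monomial,
      zero_add, PowerSeries.X_pow_eq, add_mul, mul_add,
      PowerSeries.monomial_mul_monomial, quad, one_smul, one_mul, h00, map_zero]
    ext k
    -- All monomials that occur have degree less than 6, so finitely many coefficients remain to be
    -- compared.
    rcases lt_or_ge k 6 with hk | hk
    · interval_cases k <;> simp only [PowerSeries.coeff_monomial, map_add] <;>
        norm_num <;>
        simp only [two_mul, add_mul, ha, h11] <;>
        abel
    · have e : ∀ (j : ℕ) (a : A), j < 6 → PowerSeries.coeff k (PowerSeries.monomial j a) = 0 :=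
        fun j a hj => by rw [PowerSeries.coeff_monomial, if_neg (by omega)]
      simp only [map_add]
      simp [e, -PowerSeries.monomial_zero_eq_C]
  · simp only [alphaSer, betaSer, Fin.sum_univ_two, Fin.val_zero, Fin.val_one, map_add, dX_monomial,
      zero_add, PowerSeries.X_pow_eq, add_mul, mul_add, two_nsmul, delta3, deltaSer_two,
      PowerSeries.monomial_mul_monomial, quad, one_smul, one_mul, mul_one]
    ext k
    rcases lt_or_ge k 6 with hk | hk
    · interval_cases k <;> simp only [PowerSeries.coeff_monomial, map_add, map_sub] <;>
        norm_num <;>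
        simp only [two_mul, add_mul, mul_assoc, hc, hc', pow_two] <;>
        abel
    · have e : ∀ (j : ℕ) (a : A), j < 6 → PowerSeries.coeff k (PowerSeries.monomial j a) = 0 :=
        fun j a hj => by rw [PowerSeries.coeff_monomial, if_neg (by omega)]
      simp only [map_add, map_sub, map_neg]
      simp [e, -PowerSeries.monomial_zero_eq_C]

/-- These are the two divisions by the cubic `β`. The first quotient `θ_2 θ_3 x + (2 θ_1 θ_3 - θ_2
θ_3 t_3)` explains the term `ψ^1_f θ_2 θ_3`, and its constant term is up to sign the third relation.
The second quotient is `-delta4`, and the coefficients of its remainder are the last three relations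
up to sign. -/
lemma IsLocalBase.square_three (h : IsLocalBase 𝒜 ε) {θ t : Fin 3 → A} (hθ : ∀ i, θ i ∈ 𝒜 1)
    (ht : ∀ i, t i ∈ 𝒜 0) :
    dX (alphaSer θ) * alphaSer θ + betaSer t * (PowerSeries.monomial 1 (θ 1 * θ 2)
        + PowerSeries.monomial 0 (2 * θ 0 * θ 2 - θ 1 * θ 2 * t 2))
      = quad (t 0 * (2 * θ 0 * θ 2 - θ 1 * θ 2 * t 2))
        (θ 1 * θ 2 * t 0 + t 1 * (2 * θ 0 * θ 2 - θ 1 * θ 2 * t 2))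
        (-(θ 0 * θ 1) + θ 1 * θ 2 * t 1 + t 2 * (2 * θ 0 * θ 2 - θ 1 * θ 2 * t 2)) ∧
    dX (alphaSer θ) * betaSer t - dX (betaSer t) * alphaSer θ + betaSer t * delta4 K θ t
      = quad (-(-3 * θ 0 * t 0 + θ 1 * t 0 * t 2 + 2 * θ 2 * t 0 * t 1 - θ 2 * t 0 * t 2 ^ 2))
        (-(-2 * θ 0 * t 1 - 3 * θ 1 * t 0 + θ 1 * t 1 * t 2 + 2 * θ 2 * t 1 ^ 2 + θ 2 * t 0 * t 2
          - θ 2 * t 1 * t 2 ^ 2))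
        (-(-(θ 0 * t 2) - 2 * θ 1 * t 1 - 3 * θ 2 * t 0 + θ 1 * t 2 ^ 2 + 3 * θ 2 * t 1 * t 2
          - θ 2 * t 2 ^ 3)) := by
  have hc : ∀ i j, t i * θ j = θ j * t i := fun i j => h.central (ht i) _
  have hc' : ∀ i j w, t i * (θ j * w) = θ j * (t i * w) := fun i j w => by
    rw [← mul_assoc, hc, mul_assoc]
  have h10 := h.central (ht 1) (t 0)
  have h20 := h.central (ht 2) (t 0)
  have h21 := h.central (ht 2) (t 1)
  have h10' : ∀ w, t 1 * (t 0 * w) = t 0 * (t 1 * w) := fun w => by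
    rw [← mul_assoc, h10, mul_assoc]
  have h20' : ∀ w, t 2 * (t 0 * w) = t 0 * (t 2 * w) := fun w => by
    rw [← mul_assoc, h20, mul_assoc]
  have h21' : ∀ w, t 2 * (t 1 * w) = t 1 * (t 2 * w) := fun w => by
    rw [← mul_assoc, h21, mul_assoc]
  have s0 := h.mul_self (hθ 0)
  have s1 := h.mul_self (hθ 1)
  have s2 := h.mul_self (hθ 2)
  have a10 : θ 1 * θ 0 = - (θ 0 * θ 1) := h.anticomm (hθ 1) (hθ 0)
  have a20 : θ 2 * θ 0 = - (θ 0 * θ 2) := h.anticomm (hθ 2) (hθ 0)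
  have a21 : θ 2 * θ 1 = - (θ 1 * θ 2) := h.anticomm (hθ 2) (hθ 1)
  constructor
  · simp only [alphaSer, betaSer, Fin.sum_univ_three, Fin.val_zero, Fin.val_one, Fin.val_two,
      map_add, dX_monomial,
      zero_add, PowerSeries.X_pow_eq, add_mul, mul_add,
      PowerSeries.monomial_mul_monomial, quad, one_smul, one_mul, s0]
    ext k
    rcases lt_or_ge k 6 with hk | hk
    · interval_cases k <;> simp only [PowerSeries.coeff_monomial, map_add, map_sub] <;>
        norm_num <;>
        simp only [two_mul, three_mul_eq, mul_add, add_mul, mul_sub, mul_assoc, hc, hc', a10, a20,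
          a21, s1, s2] <;>
        abel
    · have e : ∀ (j : ℕ) (a : A), j < 6 → PowerSeries.coeff k (PowerSeries.monomial j a) = 0 :=
        fun j a hj => by rw [PowerSeries.coeff_monomial, if_neg (by omega)]
      simp only [map_add, map_sub, map_neg]
      simp [e, -PowerSeries.monomial_zero_eq_C]
  · simp only [alphaSer, betaSer, Fin.sum_univ_three, Fin.val_zero, Fin.val_one, Fin.val_two,
      map_add, dX_monomial,
      zero_add, PowerSeries.X_pow_eq, add_mul, mul_add, two_nsmul, three_nsmul_eq, delta4,
      deltaSer_three, PowerSeries.monomial_mul_monomial, quad, one_smul, one_mul, mul_one]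
    ext k
    rcases lt_or_ge k 6 with hk | hk
    · interval_cases k <;> simp only [PowerSeries.coeff_monomial, map_add, map_sub] <;>
        norm_num <;>
        simp only [two_mul, three_mul_eq, mul_add, add_mul, mul_assoc, hc, hc', h21, pow_succ, pow_zero,
          one_mul, mul_neg] <;>
        abel
    · have e : ∀ (j : ℕ) (a : A), j < 6 → PowerSeries.coeff k (PowerSeries.monomial j a) = 0 :=
        fun j a hj => by rw [PowerSeries.coeff_monomial, if_neg (by omega)]
      simp only [map_add, map_sub, map_neg]
      simp [e, -PowerSeries.monomial_zero_eq_C]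

end Explicit

end LInfty
end

noncomputable section
namespace LInfty
open PowerSeries

/-! ### Entries in low degree as invariants of infinitesimal deformations -/

section Uniqueness

/-- The degree of a monomial. -/
def Mon.deg : Mon → ℕ
  | .E n => n + 1
  | .F n => n + 1

variable {A : Type v} [Ring A]

/-- The function vanishes on the monomials of degree less than `d`. -/
def VanishesBelow (d : ℕ) (φ : Fn A) : Prop :=
  (∀ m < d, PowerSeries.coeff m φ.1 = 0) ∧ ∀ m, m + 1 < d → PowerSeries.coeff m φ.2 = 0

lemma coeff_mul_eq_zero {a b m : ℕ} {p q : A⟦X⟧} (hp : ∀ i < a, PowerSeries.coeff i p = 0)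
    (hq : ∀ i < b, PowerSeries.coeff i q = 0) (hm : m + 1 < a + b + 1) :
    PowerSeries.coeff m (p * q) = 0 := by
  rw [PowerSeries.coeff_mul]
  refine Finset.sum_eq_zero fun x hx => ?_
  rw [Finset.HasAntidiagonal.mem_antidiagonal] at hx
  rcases lt_or_ge x.1 a with h | h
  · rw [hp _ h, zero_mul]
  · rw [hq _ (by omega), mul_zero]

lemma VanishesBelow.mulFn {d : ℕ} {φ ψ : Fn A} (hφ : VanishesBelow 1 φ) (hψ : VanishesBelow d ψ)
    (s t : ℤ) : VanishesBelow (d + 1) (mulFn s t φ ψ) := by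
  refine ⟨fun m hm => ?_, fun m hm => ?_⟩
  · have h0 := coeff_mul_eq_zero hφ.1 hψ.1 (show m + 1 < 1 + d + 1 by omega)
    rw [LInfty.mulFn, map_zsmul, h0, smul_zero]
  have h1 : PowerSeries.coeff m (φ.1 * ψ.2) = 0 :=
    coeff_mul_eq_zero (b := d - 1) hφ.1 (fun i hi => hψ.2 i (by omega)) (by omega)
  have h2 : PowerSeries.coeff m (φ.2 * ψ.1) = 0 :=
    coeff_mul_eq_zero (a := 0) (by simp) hψ.1 (by omega)
  rw [LInfty.mulFn, map_add, map_zsmul, map_zsmul, h1, h2, smul_zero, smul_zero, add_zero]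

lemma End_apply (δ : End A) (s : S A) (z : Mon) :
    δ s z = s.sum fun u a => δ (Finsupp.single u 1) z * a := by
  induction s using Finsupp.induction_linear with
  | zero => simp
  | add s t hs ht =>
    rw [map_add, Finsupp.add_apply, hs, ht, Finsupp.sum_add_index' (by simp)
      (fun u a b => mul_add _ a b)]
  | single i b =>
    rw [single_eq_op_smul, map_smul, ← single_eq_op_smul, Finsupp.sum_single_index (by simp)]
    rfl

variable {K : Type u} [Field K]

/-- The cochain consumes `n + 1` factors, more than `w` has. -/
lemma dPsi_apply_eq_zero (n : ℕ) {w : Mon} (hw : w.deg ≤ n) :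
    dPsi K (n + 1) (Finsupp.single w 1) = 0 := by
  rw [dPsi, coder, extend_single_one]
  cases w with
  | E k => simp [psiE]
  | F k =>
    have hk : k + 1 ≤ n := hw
    refine (sub_eq_zero.2 ?_)
    rw [Finset.sum_eq_zero, Finset.sum_eq_zero]
    · simp [psiE]
    · intro i hi
      rw [Finset.mem_range] at hi
      simp [psiE, show i ≠ n by omega]

variable [Algebra K A]

lemma vanishesBelow_one_transpose (g : End A) (φ : Fn A) : VanishesBelow 1 (transpose K g φ) :=
  ⟨fun m hm => by rw [Nat.lt_one_iff.1 hm, coeff_zero_transpose], fun m hm => by omega⟩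

variable [CharZero K]

/-- A monomial of degree `d` is a product of `d` coordinates. A multiplicative map sends each of
them to a function without constant term, so the product starts in degree `d`. -/
lemma vanishesBelow_transpose {g : End A} (hg : IsCoalgebraMorphism g) (z : Mon) :
    VanishesBelow z.deg (transpose K g z.hat) := by
  have hg' := (isCoalgebraMorphism_iff K g).1 hg
  have hE : ∀ k, VanishesBelow (k + 1) (transpose K g (Mon.E k).hat) := by
    intro k
    induction k with
    | zero => exact vanishesBelow_one_transpose g _
    | succ k ih =>
      have e : (Mon.E (k + 1)).hat = hatMul (A := A) (.E 0) (.E k) := by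
        rw [hatMul_EE, ← pow_add, Mon.hat, show 0 + 1 + (k + 1) = k + 1 + 1 by omega]
      rw [e, hg']
      exact (vanishesBelow_one_transpose g _).mulFn ih _ _
  cases z with
  | E k => exact hE k
  | F k =>
    induction k with
    | zero => exact vanishesBelow_one_transpose g _
    | succ k ih =>
      have e : (Mon.F (k + 1)).hat = hatMul (A := A) (.E 0) (.F k) := by
        rw [hatMul_EF, ← pow_add, Mon.hat, show 0 + 1 + k = k + 1 by omega]
      rw [e, hg']
      exact (vanishesBelow_one_transpose g _).mulFn ih _ _

/-- A coalgebra morphism does not raise the degree. -/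
lemma IsCoalgebraMorphism.apply_eq_zero (K : Type u) [Field K] [Algebra K A] [CharZero K]
    {g : End A} (hg : IsCoalgebraMorphism g) {w z : Mon}
    (h : w.deg < z.deg) : g (Finsupp.single w 1) z = 0 := by
  have hz := vanishesBelow_transpose (K := K) hg z
  refine fac_smul_cancel K (m := z.pow) ?_
  rw [smul_zero]
  refine (fac_smul_apply K g w z).trans ?_
  cases w with
  | E k => rw [coeff_E, hz.1 (k + 1) h, smul_zero]
  | F k => rw [coeff_F, hz.2 k h, smul_zero]

/-- Equivalent infinitesimal deformations of `ψ^{n+1}_e` agree in degrees at most `n`. -/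
lemma IsInfinitesimalBase.apply_eq_of_equivalent {𝒜 : ZMod 2 → Submodule K A} {ε : A →ₐ[K] K}
    (h : IsInfinitesimalBase 𝒜 ε) {n : ℕ} {δ₁ δ₂ : End A}
    (h₁ : push (ε : A →+* K) δ₁ = dPsi K (n + 1)) (h₂ : push (ε : A →+* K) δ₂ = dPsi K (n + 1))
    (he : Equivalent 𝒜 ε δ₁ δ₂) {w : Mon} (hw : w.deg ≤ n) (z : Mon) :
    δ₁ (Finsupp.single w 1) z = δ₂ (Finsupp.single w 1) z := by
  obtain ⟨g, -, hg, hgε, hge⟩ := he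
  have hm : ∀ δ : End A, push (ε : A →+* K) δ = dPsi K (n + 1) → ∀ w : Mon, w.deg ≤ n → ∀ z,
      ε (δ (Finsupp.single w 1) z) = 0 := by
    intro δ hδ w hw z
    have := push_single (ε : A →+* K) δ w z
    rw [hδ, dPsi_apply_eq_zero n hw] at this
    exact this.symm
  have hgu : ∀ w u : Mon, ε (g (Finsupp.single w 1) u - Finsupp.single w 1 u) = 0 := by
    intro w u
    have := DFunLike.congr_fun (hgε (Finsupp.single w 1)) u
    rw [Finsupp.mapRange_apply, Finsupp.mapRange_apply] at this
    rw [map_sub, this, sub_self]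
  have hcomp : δ₁ (g (Finsupp.single w 1)) = g (δ₂ (Finsupp.single w 1)) := by
    rw [← hge]; simp
  -- In degrees at most `n` both `g - 1` and `δ₁` have entries in the maximal ideal, whose square is
  -- zero. Monomials of higher degree do not contribute, as `g` does not raise the degree.
  have e1 : δ₁ (g (Finsupp.single w 1)) z = δ₁ (Finsupp.single w 1) z := by
    rw [← sub_eq_zero, ← Finsupp.sub_apply, ← map_sub, End_apply]
    refine Finset.sum_eq_zero fun u _ => ?_
    rcases le_or_gt u.deg n with hu | hu
    · exact h.sq_zero _ _ (hm δ₁ h₁ u hu z) (hgu w u)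
    · rw [Finsupp.sub_apply]
      have h0 : (g (Finsupp.single w 1)) u = 0 := hg.apply_eq_zero K (hw.trans_lt hu)
      have h1 : w ≠ u := by rintro rfl; omega
      rw [h0, Finsupp.single_eq_of_ne h1.symm, sub_zero]
      exact mul_zero _
  have e2 : g (δ₂ (Finsupp.single w 1)) z = δ₂ (Finsupp.single w 1) z := by
    rw [← sub_eq_zero, ← Finsupp.sub_apply]
    have := End_apply (g.toLinearMap - LinearMap.id) (δ₂ (Finsupp.single w 1)) z
    refine Eq.trans this (Finset.sum_eq_zero fun u _ => ?_)
    exact h.sq_zero _ _ (hgu u z) (hm δ₂ h₂ w hw u)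
  rw [← e1, hcomp, e2]

/-- The parameters of a normal form are determined by the entries in degrees at most `n`. -/
lemma coder_ser_apply (K : Type u) [Field K] [Algebra K A] [CharZero K] (α β γ δ : A⟦X⟧) (k : ℕ) (hα : PowerSeries.coeff 0 α = 0)
    (hγ : PowerSeries.coeff 0 γ = 0) :
    coder (ser α β γ δ) (Finsupp.single (.E k) 1) (.E 0)
        = (k + 1).factorial • PowerSeries.coeff (k + 1) α ∧
      coder (ser α β γ δ) (Finsupp.single (.F k) 1) (.E 0)
        = k.factorial • PowerSeries.coeff k β := by
  have h1 := fac_smul_apply K (coder (ser α β γ δ)) (.E k) (.E 0)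
  have h2 := fac_smul_apply K (coder (ser α β γ δ)) (.F k) (.E 0)
  rw [transpose_coder_ser K hα hγ] at h1 h2
  simp only [Mon.fac, Mon.pow, zero_add, Nat.factorial_one, one_smul, coeff_E, coeff_F, vf, Mon.hat,
    pow_one, dX_X, one_mul, zero_mul, add_zero, map_zero, sub_zero] at h1 h2
  exact ⟨h1, h2⟩

end Uniqueness
end LInfty
end

noncomputable section
namespace LInfty
open PowerSeries

/-! ### The algebra `K[[θ, t]]` -/

section Exterior

variable {R : Type u} [CommRing R] {M : Type v} [AddCommGroup M] [Module R M]

local notation "ev" => CliffordAlgebra.evenOdd (0 : QuadraticForm R M) 0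
local notation "od" => CliffordAlgebra.evenOdd (0 : QuadraticForm R M) 1

lemma ι_mul_ι_swap (a b : M) :
    ExteriorAlgebra.ι R a * ExteriorAlgebra.ι R b
      = -(ExteriorAlgebra.ι R b * ExteriorAlgebra.ι R a) :=
  eq_neg_of_add_eq_zero_left (ExteriorAlgebra.ι_add_mul_swap a b)

lemma ι_mul_ι_comm (a b : M) (y : ExteriorAlgebra R M) :
    Commute (ExteriorAlgebra.ι R a * ExteriorAlgebra.ι R b) y := by
  induction y using ExteriorAlgebra.induction with
  | algebraMap r => exact (Algebra.commutes r _).symm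
  | ι v =>
    rw [Commute, SemiconjBy, mul_assoc, ι_mul_ι_swap b v, mul_neg, ← mul_assoc, ι_mul_ι_swap a v,
      neg_mul, neg_neg, mul_assoc]
  | mul x y hx hy => exact hx.mul_right hy
  | add x y hx hy => exact hx.add_right hy

lemma even_commute {x : ExteriorAlgebra R M} (hx : x ∈ ev) (y : ExteriorAlgebra R M) :
    x * y = y * x := by
  induction x, hx using CliffordAlgebra.even_induction with
  | algebraMap r => exact Algebra.commutes r _
  | add x z _ _ hx hz => rw [add_mul, mul_add, hx, hz]
  | ι_mul_ι_mul a b x _ ih => 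
    rw [mul_assoc, ih, ← mul_assoc, (ι_mul_ι_comm a b y).eq, mul_assoc]

lemma odd_anticommute {x y : ExteriorAlgebra R M} (hx : x ∈ od) (hy : y ∈ od) :
    x * y = -(y * x) := by
  induction x, hx using CliffordAlgebra.odd_induction with
  | ι v =>
    induction y, hy using CliffordAlgebra.odd_induction with
    | ι w => exact ι_mul_ι_swap v w
    | add x z _ _ hx hz => rw [add_mul, mul_add, hx, hz, neg_add]
    | ι_mul_ι_mul a b x _ ih =>
      rw [← mul_assoc, ← (ι_mul_ι_comm a b (ExteriorAlgebra.ι R v)).eq, mul_assoc, ih, mul_neg,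
        ← mul_assoc]
  | add x z _ _ hx hz => rw [add_mul, mul_add, hx, hz, neg_add]
  | ι_mul_ι_mul a b x _ ih =>
    rw [mul_assoc, ih, mul_neg, ← mul_assoc, (ι_mul_ι_comm a b y).eq, mul_assoc]

/-- The span of the products of `k` generators. -/
def genPow (R : Type u) [CommRing R] (M : Type v) [AddCommGroup M] [Module R M] (k : ℕ) :
    Submodule R (ExteriorAlgebra R M) := LinearMap.range (ExteriorAlgebra.ι R (M := M)) ^ k

lemma genPow_add (k l : ℕ) : genPow R M (k + l) = genPow R M k * genPow R M l := pow_add _ _ _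

lemma iSup_genPow : ⨆ k, genPow R M k = ⊤ := CliffordAlgebra.iSup_ι_range_eq_top _

/-- An alternating map of more than `n` arguments is zero on the standard basis, which has no `k`
distinct elements. -/
lemma genPow_eq_bot {n k : ℕ} (h : n < k) : genPow R (Fin n → R) k = ⊥ := by
  have h0 : (ExteriorAlgebra.ιMulti R k (M := Fin n → R)) = 0 := by
    refine Module.Basis.ext_alternating (Pi.basisFun R (Fin n)) fun v hv => ?_
    have := Fintype.card_le_of_injective v hv
    simp only [Fintype.card_fin] at this
    omega
  have h1 := ExteriorAlgebra.ιMulti_span_fixedDegree R k (M := Fin n → R)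
  refine h1.symm.trans ?_
  rw [h0, Submodule.span_eq_bot]
  rintro _ ⟨v, rfl⟩
  rfl

/-- Finiteness is what allows completeness and Krull's intersection theorem to be transferred from
the power series ring. -/
lemma finite_exteriorAlgebra (n : ℕ) : Module.Finite R (ExteriorAlgebra R (Fin n → R)) := by
  refine ⟨?_⟩
  rw [← iSup_genPow]
  have h : ⨆ k, genPow R (Fin n → R) k = ⨆ k : Fin (n + 1), genPow R (Fin n → R) k := by
    refine le_antisymm (iSup_le fun k => ?_) (iSup_le fun k => le_iSup (genPow R (Fin n → R)) k)
    rcases lt_or_ge n k with hk | hk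
    · rw [genPow_eq_bot hk]; exact bot_le
    · exact le_iSup (fun k : Fin (n + 1) => genPow R (Fin n → R) k) ⟨k, by omega⟩
  rw [h]
  refine Submodule.fg_iSup _ fun k => ?_
  refine Submodule.FG.pow ?_ _
  rw [LinearMap.range_eq_map]
  exact Submodule.FG.map _ Module.Finite.fg_top

/-- Elements with at least `k` factors, each a generator or a scalar in `I`. -/
def filt (M : Type v) [AddCommGroup M] [Module R M] (I : Ideal R) (k : ℕ) :
    Submodule R (ExteriorAlgebra R M) := ⨆ j, I ^ (k - j) • genPow R M j

lemma filt_zero (I : Ideal R) : filt M I 0 = ⊤ := by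
  rw [filt, ← iSup_genPow]
  simp

lemma smul_mul_smul_le (I J : Ideal R) {A : Type v} [Ring A] [Algebra R A] (V W : Submodule R A) :
    (I • V) * (J • W) ≤ (I * J) • (V * W) := by
  refine Submodule.mul_le.2 fun x hx y hy => ?_
  refine Submodule.smul_induction_on hx (fun a ha v hv => ?_) fun x x' h h' => by
    rw [add_mul]; exact add_mem h h'
  refine Submodule.smul_induction_on hy (fun b hb w hw => ?_) fun x x' h h' => by
    rw [mul_add]; exact add_mem h h'
  rw [smul_mul_smul_comm]
  exact Submodule.smul_mem_smul (Ideal.mul_mem_mul ha hb) (Submodule.mul_mem_mul hv hw)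

lemma filt_mul_le (I : Ideal R) (k l : ℕ) : filt M I k * filt M I l ≤ filt M I (k + l) := by
  rw [filt, Submodule.iSup_mul]
  refine iSup_le fun i => ?_
  rw [filt, Submodule.mul_iSup]
  refine iSup_le fun j => ?_
  refine le_trans ?_ (le_iSup (fun j => I ^ (k + l - j) • genPow R M j) (i + j))
  refine (smul_mul_smul_le _ _ _ _).trans ?_
  rw [← pow_add, ← genPow_add]
  exact Submodule.smul_mono_left (Ideal.pow_le_pow_right (by omega))

/-- A nonzero product contains at most `n` exterior generators, so among `k + n` factors at least
`k` are scalars in `I`. -/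
lemma filt_le (I : Ideal R) (n k : ℕ) : filt (Fin n → R) I (k + n) ≤ I ^ k • ⊤ := by
  refine iSup_le fun j => ?_
  rcases lt_or_ge n j with hj | hj
  · rw [genPow_eq_bot hj, Submodule.smul_bot]; exact bot_le
  · exact Submodule.smul_mono (Ideal.pow_le_pow_right (by omega)) le_top

/-- Apart from its scalar part, every element is a combination of products with at least one
generator. -/
lemma mem_filt_one {I : Ideal R} {x : ExteriorAlgebra R M}
    (hx : ExteriorAlgebra.algebraMapInv x ∈ I) : x ∈ filt M I 1 := by
  have h : ∀ x : ExteriorAlgebra R M,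
      x - algebraMap R _ (ExteriorAlgebra.algebraMapInv x) ∈ filt M I 1 := by
    have h1 : ∀ j, genPow R M (j + 1) ≤ filt M I 1 := fun j =>
      le_trans (by simp) (le_iSup (fun j => I ^ (1 - j) • genPow R M j) (j + 1))
    intro x
    have hx : x ∈ ⨆ k, genPow R M k := by rw [iSup_genPow]; trivial
    induction hx using Submodule.iSup_induction' with
    | mem j x hx =>
      cases j with
      | zero =>
        obtain ⟨r, rfl⟩ := Submodule.mem_one.1 hx
        rw [ExteriorAlgebra.algebraMap_leftInverse, sub_self]
        exact zero_mem _
      | succ j =>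
        have : ExteriorAlgebra.algebraMapInv x = 0 := by
          rw [genPow_add, genPow, genPow, pow_one] at hx
          induction hx using Submodule.mul_induction_on' with
          | mem_mul_mem a _ b hb =>
            obtain ⟨v, rfl⟩ := hb
            simp [ExteriorAlgebra.algebraMapInv]
          | add x _ y _ hx hy => rw [map_add, hx, hy, add_zero]
        rw [this, map_zero, sub_zero]
        exact h1 j hx
    | zero => simp
    | add x y _ _ hx hy =>
      rw [map_add, map_add, add_sub_add_comm]
      exact add_mem hx hy
  rw [← sub_add_cancel x (algebraMap R _ (ExteriorAlgebra.algebraMapInv x))]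
  refine add_mem (h x) (Submodule.mem_iSup_of_mem 0 ?_)
  rw [Algebra.algebraMap_eq_smul_one, tsub_zero, pow_one]
  exact Submodule.smul_mem_smul hx (Submodule.one_le.1 le_rfl)

end Exterior

/-! ### The maximal ideal of the power series ring -/

section Vars

variable {K : Type u} [Field K] {n : ℕ}

/-- A power series without constant term is a combination of the variables. -/
lemma mem_span_range_X {f : MvPowerSeries (Fin n) K} (hf : MvPowerSeries.constantCoeff f = 0) :
    f ∈ Ideal.span (Set.range (MvPowerSeries.X : Fin n → MvPowerSeries (Fin n) K)) := by
  classical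
  -- Each nonconstant monomial is assigned to one variable that divides it; `g i` collects the
  -- monomials assigned to the `i`-th variable, divided by it.
  have hex : ∀ d : Fin n →₀ ℕ, d ≠ 0 → ∃ i, d i ≠ 0 := fun d hd => Finsupp.ne_iff.1 hd
  choose c hc using hex
  let g : Fin n → MvPowerSeries (Fin n) K := fun i d =>
    if ∃ h, c (Finsupp.single i 1 + d) h = i then MvPowerSeries.coeff (Finsupp.single i 1 + d) f else 0
  have hg : f = ∑ i, MvPowerSeries.X i * g i := by
    ext d
    rw [map_sum]
    have e : ∀ i, MvPowerSeries.coeff d (MvPowerSeries.X i * g i)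
        = if Finsupp.single i 1 ≤ d ∧ ∃ h, c d h = i then MvPowerSeries.coeff d f else 0 := by
      intro i
      rw [MvPowerSeries.X_def, MvPowerSeries.coeff_monomial_mul, one_mul]
      by_cases h : Finsupp.single i 1 ≤ d
      · have h2 : MvPowerSeries.coeff (d - Finsupp.single i 1) (g i)
            = if ∃ h, c (Finsupp.single i 1 + (d - Finsupp.single i 1)) h = i then
              MvPowerSeries.coeff (Finsupp.single i 1 + (d - Finsupp.single i 1)) f else 0 := rfl
        rw [h2, add_tsub_cancel_of_le h]
        simp [h]
      · simp [h]
    simp only [e]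
    by_cases hd : d = 0
    · subst hd
      rw [show MvPowerSeries.coeff 0 f = 0 from hf]
      simp
    · rw [Finset.sum_eq_single (c d hd)]
      · rw [if_pos]
        refine ⟨?_, hd, rfl⟩
        rw [Finsupp.single_le_iff]
        exact Nat.one_le_iff_ne_zero.2 (hc d hd)
      · intro i _ hi
        rw [if_neg fun h => hi h.2.2.symm]
      · intro h; exact absurd (Finset.mem_univ _) h
  rw [hg]
  exact sum_mem fun i _ => Ideal.mul_mem_right _ _ (Ideal.subset_span ⟨i, rfl⟩)

end Vars
end LInfty
end

noncomputable section
namespace LInfty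
open PowerSeries

/-! ### Completeness of the free algebra -/

section FreeComplete

variable {K : Type u} [Field K] {n : ℕ}

/-- The ideal of the variables. -/
abbrev varIdeal (K : Type u) [Field K] (n : ℕ) : Ideal (MvPowerSeries (Fin n) K) :=
  Ideal.span (Set.range MvPowerSeries.X)

lemma freeAug_apply (x : Free K n) :
    freeAug K n x = MvPowerSeries.constantCoeff (ExteriorAlgebra.algebraMapInv x) := rfl

lemma augIdeal_pow_le_filt (k : ℕ) :
    augIdeal (freeAug K n) ^ k ≤ (filt _ (varIdeal K n) k).restrictScalars K := by
  induction k with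
  | zero => rw [filt_zero]; exact le_top
  | succ k ih =>
    rw [pow_succ, Submodule.mul_le]
    intro a ha b hb
    exact filt_mul_le _ k 1 (Submodule.mul_mem_mul (ih ha) (mem_filt_one (mem_span_range_X hb)))

/-- Together with `mem_augIdeal_pow` this shows that the powers of the augmentation ideal and of the
ideal of the even variables define the same topology, with a shift by `n` in one direction. -/
lemma augIdeal_pow_le (k : ℕ) {x : Free K n} (hx : x ∈ augIdeal (freeAug K n) ^ (k + n)) :
    x ∈ varIdeal K n ^ k • (⊤ : Submodule (MvPowerSeries (Fin n) K) (Free K n)) :=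
  filt_le _ n k (augIdeal_pow_le_filt _ hx)

lemma algebraMap_mem_augIdeal_pow (k : ℕ) {r : MvPowerSeries (Fin n) K}
    (hr : r ∈ varIdeal K n ^ (k + 1)) :
    algebraMap _ (Free K n) r ∈ augIdeal (freeAug K n) ^ (k + 1) := by
  have h1 : ∀ r ∈ varIdeal K n, algebraMap _ (Free K n) r ∈ augIdeal (freeAug K n) := by
    intro r hr
    have : varIdeal K n ≤ RingHom.ker (MvPowerSeries.constantCoeff (σ := Fin n) (R := K)) := by
      rw [Ideal.span_le]
      rintro _ ⟨i, rfl⟩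
      exact MvPowerSeries.constantCoeff_X i
    rw [mem_augIdeal, freeAug_apply, ExteriorAlgebra.algebraMap_leftInverse]
    exact this hr
  induction k generalizing r with
  | zero => rw [zero_add, pow_one] at hr ⊢; exact h1 r hr
  | succ k ih =>
    rw [pow_succ] at hr ⊢
    refine Submodule.mul_induction_on hr (fun a ha b hb => ?_) fun a b ha hb => ?_
    · rw [map_mul]
      exact Submodule.mul_mem_mul (ih ha) (h1 b hb)
    · rw [map_add]; exact add_mem ha hb

lemma mem_augIdeal_pow (k : ℕ) {x : Free K n}
    (hx : x ∈ varIdeal K n ^ (k + 1) • (⊤ : Submodule (MvPowerSeries (Fin n) K) (Free K n))) :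
    x ∈ augIdeal (freeAug K n) ^ (k + 1) := by
  refine Submodule.smul_induction_on hx (fun r hr y _ => ?_) fun y z => add_mem
  rw [Algebra.smul_def]
  exact augIdeal_pow_mul (algebraMap_mem_augIdeal_pow k hr) y

lemma sub_mem_augIdeal_pow {A : Type v} [Ring A] [Algebra K A] {ε : A →ₐ[K] K} {s : ℕ → A}
    (hs : ∀ k, s (k + 1) - s k ∈ augIdeal ε ^ (k + 1)) (k j : ℕ) :
    s (k + j) - s k ∈ augIdeal ε ^ (k + 1) := by
  induction j with
  | zero => simp
  | succ j ih =>
    rw [← sub_add_sub_cancel _ (s (k + j))]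
    exact add_mem (augIdeal_pow_anti (by omega) (hs (k + j))) ih

/-- Finite modules over a complete ring are complete. -/
lemma exists_limit_of_finite {R : Type u} [CommRing R] (I : Ideal R) [IsPrecomplete I R]
    {M : Type v} [AddCommGroup M] [Module R M] [Module.Finite R M] {s : ℕ → M}
    (hs : ∀ k, s (k + 1) - s k ∈ I ^ k • (⊤ : Submodule R M)) :
    ∃ x : M, ∀ k, s k - x ∈ I ^ k • (⊤ : Submodule R M) := by
  obtain ⟨m, φ, hφ⟩ := Module.Finite.exists_fin' R M
  -- The increments, rather than the terms, are lifted to the free module, where their sum converges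
  -- in each coordinate.
  have hlift : ∀ k, ∃ v : Fin m → R, (∀ i, v i ∈ I ^ k) ∧ φ v = s (k + 1) - s k := by
    intro k
    have h : s (k + 1) - s k ∈ (I ^ k • (⊤ : Submodule R (Fin m → R))).map φ := by
      rw [Submodule.map_smul'', Submodule.map_top, LinearMap.range_eq_top.2 hφ]
      exact hs k
    obtain ⟨v, hv, e⟩ := h
    refine ⟨v, fun i => ?_, e⟩
    have : I ^ k • (⊤ : Submodule R (Fin m → R)) ≤ 
        Submodule.comap (LinearMap.proj (R := R) (φ := fun _ : Fin m => R) i) (I ^ k) :=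
      Submodule.smul_le.2 fun r hr w _ => Ideal.mul_mem_right _ _ hr
    exact this hv
  choose v hv hφv using hlift
  have hlim : ∀ i, ∃ L : R, ∀ k, ∑ j ∈ Finset.range k, v j i - L ∈ I ^ k := by
    intro i
    have := IsPrecomplete.prec (I := I) (M := R) ‹_›
      (f := fun k => ∑ j ∈ Finset.range k, v j i) (by
        intro k l hkl
        rw [SModEq.sub_mem, smul_eq_mul, Ideal.mul_top, ← neg_sub, neg_mem_iff,
          ← Finset.sum_Ico_eq_sub _ hkl]
        exact sum_mem fun j hj => Ideal.pow_le_pow_right (Finset.mem_Ico.1 hj).1 (hv j i))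
    obtain ⟨L, hL⟩ := this
    refine ⟨L, fun k => ?_⟩
    have := hL k
    rwa [SModEq.sub_mem, smul_eq_mul, Ideal.mul_top] at this
  choose L hL using hlim
  refine ⟨s 0 + φ L, fun k => ?_⟩
  have e : s k - (s 0 + φ L) = φ (fun i => ∑ j ∈ Finset.range k, v j i - L i) := by
    have e1 : (fun i => ∑ j ∈ Finset.range k, v j i - L i) = ∑ j ∈ Finset.range k, v j - L := by
      ext i; simp
    rw [e1, map_sub, map_sum]
    simp only [hφv]
    rw [Finset.sum_range_sub]
    abel
  rw [e, LinearMap.pi_apply_eq_sum_univ φ]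
  exact sum_mem fun i _ => Submodule.smul_mem_smul (hL i k) trivial

lemma free_complete (s : ℕ → Free K n)
    (hs : ∀ k, s (k + 1) - s k ∈ augIdeal (freeAug K n) ^ (k + 1)) :
    ∃ x, ∀ k, s k - x ∈ augIdeal (freeAug K n) ^ (k + 1) := by
  have := finite_exteriorAlgebra (R := MvPowerSeries (Fin n) K) n
  -- The sequence is shifted by `n` to absorb the loss in the comparison of the two topologies.
  have hu : ∀ k, s (k + 1 + n) - s (k + n) ∈
      varIdeal K n ^ k • (⊤ : Submodule (MvPowerSeries (Fin n) K) (Free K n)) := by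
    intro k
    have h2 : s (k + n + 1) - s (k + n) ∈ augIdeal (freeAug K n) ^ (k + 1 + n) := by
      rw [show k + 1 + n = k + n + 1 by omega]
      exact hs (k + n)
    rw [show k + 1 + n = k + n + 1 by omega]
    have h3 : varIdeal K n ^ (k + 1) • (⊤ : Submodule (MvPowerSeries (Fin n) K) (Free K n))
      ≤ varIdeal K n ^ k • ⊤ := Submodule.smul_mono_left (Ideal.pow_le_pow_right (Nat.le_succ k))
    exact h3 (augIdeal_pow_le (k + 1) h2)
  obtain ⟨x, hx⟩ := exists_limit_of_finite (varIdeal K n) (s := fun k => s (k + n)) hu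
  refine ⟨x, fun k => ?_⟩
  have h1 := sub_mem_augIdeal_pow hs k (1 + n)
  have h2 := mem_augIdeal_pow k (hx (k + 1))
  rw [show k + (1 + n) = k + 1 + n by omega] at h1
  have e : s k - x = (s (k + 1 + n) - x) - (s (k + 1 + n) - s k) := by abel
  rw [e]
  exact sub_mem h2 h1

end FreeComplete

/-! ### Units in complete augmented algebras -/

section Units

variable {K : Type u} [Field K] {A : Type v} [Ring A] [Algebra K A] {ε : A →ₐ[K] K}

/-- In a complete augmented algebra, the elements outside of the augmentation ideal are units. -/
lemma isUnit_of_complete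
    (separated : ∀ x : A, (∀ n : ℕ, x ∈ augIdeal ε ^ (n + 1)) → x = 0)
    (complete : ∀ s : ℕ → A, (∀ n : ℕ, s (n + 1) - s n ∈ augIdeal ε ^ (n + 1)) →
      ∃ x : A, ∀ n : ℕ, s n - x ∈ augIdeal ε ^ (n + 1)) (a : A) (ha : ε a ≠ 0) : IsUnit a := by
  have key : ∀ z, ε z = 0 → IsUnit (1 - z) := by
    intro z hz
    have hzk : ∀ k, z ^ k ∈ augIdeal ε ^ k := fun k => Submodule.pow_mem_pow _ hz k
    -- The inverse of `1 - z` is the sum of the geometric series.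
    obtain ⟨y, hy⟩ := complete (fun k => ∑ j ∈ Finset.range (k + 1), z ^ j) fun k => by
      rw [Finset.sum_range_succ _ (k + 1), add_sub_cancel_left]
      exact hzk _
    have h1 : (1 - z) * y = 1 := by
      rw [← sub_eq_zero]
      refine separated _ fun k => ?_
      have e : (1 - z) * y - 1
          = -((1 - z) * (∑ j ∈ Finset.range (k + 1), z ^ j - y)) - z ^ (k + 1) := by
        rw [mul_sub, mul_neg_geom_sum]; abel
      rw [e]
      exact sub_mem (neg_mem (augIdeal_mul_pow (hy k) _)) (hzk _)
    have h2 : y * (1 - z) = 1 := by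
      rw [← sub_eq_zero]
      refine separated _ fun k => ?_
      have e : y * (1 - z) - 1
          = -((∑ j ∈ Finset.range (k + 1), z ^ j - y) * (1 - z)) - z ^ (k + 1) := by
        rw [sub_mul, geom_sum_mul_neg]; abel
      rw [e]
      exact sub_mem (neg_mem (augIdeal_pow_mul (hy k) _)) (hzk _)
    exact ⟨⟨1 - z, y, h1, h2⟩, rfl⟩
  have h := key (1 - (ε a)⁻¹ • a) (by simp [ha])
  rw [sub_sub_cancel] at h
  have h2 := h.smul (Units.mk0 _ ha)
  rwa [Units.smul_def, Units.val_mk0, smul_smul, mul_inv_cancel₀ ha, one_smul] at h2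

end Units

end LInfty
end

noncomputable section
namespace LInfty
open PowerSeries

/-! ### Quotients of the free algebra as formal bases -/

section FormalBase

variable {K : Type u} [Field K] {n : ℕ}

lemma proj_surjective (R : Set (Free K n)) : Function.Surjective (proj R) :=
  RingCon.mk'_surjective _

lemma proj_eq_zero {R : Set (Free K n)} {x : Free K n} :
    proj R x = 0 ↔ x ∈ TwoSidedIdeal.span R := by
  rw [← map_zero (proj R), TwoSidedIdeal.mem_iff]
  exact (RingCon.eq _)

/-- Algebra homomorphisms that kill the relations descend. -/
def baseLift {R : Set (Free K n)} {B : Type w} [Ring B] [Algebra K B] (g : Free K n →ₐ[K] B)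
    (hg : ∀ r ∈ R, g r = 0) : Base R →ₐ[K] B :=
  RingCon.liftₐ (TwoSidedIdeal.span R).ringCon g (by
    have h : TwoSidedIdeal.span R ≤ TwoSidedIdeal.ker g :=
      TwoSidedIdeal.span_le.2 fun r hr => (TwoSidedIdeal.mem_ker _).2 (hg r hr)
    intro x y hxy
    have := (TwoSidedIdeal.mem_ker _).1 (h ((TwoSidedIdeal.rel_iff _ x y).1 hxy))
    rw [map_sub, sub_eq_zero] at this
    exact this)

lemma baseLift_proj {R : Set (Free K n)} {B : Type w} [Ring B] [Algebra K B]
    (g : Free K n →ₐ[K] B) (hg : ∀ r ∈ R, g r = 0) (x : Free K n) :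
    baseLift g hg (proj R x) = g x := rfl

variable (K n) in
/-- The parity involution. -/
def parity : Free K n →ₐ[K] Free K n :=
  (CliffordAlgebra.involute (Q := (0 : QuadraticForm (MvPowerSeries (Fin n) K)
    (Fin n → MvPowerSeries (Fin n) K)))).restrictScalars K

lemma parity_even {x : Free K n} (hx : x ∈ freeGrading K n 0) : parity K n x = x :=
  CliffordAlgebra.involute_eq_of_mem_even hx

lemma parity_odd {x : Free K n} (hx : x ∈ freeGrading K n 1) : parity K n x = -x :=
  CliffordAlgebra.involute_eq_of_mem_odd hx

lemma freeGrading_mul {i j : ZMod 2} {a b : Free K n} (ha : a ∈ freeGrading K n i)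
    (hb : b ∈ freeGrading K n j) : a * b ∈ freeGrading K n (i + j) :=
  CliffordAlgebra.evenOdd_mul_le _ i j (Submodule.mul_mem_mul ha hb)

lemma freeTheta_mem (i : Fin n) : freeTheta K n i ∈ freeGrading K n 1 :=
  CliffordAlgebra.ι_mem_evenOdd_one _ _

lemma algebraMap_mem_freeGrading (r : MvPowerSeries (Fin n) K) :
    algebraMap _ (Free K n) r ∈ freeGrading K n 0 :=
  SetLike.algebraMap_mem_graded (CliffordAlgebra.evenOdd
    (0 : QuadraticForm (MvPowerSeries (Fin n) K) (Fin n → MvPowerSeries (Fin n) K))) r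

lemma freeT_mem (i : Fin n) : freeT K n i ∈ freeGrading K n 0 := algebraMap_mem_freeGrading _

lemma freeAug_odd {x : Free K n} (hx : x ∈ freeGrading K n 1) : freeAug K n x = 0 := by
  rw [freeAug_apply]
  have : ExteriorAlgebra.algebraMapInv x = 0 := by
    change x ∈ CliffordAlgebra.evenOdd _ 1 at hx
    induction x, hx using CliffordAlgebra.odd_induction with
    | ι v =>
      exact (ExteriorAlgebra.lift_ι_apply _ _ _ _)
    | add x y _ _ hx hy => rw [map_add, hx, hy, add_zero]
    | ι_mul_ι_mul a b x _ ih => rw [map_mul, ih, mul_zero]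
  rw [this, map_zero]

lemma exists_add_free (x : Free K n) :
    ∃ a ∈ freeGrading K n 0, ∃ b ∈ freeGrading K n 1, a + b = x := by
  have h := (CliffordAlgebra.evenOdd_isCompl (Q := (0 : QuadraticForm
    (MvPowerSeries (Fin n) K) (Fin n → MvPowerSeries (Fin n) K)))).codisjoint.eq_top
  have hx : x ∈ (⊤ : Submodule (MvPowerSeries (Fin n) K) (Free K n)) := trivial
  rw [← h] at hx
  obtain ⟨a, ha, b, hb, e⟩ := Submodule.mem_sup.1 hx
  exact ⟨a, ha, b, hb, e⟩

lemma freeAug_parity (x : Free K n) : freeAug K n (parity K n x) = freeAug K n x := by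
  obtain ⟨a, ha, b, hb, rfl⟩ := exists_add_free x
  rw [map_add, map_add, map_add, parity_even ha, parity_odd hb, map_neg, freeAug_odd hb, neg_zero]

lemma parity_mem_augIdeal_pow (k : ℕ) {x : Free K n} (hx : x ∈ augIdeal (freeAug K n) ^ k) :
    parity K n x ∈ augIdeal (freeAug K n) ^ k := by
  have h1 : (augIdeal (freeAug K n) ^ k).map (parity K n).toLinearMap
      ≤ augIdeal (freeAug K n) ^ k := by
    rw [Submodule.map_pow]
    refine pow_le_pow_left' ?_ k
    rintro _ ⟨y, hy, rfl⟩
    exact (freeAug_parity y).trans hy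
  exact h1 (Submodule.mem_map_of_mem hx)

/-- Homogeneous elements span parity-invariant ideals. -/
lemma parity_mem_of_homogeneous {R : Set (Free K n)} {i : ZMod 2} {r : Free K n} (hr : r ∈ R)
    (h : r ∈ freeGrading K n i) : parity K n r ∈ TwoSidedIdeal.span R := by
  have hr' := TwoSidedIdeal.subset_span hr
  rcases zmod_two_cases i with rfl | rfl
  · rwa [parity_even h]
  · rw [parity_odd h]; exact neg_mem hr'

variable {R : Set (Free K n)}

lemma augIdeal_base_pow (hR : ∀ r ∈ R, freeAug K n r = 0) (k : ℕ) :
    augIdeal (baseAug R hR) ^ k = (augIdeal (freeAug K n) ^ k).map (proj R).toLinearMap := by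
  rw [Submodule.map_pow]
  congr 1
  ext x
  obtain ⟨y, rfl⟩ := proj_surjective R x
  constructor
  · intro h
    exact Submodule.mem_map_of_mem (f := (proj R).toLinearMap) (p := augIdeal (freeAug K n))
      (show freeAug K n y = 0 from h)
  · rintro ⟨z, hz, e⟩
    rw [← e]
    exact hz

/-- This is Krull's intersection theorem for the quotient, a finite module over the power series
ring in the `t_i`. It shows that the algebraic ideal spanned by `R` is already closed. -/
lemma base_separated (hR : ∀ r ∈ R, freeAug K n r = 0) (x : Base R)
    (hx : ∀ k : ℕ, x ∈ augIdeal (baseAug R hR) ^ (k + 1)) : x = 0 := by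
  have := finite_exteriorAlgebra (R := MvPowerSeries (Fin n) K) n
  obtain ⟨y, rfl⟩ := proj_surjective R x
  let N : Submodule (MvPowerSeries (Fin n) K) (Free K n) :=
    { carrier := {z | proj R z = 0}
      add_mem' := fun {a b} ha hb => by
        rw [Set.mem_ofPred_eq] at *
        rw [map_add, ha, hb, add_zero]
      zero_mem' := map_zero _
      smul_mem' := fun c z hz => by
        rw [Set.mem_ofPred_eq] at *
        rw [Algebra.smul_def, map_mul, hz, mul_zero] }
  have hI : varIdeal K n ≠ ⊤ := by
    intro h
    have h1 : (1 : MvPowerSeries (Fin n) K) ∈ varIdeal K n := by rw [h]; trivial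
    have h2 := algebraMap_mem_augIdeal_pow (K := K) (n := n) 0 (r := 1) (by simpa using h1)
    rw [zero_add, pow_one, mem_augIdeal, map_one, map_one] at h2
    exact one_ne_zero h2
  have hH : IsHausdorff (varIdeal K n) (Free K n ⧸ N) := IsHausdorff.of_isLocalRing _ _ hI
  have h0 : N.mkQ y = 0 := by
    refine hH.haus _ fun k => ?_
    rw [SModEq.zero]
    have hk := augIdeal_pow_anti (ε := baseAug R hR) (show k + n ≤ k + n from le_rfl) (hx (k + n))
    rw [augIdeal_base_pow] at hk
    obtain ⟨z, hz, e⟩ := hk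
    have hz' : z ∈ augIdeal (freeAug K n) ^ (k + 1 + n) := by
      rwa [show k + 1 + n = k + n + 1 by omega]
    have hzI := augIdeal_pow_le (k + 1) hz'
    have hyz : N.mkQ y = N.mkQ z := by
      rw [← sub_eq_zero, ← map_sub, Submodule.mkQ_apply, Submodule.Quotient.mk_eq_zero]
      show proj R (y - z) = 0
      rw [map_sub, sub_eq_zero]
      exact e.symm
    rw [hyz]
    have h3 : varIdeal K n ^ (k + 1) • (⊤ : Submodule (MvPowerSeries (Fin n) K) (Free K n))
      ≤ varIdeal K n ^ k • ⊤ := Submodule.smul_mono_left (Ideal.pow_le_pow_right (Nat.le_succ k))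
    have h4 := Submodule.mem_map_of_mem (f := N.mkQ) (h3 hzI)
    rw [Submodule.map_smul''] at h4
    exact Submodule.smul_mono le_rfl le_top h4
  rw [Submodule.mkQ_apply, Submodule.Quotient.mk_eq_zero] at h0
  exact h0

/-- Powers of the augmentation ideal of the quotient are images of those upstairs, so the increments
lift and the limit can be taken in the free algebra. -/
lemma base_complete (hR : ∀ r ∈ R, freeAug K n r = 0) (s : ℕ → Base R)
    (hs : ∀ k : ℕ, s (k + 1) - s k ∈ augIdeal (baseAug R hR) ^ (k + 1)) :
    ∃ x : Base R, ∀ k : ℕ, s k - x ∈ augIdeal (baseAug R hR) ^ (k + 1) := by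
  obtain ⟨y, hy⟩ := proj_surjective R (s 0)
  simp only [augIdeal_base_pow] at hs ⊢
  choose d hd hd' using hs
  obtain ⟨x, hx⟩ := free_complete (fun k => y + ∑ j ∈ Finset.range k, d j) fun k => by
    rw [Finset.sum_range_succ, ← add_assoc, add_sub_cancel_left]
    exact hd k
  refine ⟨proj R x, fun k => ?_⟩
  have e : s k = proj R (y + ∑ j ∈ Finset.range k, d j) := by
    induction k with
    | zero => simp [hy]
    | succ k ih =>
      have := hd' k
      rw [Finset.sum_range_succ, ← add_assoc, map_add, ← ih]
      rw [← sub_eq_iff_eq_add']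
      exact this.symm
  rw [e, ← map_sub]
  exact Submodule.mem_map_of_mem (hx k)

lemma baseGrading_mul {i j : ZMod 2} {a b : Base R} (ha : a ∈ baseGrading R i)
    (hb : b ∈ baseGrading R j) : a * b ∈ baseGrading R (i + j) := by
  obtain ⟨x, hx, rfl⟩ := ha
  obtain ⟨y, hy, rfl⟩ := hb
  exact ⟨x * y, freeGrading_mul hx hy, map_mul (proj R) x y⟩

lemma theta_mem (i : Fin n) : theta R i ∈ baseGrading R 1 := ⟨_, freeTheta_mem i, rfl⟩
lemma tt_mem (i : Fin n) : tt R i ∈ baseGrading R 0 := ⟨_, freeT_mem i, rfl⟩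

variable [CharZero K]

/-- The parity involution descends to the quotient, and the two parts lie in its eigenspaces for `1`
and `-1`, which are disjoint since 2 is invertible. -/
lemma isCompl_baseGrading (hσ : ∀ r ∈ R, parity K n r ∈ TwoSidedIdeal.span R) :
    IsCompl (baseGrading R 0) (baseGrading R 1) := by
  constructor
  · rw [Submodule.disjoint_def]
    rintro _ ⟨x, hx, rfl⟩ ⟨y, hy, e⟩
    let σ : Base R →ₐ[K] Base R := baseLift ((proj R).comp (parity K n)) fun r hr =>
      proj_eq_zero.2 (hσ r hr)
    have h1 : σ (proj R x) = proj R x := by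
      refine (baseLift_proj _ _ x).trans ?_
      rw [AlgHom.comp_apply, parity_even hx]
    have h2 : σ (proj R y) = -proj R y := by
      refine (baseLift_proj _ _ y).trans ?_
      rw [AlgHom.comp_apply, parity_odd hy, map_neg]
    have e' : proj R y = proj R x := e
    rw [e', h1] at h2
    have h3 : (2 : K) • proj R x = 0 := by
      rw [two_smul]
      nth_rewrite 1 [h2]
      exact neg_add_cancel _
    exact (smul_eq_zero.1 h3).resolve_left two_ne_zero
  · rw [codisjoint_iff, eq_top_iff]
    rintro x -
    obtain ⟨y, rfl⟩ := proj_surjective R x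
    obtain ⟨a, ha, b, hb, rfl⟩ := exists_add_free y
    rw [map_add]
    exact Submodule.add_mem_sup ⟨a, ha, rfl⟩ ⟨b, hb, rfl⟩

/-- `K[[θ, t]] / (R)` is a formal base. -/
theorem isFormalBase_base (hR : ∀ r ∈ R, freeAug K n r = 0)
    (hσ : ∀ r ∈ R, parity K n r ∈ TwoSidedIdeal.span R) :
    IsFormalBase (baseGrading R) (baseAug R hR) where
  internal := by
    rw [DirectSum.isInternal_submodule_iff_isCompl _ (i := 0) (j := 1) (by decide)]
    · exact isCompl_baseGrading hσ
    · ext i; fin_cases i <;> simp <;> tauto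
  one_mem := ⟨1, by simpa using algebraMap_mem_freeGrading (K := K) (n := n) 1, map_one (proj R)⟩
  mul_mem i j a b ha hb := baseGrading_mul ha hb
  supercomm := by
    rintro i j _ _ ⟨x, hx, rfl⟩ ⟨y, hy, rfl⟩
    show proj R x * proj R y = sgn (i * j) • (proj R y * proj R x)
    rw [← map_mul, ← map_mul]
    rcases zmod_two_cases i with rfl | rfl
    · rw [even_commute hx]; simp [sgn]
    · rcases zmod_two_cases j with rfl | rfl
      · rw [even_commute hy]; simp [sgn]
      · rw [odd_anticommute hx hy]; simp [sgn]
  aug_odd := by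
    rintro _ ⟨x, hx, rfl⟩
    exact freeAug_odd hx
  isUnit := isUnit_of_complete (base_separated hR) (base_complete hR)
  separated := base_separated hR
  complete := base_complete hR

end FormalBase
end LInfty
end

noncomputable section
namespace LInfty
open PowerSeries

/-! ### Morphisms from `K[[θ, t]]` to a formal base -/

section Evaluation

variable {K : Type u} [Field K] {n : ℕ} {B : Type v} [Ring B] [Algebra K B]
  {ℬ : ZMod 2 → Submodule K B} {η : B →ₐ[K] K}

lemma mem_pow_of_mem_idealOfVars {e : MvPolynomial (Fin n) K →ₐ[K] B}
    (he : ∀ i, η (e (MvPolynomial.X i)) = 0) (k : ℕ) {p : MvPolynomial (Fin n) K}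
    (hp : p ∈ MvPolynomial.idealOfVars (Fin n) K ^ (k + 1)) : e p ∈ augIdeal η ^ (k + 1) := by
  have h1 : ∀ r ∈ MvPolynomial.idealOfVars (Fin n) K, e r ∈ augIdeal η := by
    intro r hr
    have : MvPolynomial.idealOfVars (Fin n) K ≤ RingHom.ker (η.comp e) := by
      rw [MvPolynomial.idealOfVars, Ideal.span_le]
      rintro _ ⟨i, rfl⟩
      exact he i
    exact this hr
  induction k generalizing p with
  | zero => rw [zero_add, pow_one] at hp ⊢; exact h1 p hp
  | succ k ih =>
    rw [pow_succ] at hp ⊢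
    refine Submodule.mul_induction_on hp (fun a ha b hb => ?_) fun a b ha hb => ?_
    · rw [map_mul]
      exact Submodule.mul_mem_mul (ih ha) (h1 b hb)
    · rw [map_add]; exact add_mem ha hb

/-- Limits of even elements are even. -/
lemma IsFormalBase.even_of_limit (h : IsFormalBase ℬ η) {s : ℕ → B} {x : B}
    (hs : ∀ k, s k ∈ ℬ 0) (hx : ∀ k, s k - x ∈ augIdeal η ^ (k + 1)) : x ∈ ℬ 0 := by
  obtain ⟨b, hb, c, hc, rfl⟩ := h.exists_add x
  have hc0 : c = 0 := by
    refine h.separated c fun k => ?_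
    -- Powers of the maximal ideal are graded, so the odd part of `s k - x`, which is `-c`, lies in
    -- the same power.
    obtain ⟨b', hb', c', hc', -, hm, e⟩ := h.exists_add_pow k (hx k)
    have e1 : s k - b - b' = c + c' := by
      have : s k - (b + c) = s k - b - c := by abel
      rw [this] at e
      rw [sub_eq_iff_eq_add] at e
      rw [e]; abel
    have e2 := h.eq_zero (a := c + c') (e1 ▸ sub_mem (sub_mem (hs k) hb) hb') (add_mem hc hc')
    rw [eq_neg_of_add_eq_zero_left e2]
    exact neg_mem hm
  rw [hc0, add_zero]
  exact hb

/-- Evaluation of power series in a formal base. -/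
lemma IsFormalBase.exists_eval (h : IsFormalBase ℬ η) {t : Fin n → B} (ht : ∀ i, t i ∈ ℬ 0)
    (htη : ∀ i, η (t i) = 0) :
    ∃ φ : MvPowerSeries (Fin n) K →ₐ[K] B, (∀ i, φ (MvPowerSeries.X i) = t i) ∧
      (∀ f, φ f ∈ ℬ 0) ∧ ∀ f, η (φ f) = MvPowerSeries.constantCoeff f := by
  -- Even elements are central, so polynomials can be evaluated in the commutative center. Power
  -- series are then evaluated as limits of their truncations.
  let e : MvPolynomial (Fin n) K →ₐ[K] B := (Subalgebra.center K B).val.comp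
    (MvPolynomial.aeval fun i => ⟨t i, Subalgebra.mem_center_iff.2 fun b =>
      (h.central (ht i) b).symm⟩)
  have heX : ∀ i, e (MvPolynomial.X i) = t i := fun i => by simp [e]
  have heη : ∀ i, η (e (MvPolynomial.X i)) = 0 := fun i => by rw [heX, htη]
  have hpow : ∀ k p, p ∈ MvPolynomial.idealOfVars (Fin n) K ^ (k + 1) → e p ∈ augIdeal η ^ (k + 1) :=
    fun k p => mem_pow_of_mem_idealOfVars heη k
  have he0 : ∀ p, e p ∈ ℬ 0 := by
    intro p
    induction p using MvPolynomial.induction_on with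
    | C a =>
      rw [← MvPolynomial.algebraMap_eq, AlgHom.commutes, Algebra.algebraMap_eq_smul_one]
      exact Submodule.smul_mem _ _ h.one_mem
    | add p q hp hq => rw [map_add]; exact add_mem hp hq
    | mul_X p i hp =>
      rw [map_mul, heX]
      exact h.mul_mem 0 0 _ _ hp (ht i)
  have hlim : ∀ f : MvPowerSeries (Fin n) K, ∃ x, ∀ k,
      e (MvPowerSeries.truncTotal (k + 1) f) - x ∈ augIdeal η ^ (k + 1) := by
    intro f
    refine h.complete (fun k => e (MvPowerSeries.truncTotal (k + 1) f)) fun k => ?_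
    rw [← map_sub]
    exact hpow k _ (MvPowerSeries.truncTotal_sub_truncTotal_mem_pow_idealOfVars (by omega) le_rfl f)
  choose φ hφ using hlim
  have huniq : ∀ f x, (∀ k, e (MvPowerSeries.truncTotal (k + 1) f) - x ∈ augIdeal η ^ (k + 1)) →
      φ f = x := by
    intro f x hx
    rw [← sub_eq_zero]
    refine h.separated _ fun k => ?_
    rw [← sub_sub_sub_cancel_left]
    exact sub_mem (hx k) (hφ f k)
  have hadd : ∀ f g, φ (f + g) = φ f + φ g := fun f g => huniq _ _ fun k => by
    rw [map_add, map_add, add_sub_add_comm]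
    exact add_mem (hφ f k) (hφ g k)
  have hsmul : ∀ (c : K) f, φ (c • f) = c • φ f := fun c f => huniq _ _ fun k => by
    rw [map_smul, map_smul, ← smul_sub]
    exact Submodule.smul_mem _ _ (hφ f k)
  have hone : φ 1 = 1 := huniq _ _ fun k => by
    rw [MvPowerSeries.truncTotal_one (Nat.succ_ne_zero k), map_one, sub_self]
    exact zero_mem _
  have hmul : ∀ f g, φ (f * g) = φ f * φ g := fun f g => huniq _ _ fun k => by
    have h1 := hpow k _ (MvPowerSeries.truncTotal_mul_sub_mul_truncTotal_mem_pow_idealOfVars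
      (n := k + 1) f g)
    rw [map_sub, map_mul e] at h1
    have h2 := augIdeal_pow_mul (hφ f k) (e (MvPowerSeries.truncTotal (k + 1) g))
    have h3 := augIdeal_mul_pow (hφ g k) (φ f)
    rw [sub_mul] at h2
    rw [mul_sub] at h3
    have := add_mem h1 (add_mem h2 h3)
    rwa [sub_add_sub_cancel, sub_add_sub_cancel] at this
  refine ⟨AlgHom.ofLinearMap ⟨⟨φ, hadd⟩, hsmul⟩ hone hmul, fun i => huniq _ _ fun k => ?_,
    fun f => h.even_of_limit (fun k => he0 _) (hφ f), fun f => ?_⟩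
  · cases k with
    | zero =>
      have h0 : MvPowerSeries.truncTotal 1 (MvPowerSeries.X i : MvPowerSeries (Fin n) K) = 0 := by
        ext d
        rw [MvPowerSeries.coeff_truncTotal_eq_ite, MvPolynomial.coeff_zero]
        split_ifs with hd
        · have hd0 : d = 0 := by
            rw [← Finsupp.degree_eq_zero_iff]; omega
          rw [hd0]; simp
        · rfl
      rw [zero_add, h0, map_zero, zero_sub, pow_one]
      exact neg_mem (htη i)
    | succ k =>
      have h0 : MvPowerSeries.truncTotal (k + 1 + 1) (MvPowerSeries.X i : MvPowerSeries (Fin n) K)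
          = MvPolynomial.X i := by
        ext d
        rw [MvPowerSeries.coeff_truncTotal_eq_ite, ← MvPolynomial.coe_X, MvPolynomial.coeff_coe]
        split_ifs with hd
        · rfl
        · rw [MvPolynomial.coeff_X, if_neg]
          rintro rfl
          simp at hd
      rw [h0, heX, sub_self]
      exact zero_mem _
  · have h0 := hφ f 0
    rw [zero_add, pow_one, mem_augIdeal, map_sub, sub_eq_zero] at h0
    show η (φ f) = _
    rw [← h0]
    have h1 : MvPowerSeries.truncTotal 1 f = MvPolynomial.C (MvPowerSeries.constantCoeff f) := by
      ext d
      rw [MvPowerSeries.coeff_truncTotal_eq_ite, MvPolynomial.coeff_C]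
      by_cases hd : d = 0
      · subst hd; simp
      · have : d.degree ≠ 0 := fun hd' => hd ((Finsupp.degree_eq_zero_iff d).1 hd')
        rw [if_neg (by omega), if_neg (Ne.symm hd)]
    rw [h1, ← MvPolynomial.algebraMap_eq, AlgHom.commutes, AlgHom.commutes]
    rfl

/-- The homomorphism from `K[[θ, t]]` with given values on the parameters. -/
lemma IsFormalBase.exists_free_hom [CharZero K] (h : IsFormalBase ℬ η) {θ t : Fin n → B}
    (hθ : ∀ i, θ i ∈ ℬ 1) (ht : ∀ i, t i ∈ ℬ 0) (htη : ∀ i, η (t i) = 0) :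
    ∃ g : Free K n →ₐ[K] B, (∀ i, g (freeTheta K n i) = θ i) ∧ (∀ i, g (freeT K n i) = t i) ∧
      (∀ i x, x ∈ freeGrading K n i → g x ∈ ℬ i) ∧ ∀ x, η (g x) = freeAug K n x := by
  obtain ⟨φ, hφX, hφ0, hφη⟩ := h.exists_eval ht htη
  -- Evaluation of the even variables makes `B` an algebra over the power series ring, because its
  -- values are central. The universal property of the exterior algebra then applies, since odd
  -- elements square to zero.
  let _ : Algebra (MvPowerSeries (Fin n) K) B :=
    (φ : MvPowerSeries (Fin n) K →+* B).toAlgebra' fun f b => h.central (hφ0 f) b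
  have hmap : ∀ f, algebraMap (MvPowerSeries (Fin n) K) B f = φ f := fun f => rfl
  have : IsScalarTower K (MvPowerSeries (Fin n) K) B :=
    IsScalarTower.of_algebraMap_eq fun c => by rw [hmap, AlgHom.commutes]
  let l : (Fin n → MvPowerSeries (Fin n) K) →ₗ[MvPowerSeries (Fin n) K] B :=
    Fintype.linearCombination _ θ
  have hl1 : ∀ v, l v ∈ ℬ 1 := by
    intro v
    rw [Fintype.linearCombination_apply]
    refine sum_mem fun i _ => ?_
    rw [Algebra.smul_def, hmap]
    exact h.mul_mem 0 1 _ _ (hφ0 _) (hθ i)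
  let G := ExteriorAlgebra.lift (MvPowerSeries (Fin n) K) ⟨l, fun v => h.mul_self (hl1 v)⟩
  have hGι : ∀ v, G (ExteriorAlgebra.ι _ v) = l v := fun v =>
    ExteriorAlgebra.lift_ι_apply _ _ _ _
  have hGmap : ∀ f, G (algebraMap _ _ f) = φ f := fun f => G.commutes f
  have hG : ∀ i x, x ∈ freeGrading K n i → G x ∈ ℬ i := by
    intro i x hx
    rcases zmod_two_cases i with rfl | rfl
    · change x ∈ CliffordAlgebra.evenOdd _ 0 at hx
      induction x, hx using CliffordAlgebra.even_induction with
      | algebraMap r => exact (hGmap r).symm ▸ hφ0 r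
      | add x y _ _ hx hy => rw [map_add]; exact add_mem hx hy
      | ι_mul_ι_mul a b x _ ih =>
        rw [map_mul, map_mul]
        exact h.mul_mem 0 0 _ _ (h.mul_mem 1 1 _ _ ((hGι a).symm ▸ hl1 a) ((hGι b).symm ▸ hl1 b)) ih
    · change x ∈ CliffordAlgebra.evenOdd _ 1 at hx
      induction x, hx using CliffordAlgebra.odd_induction with
      | ι v => exact (hGι v).symm ▸ hl1 v
      | add x y _ _ hx hy => rw [map_add]; exact add_mem hx hy
      | ι_mul_ι_mul a b x _ ih =>
        rw [map_mul, map_mul]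
        exact h.mul_mem 0 1 _ _ (h.mul_mem 1 1 _ _ ((hGι a).symm ▸ hl1 a) ((hGι b).symm ▸ hl1 b)) ih
  refine ⟨G.restrictScalars K, fun i => ?_, fun i => (hGmap _).trans (hφX i), hG, fun x => ?_⟩
  · refine (hGι _).trans ?_
    rw [Fintype.linearCombination_apply_single, one_smul]
  · show η (G x) = _
    induction x using ExteriorAlgebra.induction with
    | algebraMap r =>
      rw [hGmap, hφη, freeAug_apply, ExteriorAlgebra.algebraMap_leftInverse]
    | ι v =>
      rw [hGι, h.aug_odd _ (hl1 v)]
      exact (freeAug_odd (CliffordAlgebra.ι_mem_evenOdd_one _ v)).symm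
    | mul x y hx hy => rw [map_mul, map_mul, map_mul, hx, hy]
    | add x y hx hy => rw [map_add, map_add, map_add, hx, hy]

/-- The morphism of bases with given values on the parameters. -/
lemma IsFormalBase.exists_baseHom [CharZero K] (h : IsFormalBase ℬ η) {θ t : Fin n → B}
    (hθ : ∀ i, θ i ∈ ℬ 1) (ht : ∀ i, t i ∈ ℬ 0) (htη : ∀ i, η (t i) = 0)
    {R : Set (Free K n)} (hR : ∀ r ∈ R, freeAug K n r = 0)
    (hrel : ∀ g : Free K n →ₐ[K] B, (∀ i, g (freeTheta K n i) = θ i) →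
      (∀ i, g (freeT K n i) = t i) → (∀ x, η (g x) = freeAug K n x) → ∀ r ∈ R, g r = 0) :
    ∃ f : Base R →ₐ[K] B, IsBaseHom (baseGrading R) (baseAug R hR) ℬ η f ∧
      (∀ i, f (theta R i) = θ i) ∧ ∀ i, f (tt R i) = t i := by
  obtain ⟨g, h1, h2, h3, h4⟩ := h.exists_free_hom hθ ht htη
  refine ⟨baseLift g (hrel g h1 h2 h4), ⟨?_, ?_⟩, h1, h2⟩
  · rintro i _ ⟨x, hx, rfl⟩
    exact h3 i x hx
  · refine AlgHom.ext fun x => ?_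
    obtain ⟨y, rfl⟩ := proj_surjective R x
    exact h4 y

/-- Morphisms to infinitesimal bases are determined by the values on the parameters. -/
lemma IsInfinitesimalBase.baseHom_ext (h : IsInfinitesimalBase ℬ η) {R : Set (Free K n)}
    (hR : ∀ r ∈ R, freeAug K n r = 0) {f₁ f₂ : Base R →ₐ[K] B}
    (h₁ : IsBaseHom (baseGrading R) (baseAug R hR) ℬ η f₁)
    (h₂ : IsBaseHom (baseGrading R) (baseAug R hR) ℬ η f₂)
    (hθ : ∀ i, f₁ (theta R i) = f₂ (theta R i)) (ht : ∀ i, f₁ (tt R i) = f₂ (tt R i)) :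
    f₁ = f₂ := by
  have hη : ∀ f : Base R →ₐ[K] B, IsBaseHom (baseGrading R) (baseAug R hR) ℬ η f → ∀ x,
      η (f (proj R x)) = freeAug K n x := by
    intro f hf x
    have := DFunLike.congr_fun hf.aug_comp (proj R x)
    exact this
  -- multiplication by an element of the augmentation ideal only depends on the constant term
  have hmul : ∀ f : Base R →ₐ[K] B, IsBaseHom (baseGrading R) (baseAug R hR) ℬ η f → ∀ x y,
      freeAug K n y = 0 → f (proj R (x * y)) = freeAug K n x • f (proj R y) := by
    intro f hf x y hy
    rw [map_mul, map_mul, ← sub_eq_zero, Algebra.smul_def, ← sub_mul]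
    refine h.sq_zero _ _ ?_ (by rw [hη f hf, hy])
    rw [map_sub, hη f hf, AlgHom.commutes]
    exact sub_self _
  have hvar : ∀ r ∈ varIdeal K n, f₁ (proj R (algebraMap _ _ r)) = f₂ (proj R (algebraMap _ _ r)) := by
    intro r hr
    induction hr using Submodule.span_induction with
    | mem x hx => obtain ⟨i, rfl⟩ := hx; exact ht i
    | zero => simp
    | add x y _ _ hx hy => simp only [map_add, hx, hy]
    | smul a x hx ih =>
      have hx0 : freeAug K n (algebraMap _ _ x) = 0 := by
        have := algebraMap_mem_augIdeal_pow (K := K) (n := n) 0 (r := x) (by simpa using hx)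
        rwa [zero_add, pow_one] at this
      rw [smul_eq_mul, map_mul, hmul f₁ h₁ _ _ hx0, hmul f₂ h₂ _ _ hx0, ih]
  have hfree : ∀ x : Free K n, f₁ (proj R x) = f₂ (proj R x) := by
    intro x
    induction x using ExteriorAlgebra.induction with
    | algebraMap r =>
      have e : r = algebraMap K _ (MvPowerSeries.constantCoeff r)
          + (r - algebraMap K _ (MvPowerSeries.constantCoeff r)) := by abel
      rw [e]
      simp only [map_add]
      congr 1
      · rw [← IsScalarTower.algebraMap_apply, AlgHom.commutes, AlgHom.commutes, AlgHom.commutes]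
      · refine hvar _ (mem_span_range_X ?_)
        rw [map_sub, MvPowerSeries.algebraMap_apply]
        simp
    | ι v =>
      have e : ExteriorAlgebra.ι _ v = ∑ i, algebraMap _ (Free K n) (v i) * freeTheta K n i := by
        simp only [← Algebra.smul_def, freeTheta, ← map_smul, ← map_sum]
        congr 1
        exact pi_eq_sum_univ' v
      rw [e]
      simp only [map_sum]
      refine Finset.sum_congr rfl fun i _ => ?_
      rw [hmul f₁ h₁ _ _ (freeAug_theta K n i), hmul f₂ h₂ _ _ (freeAug_theta K n i)]
      exact congrArg _ (hθ i)
    | mul x y hx hy => rw [map_mul, map_mul, map_mul, hx, hy]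
    | add x y hx hy => rw [map_add, map_add, map_add, hx, hy]
  refine AlgHom.ext fun x => ?_
  obtain ⟨y, rfl⟩ := proj_surjective R x
  exact hfree y

end Evaluation
end LInfty
end

noncomputable section
namespace LInfty
open PowerSeries

/-! ### From normal forms to miniversality -/

section Miniversal

variable {K : Type u} [Field K]

section Maps

variable {A : Type v} [Ring A] {B : Type w} [Ring B] {n : ℕ}

lemma map_monomial' (f : A →+* B) (k : ℕ) (a : A) :
    PowerSeries.map f (PowerSeries.monomial k a) = PowerSeries.monomial k (f a) := by
  ext m
  rw [PowerSeries.coeff_map, PowerSeries.coeff_monomial, PowerSeries.coeff_monomial]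
  split_ifs
  · rfl
  · exact map_zero f

lemma map_alphaSer (f : A →+* B) (θ : Fin n → A) :
    PowerSeries.map f (alphaSer θ) = alphaSer fun i => f (θ i) := by
  simp only [alphaSer, map_sum, map_monomial']

lemma map_betaSer (f : A →+* B) (t : Fin n → A) :
    PowerSeries.map f (betaSer t) = betaSer fun i => f (t i) := by
  simp only [betaSer, map_add, map_sum, map_monomial', map_pow, PowerSeries.map_X]

lemma coeff_alphaSer (θ : Fin n → A) (i : Fin n) :
    PowerSeries.coeff (i + 1) (alphaSer θ) = θ i := by
  rw [alphaSer, map_sum, Finset.sum_eq_single i]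
  · rw [PowerSeries.coeff_monomial, if_pos rfl]
  · intro j _ hj
    rw [PowerSeries.coeff_monomial, if_neg]
    intro h
    exact hj (Fin.ext (by omega))
  · simp

lemma coeff_betaSer (t : Fin n → A) (i : Fin n) : PowerSeries.coeff i (betaSer t) = t i := by
  rw [betaSer, map_add, PowerSeries.coeff_X_pow, if_neg (by omega), zero_add, map_sum,
    Finset.sum_eq_single i]
  · rw [PowerSeries.coeff_monomial, if_pos rfl]
  · intro j _ hj
    rw [PowerSeries.coeff_monomial, if_neg]
    intro h
    exact hj (Fin.ext (by omega))
  · simp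

lemma push_push {C : Type*} [Ring C] (f : A →+* B) (g : B →+* C) (δ : End A) :
    push g (push f δ) = push (g.comp f) δ := by
  refine opLinear_ext fun w => Finsupp.ext fun z => ?_
  rw [push_single, push_single, push_single]
  rfl

end Maps

variable [CharZero K] {n : ℕ} {R : Set (Free K n)}

/-- The normal form of a deformation is induced from a universal example if the relations and the
remaining components of the normal form are. -/
lemma IsFormalBase.exists_baseHom_equivalent {B : Type v} [Ring B] [Algebra K B]
    {ℬ : ZMod 2 → Submodule K B} {η : B →ₐ[K] K} (h : IsFormalBase ℬ η)
    (hR : ∀ r ∈ R, freeAug K n r = 0) {c : Cochain (Base R)}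
    (hrel : ∀ (θ t : Fin n → B) (γ δ : B⟦X⟧), (∀ i, θ i ∈ ℬ 1) → (∀ i, t i ∈ ℬ 0) →
      (∀ i, η (t i) = 0) → PowerSeries.coeff 0 γ = 0 →
      dX (alphaSer θ) * alphaSer θ + betaSer t * γ = 0 →
      dX (alphaSer θ) * betaSer t - dX (betaSer t) * alphaSer θ + betaSer t * δ = 0 →
      (∀ g : Free K n →ₐ[K] B, (∀ i, g (freeTheta K n i) = θ i) →
        (∀ i, g (freeT K n i) = t i) → (∀ x, η (g x) = freeAug K n x) → ∀ r ∈ R, g r = 0) ∧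
      ∀ f : Base R →ₐ[K] B, (∀ i, f (theta R i) = θ i) → (∀ i, f (tt R i) = t i) →
        (fun w g => f (c w g)) = ser (alphaSer θ) (betaSer t) γ δ)
    {δ' : End B} (hδ' : IsDeformation ℬ η (dPsi K (n + 1)) δ') :
    ∃ f : Base R →ₐ[K] B, IsBaseHom (baseGrading R) (baseAug R hR) ℬ η f ∧
      Equivalent ℬ η (push (f : Base R →+* B) (coder c)) δ' := by
  obtain ⟨θ, t, hθ, ht, htη, γ, δ, hγ, h1, h2, he⟩ := h.exists_normalForm hδ'
  obtain ⟨hg, hf⟩ := hrel θ t γ δ hθ ht htη hγ h1 h2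
  obtain ⟨f, hfb, hfθ, hft⟩ := h.exists_baseHom hθ ht htη hR hg
  refine ⟨f, hfb, ?_⟩
  rw [push_coder]
  have := hf f hfθ hft
  rw [← this] at he
  exact he

/-- Morphisms to an infinitesimal base are determined by the induced deformation. -/
lemma IsInfinitesimalBase.baseHom_unique {B : Type v} [Ring B] [Algebra K B]
    {ℬ : ZMod 2 → Submodule K B} {η : B →ₐ[K] K} (h : IsInfinitesimalBase ℬ η)
    (hR : ∀ r ∈ R, freeAug K n r = 0) {γ δ : (Base R)⟦X⟧} (hγ : PowerSeries.coeff 0 γ = 0)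
    (hd : push ((baseAug R hR : Base R →ₐ[K] K) : Base R →+* K)
      (coder (ser (alphaSer (theta R)) (betaSer (tt R)) γ δ)) = dPsi K (n + 1))
    {δ' : End B} (hδ' : IsDeformation ℬ η (dPsi K (n + 1)) δ') {f₁ f₂ : Base R →ₐ[K] B}
    (h₁ : IsBaseHom (baseGrading R) (baseAug R hR) ℬ η f₁)
    (h₂ : IsBaseHom (baseGrading R) (baseAug R hR) ℬ η f₂)
    (e₁ : Equivalent ℬ η (push (f₁ : Base R →+* B)
      (coder (ser (alphaSer (theta R)) (betaSer (tt R)) γ δ))) δ')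
    (e₂ : Equivalent ℬ η (push (f₂ : Base R →+* B)
      (coder (ser (alphaSer (theta R)) (betaSer (tt R)) γ δ))) δ') : f₁ = f₂ := by
  -- Up to factorials, the images of the parameters are entries of `δ'` itself in degrees at most
  -- `n`, so they do not depend on `f`.
  have key : ∀ f : Base R →ₐ[K] B, IsBaseHom (baseGrading R) (baseAug R hR) ℬ η f →
      Equivalent ℬ η (push (f : Base R →+* B)
        (coder (ser (alphaSer (theta R)) (betaSer (tt R)) γ δ))) δ' → ∀ i : Fin n,
      (i + 1 : ℕ).factorial • f (theta R i) = δ' (Finsupp.single (.E i) 1) (.E 0) ∧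
      (i : ℕ).factorial • f (tt R i) = δ' (Finsupp.single (.F i) 1) (.E 0) := by
    intro f hf he i
    have hp : push (η : B →+* K) (push (f : Base R →+* B)
        (coder (ser (alphaSer (theta R)) (betaSer (tt R)) γ δ))) = dPsi K (n + 1) := by
      rw [push_push, ← hd]
      congr 1
      exact congrArg (fun g : Base R →ₐ[K] K => (g : Base R →+* K)) hf.aug_comp
    have h1 := h.apply_eq_of_equivalent hp hδ'.proj he (w := .E i) i.2 (.E 0)
    have h2 := h.apply_eq_of_equivalent hp hδ'.proj he (w := .F i) i.2 (.E 0)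
    rw [push_coder, ser_map] at h1 h2
    have hs := coder_ser_apply K (PowerSeries.map (f : Base R →+* B) (alphaSer (theta R)))
      (PowerSeries.map (f : Base R →+* B) (betaSer (tt R)))
      (PowerSeries.map (f : Base R →+* B) γ) (PowerSeries.map (f : Base R →+* B) δ) i
      (by rw [PowerSeries.coeff_map, coeff_zero_alphaSer, map_zero])
      (by rw [PowerSeries.coeff_map, hγ, map_zero])
    rw [hs.1, PowerSeries.coeff_map, coeff_alphaSer] at h1
    rw [hs.2, PowerSeries.coeff_map, coeff_betaSer] at h2
    exact ⟨h1, h2⟩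
  refine h.baseHom_ext hR h₁ h₂ (fun i => ?_) fun i => ?_
  · exact fac_smul_cancel K (((key f₁ h₁ e₁ i).1).trans ((key f₂ h₂ e₂ i).1).symm)
  · exact fac_smul_cancel K (((key f₁ h₁ e₁ i).2).trans ((key f₂ h₂ e₂ i).2).symm)

/-! ### The rigid case -/

/-- For `n = 0` the normal form has no parameters: `α = 0` and `β = 1`, and the two equations become
`γ = 0` and `δ = 0`. Uniqueness holds as there is only one algebra morphism out of `K`. -/
lemma isMiniversal_dPsi_one :
    IsMiniversal.{u, u, v} (groundGrading K) (AlgHom.id K K) (dPsi K 1) (dPsi K 1) where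
  formal := isFormalBase_ground
  deformation :=
    { toIsCodifferential := isCodifferential_dPsi 0
      base := isCodifferential_dPsi 0
      proj := opLinear_ext fun w => Finsupp.ext fun z => by rw [push_single]; rfl }
  versal B _ _ ℬ η δ' hB hδ' := by
    refine ⟨Algebra.ofId K B, ⟨?_, ?_⟩, ?_⟩
    · intro i a ha
      rcases zmod_two_cases i with rfl | rfl
      · rw [Algebra.ofId_apply, Algebra.algebraMap_eq_smul_one]
        exact Submodule.smul_mem _ _ hB.one_mem
      · rw [groundGrading_one, Submodule.mem_bot] at ha
        rw [ha, map_zero]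
        exact zero_mem _
    · ext
    · obtain ⟨θ, t, -, -, -, γ, δ, -, h1, h2, he⟩ := hB.exists_normalForm (n := 0) hδ'
      have hα : alphaSer θ = 0 := by simp [alphaSer]
      have hβ : betaSer t = 1 := by simp [betaSer]
      rw [hα, hβ, mul_zero, zero_add, one_mul] at h1
      rw [hα, hβ, mul_zero, map_zero, zero_mul, sub_zero, zero_add, one_mul] at h2
      rw [hα, hβ, h1, h2] at he
      rw [dPsi, psiE_eq_ser, push_coder, ser_map]
      simpa using he
  unique B _ _ ℬ η δ' _ _ f₁ f₂ _ _ _ _ := by ext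

end Miniversal
end LInfty
end

noncomputable section
namespace LInfty
open PowerSeries

/-! ### Functoriality of the explicit series, the infinitesimal case and `L = 2` -/

section Cases

variable {K : Type u} [Field K]

lemma map_deltaSer {A : Type v} [Ring A] [Algebra K A] {B : Type w} [Ring B] [Algebra K B] {n : ℕ}
    (f : A →ₐ[K] B) (θ : Fin n → A) :
    PowerSeries.map (f : A →+* B) (deltaSer K θ) = deltaSer K fun i => f (θ i) := by
  simp only [deltaSer, map_sum, map_monomial']
  refine Finset.sum_congr rfl fun i _ => ?_
  exact congrArg _ (map_smul f _ _)

lemma map_delta3 {A : Type v} [Ring A] [Algebra K A] {B : Type w} [Ring B] [Algebra K B]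
    (f : A →ₐ[K] B) (θ t : Fin 2 → A) :
    PowerSeries.map (f : A →+* B) (delta3 K θ t)
      = delta3 K (fun i => f (θ i)) fun i => f (t i) := by
  simp only [delta3, map_add, map_monomial', map_deltaSer, map_neg, map_mul, RingHom.coe_coe]

lemma map_delta4 {A : Type v} [Ring A] [Algebra K A] {B : Type w} [Ring B] [Algebra K B]
    (f : A →ₐ[K] B) (θ t : Fin 3 → A) :
    PowerSeries.map (f : A →+* B) (delta4 K θ t)
      = delta4 K (fun i => f (θ i)) fun i => f (t i) := by
  simp only [delta4, map_add, map_monomial', map_deltaSer, map_neg, map_mul, map_pow, map_ofNat,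
    RingHom.coe_coe]

lemma map_ser_params {A : Type v} [Ring A] [Algebra K A] {B : Type w} [Ring B] [Algebra K B] {n : ℕ}
    (f : A →ₐ[K] B) {θ t : Fin n → A} {θ' t' : Fin n → B} (hθ : ∀ i, f (θ i) = θ' i)
    (ht : ∀ i, f (t i) = t' i) (γ δ : A⟦X⟧) :
    (fun w g => f (ser (alphaSer θ) (betaSer t) γ δ w g))
      = ser (alphaSer θ') (betaSer t') (γ.map (f : A →+* B)) (δ.map (f : A →+* B)) := by
  refine (ser_map (f : A →+* B) _ _ _ _).trans ?_
  rw [map_alphaSer, map_betaSer]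
  congr
  · exact funext hθ
  · exact funext ht

lemma serMem_deltaSer {A : Type v} [Ring A] [Algebra K A] {M : Submodule K A} {n : ℕ}
    {θ : Fin n → A} (hθ : ∀ i, θ i ∈ M) : deltaSer K θ ∈ SerMem M :=
  sum_mem fun i _ => serMem_monomial (M.smul_mem _ (hθ i)) _

lemma coeff_quad_of_two_le {A : Type v} [Ring A] {a b c : A} {k : ℕ} (h : c = 0) :
    PowerSeries.coeff (2 + k) (quad a b c) = 0 := by
  rw [quad, h, map_add, map_add, PowerSeries.coeff_monomial, PowerSeries.coeff_monomial,
    if_neg (by omega), if_neg (by omega), map_zero, map_zero, add_zero, add_zero]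

lemma coeff_quad_of_three_le {A : Type v} [Ring A] {a b c : A} {k : ℕ} :
    PowerSeries.coeff (3 + k) (quad a b c) = 0 := by
  rw [quad, map_add, map_add, PowerSeries.coeff_monomial, PowerSeries.coeff_monomial,
    PowerSeries.coeff_monomial, if_neg (by omega), if_neg (by omega), if_neg (by omega), add_zero,
    add_zero]

lemma quad_eq_zero_iff {A : Type v} [Ring A] {a b c : A} :
    quad a b c = 0 ↔ a = 0 ∧ b = 0 ∧ c = 0 := by
  constructor
  · intro h
    have h0 := congrArg (PowerSeries.coeff 0) h
    have h1 := congrArg (PowerSeries.coeff 1) h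
    have h2 := congrArg (PowerSeries.coeff 2) h
    simp only [quad, map_add, PowerSeries.coeff_monomial, map_zero] at h0 h1 h2
    norm_num at h0 h1 h2
    exact ⟨h0, h1, h2⟩
  · rintro ⟨rfl, rfl, rfl⟩
    simp [quad]

/-! ### The universal infinitesimal deformations -/

section Infinitesimal

variable {A : Type v} [Ring A] [Algebra K A] {𝒜 : ZMod 2 → Submodule K A} {ε : A →ₐ[K] K}

lemma IsInfinitesimalBase.serMem_mul_eq_zero (h : IsInfinitesimalBase 𝒜 ε) {p q : A⟦X⟧}
    (hp : p ∈ SerMem (augIdeal ε)) (hq : q ∈ SerMem (augIdeal ε)) : p * q = 0 := by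
  ext k
  rw [PowerSeries.coeff_mul, map_zero]
  exact Finset.sum_eq_zero fun x _ => h.sq_zero _ _ (hp _) (hq _)

/-- Over an infinitesimal base, the first order expression is a codifferential. -/
lemma IsInfinitesimalBase.square (h : IsInfinitesimalBase 𝒜 ε) {n : ℕ} {θ t : Fin n → A}
    (hθ : ∀ i, θ i ∈ 𝒜 1) (htε : ∀ i, ε (t i) = 0) :
    dX (alphaSer θ) * alphaSer θ = 0 ∧
    dX (alphaSer θ) * betaSer t - dX (betaSer t) * alphaSer θ
      + betaSer t * deltaSer K θ = 0 := by
  have hθm : ∀ i, θ i ∈ augIdeal ε := fun i => h.aug_odd _ (hθ i)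
  have hα : alphaSer θ ∈ SerMem (augIdeal ε) := sum_mem fun i _ => serMem_monomial (hθm i) _
  have hδ : deltaSer K θ ∈ SerMem (augIdeal ε) := serMem_deltaSer hθm
  refine ⟨h.serMem_mul_eq_zero (SerMem.dX hα) hα, ?_⟩
  have hb : ∑ i : Fin n, PowerSeries.monomial i (t i) ∈ SerMem (augIdeal ε) :=
    sum_mem fun i _ => serMem_monomial (M := augIdeal ε) (htε i) _
  rw [betaSer, map_add, add_mul, add_mul, mul_add, h.serMem_mul_eq_zero (SerMem.dX hα) hb,
    h.serMem_mul_eq_zero (SerMem.dX hb) hα, h.serMem_mul_eq_zero hb hδ, add_zero, add_zero, add_zero,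
    PowerSeries.X_pow_eq, dX_monomial, alphaSer, deltaSer, map_sum, Finset.sum_mul, Finset.mul_sum,
    Finset.mul_sum, ← Finset.sum_sub_distrib, ← Finset.sum_add_distrib]
  refine Finset.sum_eq_zero fun i _ => ?_
  have hi := i.2
  rw [dX_monomial, PowerSeries.monomial_mul_monomial, PowerSeries.monomial_mul_monomial,
    PowerSeries.monomial_mul_monomial, Nat.add_sub_cancel,
    show n - 1 + (i + 1) = i + n by omega, add_comm n (i : ℕ), ← map_sub, ← map_add, mul_one,
    one_mul, ← Nat.cast_smul_eq_nsmul K, ← Nat.cast_smul_eq_nsmul K, smul_mul_assoc, one_mul,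
    ← sub_smul, ← add_smul]
  -- The three terms come from `α' x^n`, `(x^n)' α` and `x^n δ`. Their cancellation is what dictates
  -- the coefficient `k - L + 1` in `h^k`.
  have : ((i + 1 : ℕ) : K) - (n : K) + ((n : K) - (i : K) - 1) = 0 := by push_cast; ring
  rw [this, zero_smul, map_zero]

lemma parity_mPow (n k : ℕ) : ∀ r ∈ mPow K n k, parity K n r ∈ TwoSidedIdeal.span (mPow K n k) :=
  fun _ hr => TwoSidedIdeal.subset_span (parity_mem_augIdeal_pow k hr)

lemma aug_tt {n : ℕ} {R : Set (Free K n)} (hR : ∀ r ∈ R, freeAug K n r = 0) (i : Fin n) :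
    baseAug R hR (tt R i) = 0 := freeAug_t K n i

variable [CharZero K]

lemma isInfinitesimalBase_mPow (n : ℕ) :
    IsInfinitesimalBase (baseGrading (mPow K n 2)) (baseAug (mPow K n 2) (aug_mPow K n 1)) where
  toIsLocalBase := (isFormalBase_base (aug_mPow K n 1) (parity_mPow n 2)).toIsLocalBase
  sq_zero := by
    intro x y hx hy
    obtain ⟨a, rfl⟩ := proj_surjective _ x
    obtain ⟨b, rfl⟩ := proj_surjective _ y
    rw [← map_mul]
    refine proj_eq_zero.2 (TwoSidedIdeal.subset_span ?_)
    show a * b ∈ augIdeal (freeAug K n) ^ 2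
    rw [pow_two]
    exact Submodule.mul_mem_mul hx hy

/-- Over an infinitesimal base the first order normal form has zero square for all parameters, and
cancelling `β` forces `γ = 0` and `δ = deltaSer`. So the only relations are those of `𝔪 ^ 2`, and
the argument works for every `n`. -/
theorem isUniversalInfinitesimal_firstOrder (n : ℕ) :
    IsUniversalInfinitesimal.{u, u, v} (baseGrading (mPow K n 2))
      (baseAug (mPow K n 2) (aug_mPow K n 1)) (dPsi K (n + 1))
      (coder (firstOrder K n (theta (mPow K n 2)) (tt (mPow K n 2)))) := by
  have hA := isInfinitesimalBase_mPow (K := K) n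
  have hsq := hA.square (θ := theta (mPow K n 2)) (t := tt (mPow K n 2)) theta_mem
    (aug_tt (aug_mPow K n 1))
  rw [firstOrder_eq_ser]
  have hdef : IsDeformation (baseGrading (mPow K n 2)) (baseAug (mPow K n 2) (aug_mPow K n 1))
      (dPsi K (n + 1)) (coder (ser (alphaSer (theta (mPow K n 2))) (betaSer (tt (mPow K n 2))) 0
        (deltaSer K (theta (mPow K n 2))))) :=
    hA.isFormalBase.isDeformation (serMem_alphaSer theta_mem) (hA.serMem_betaSer tt_mem)
      (zero_mem _) (serMem_deltaSer theta_mem) (isWeierstrass_betaSer (aug_tt _))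
      (coeff_zero_alphaSer _) (map_zero _) (by rw [mul_zero, add_zero]; exact hsq.1) hsq.2
  refine ⟨hA, hdef, fun B _ _ ℬ η δ' hB hδ' => ?_⟩
  obtain ⟨f, hf, he⟩ := hB.isFormalBase.exists_baseHom_equivalent (aug_mPow K n 1)
    (c := ser (alphaSer (theta (mPow K n 2))) (betaSer (tt (mPow K n 2))) 0
        (deltaSer K (theta (mPow K n 2))))
    (by
      intro θ t γ δ hθ ht htη _ h1 h2
      refine ⟨fun g _ _ hg r hr => ?_, fun f hfθ hft => ?_⟩
      · change r ∈ augIdeal (freeAug K n) ^ 2 at hr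
        rw [pow_two] at hr
        refine Submodule.mul_induction_on hr (fun a ha b hb => ?_) fun a b ha hb => ?_
        · rw [map_mul]
          exact hB.sq_zero _ _ ((hg a).trans ha) ((hg b).trans hb)
        · rw [map_add, ha, hb, add_zero]
      · obtain ⟨q1, q2⟩ := hB.square hθ htη
        have hW := isWeierstrass_betaSer htη
        rw [q1, zero_add] at h1
        have hγ := hB.isFormalBase.cancel hW h1
        have hδ := (hB.isFormalBase.eq_of_remainder hW h2 q2 fun k => map_zero _).1
        rw [map_ser_params f hfθ hft, map_deltaSer, map_zero, hγ, ← hδ]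
        congr 2
        exact funext hfθ)
    hδ'
  exact ⟨f, ⟨hf, he⟩, fun f' hf' => hB.baseHom_unique (aug_mPow K n 1) (map_zero _) hdef.proj hδ'
    hf'.1 hf hf'.2 he⟩

end Infinitesimal

lemma image_rel2 {A : Type v} [Ring A] {B : Type w} [Ring B] (g : A →+* B) (θ t : Fin 1 → A) :
    g '' rel2 θ t = rel2 (fun i => g (θ i)) fun i => g (t i) := by
  simp only [rel2, Set.image_singleton, map_mul]

lemma image_rel3 {A : Type v} [Ring A] {B : Type w} [Ring B] (g : A →+* B) (θ t : Fin 2 → A) :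
    g '' rel3 θ t = rel3 (fun i => g (θ i)) fun i => g (t i) := by
  simp only [rel3, Set.image_insert_eq, Set.image_singleton, map_mul, map_sub, map_add, map_pow,
    map_ofNat]

lemma image_rel4 {A : Type v} [Ring A] {B : Type w} [Ring B] (g : A →+* B) (θ t : Fin 3 → A) :
    g '' rel4 θ t = rel4 (fun i => g (θ i)) fun i => g (t i) := by
  simp only [rel4, Set.image_insert_eq, Set.image_singleton, map_mul, map_sub, map_add, map_pow,
    map_ofNat, map_neg]

lemma eq_zero_of_mem_image {n : ℕ} {R : Set (Free K n)} {x : Base R}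
    (hx : x ∈ (proj R : Free K n →+* Base R) '' R) : x = 0 := by
  obtain ⟨r, hr, rfl⟩ := hx
  exact proj_eq_zero.2 (TwoSidedIdeal.subset_span hr)

lemma eq_zero_rel2 {x : Base (R2 K)} (hx : x ∈ rel2 (theta (R2 K)) (tt (R2 K))) : x = 0 :=
  eq_zero_of_mem_image ((Set.ext_iff.1 (image_rel2 (proj (R2 K) : Free K 1 →+* Base (R2 K))
    (freeTheta K 1) (freeT K 1)) x).2 hx)

lemma eq_zero_rel3 {x : Base (R3 K)} (hx : x ∈ rel3 (theta (R3 K)) (tt (R3 K))) : x = 0 :=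
  eq_zero_of_mem_image ((Set.ext_iff.1 (image_rel3 (proj (R3 K) : Free K 2 →+* Base (R3 K))
    (freeTheta K 2) (freeT K 2)) x).2 hx)

lemma eq_zero_rel4 {x : Base (R4 K)} (hx : x ∈ rel4 (theta (R4 K)) (tt (R4 K))) : x = 0 :=
  eq_zero_of_mem_image ((Set.ext_iff.1 (image_rel4 (proj (R4 K) : Free K 3 →+* Base (R4 K))
    (freeTheta K 3) (freeT K 3)) x).2 hx)

section Homogeneous

variable {A : Type v} [Ring A] [Algebra K A] {G : ZMod 2 → Submodule K A}

lemma two_mul_mem {i : ZMod 2} {a : A} (ha : a ∈ G i) : 2 * a ∈ G i := by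
  rw [two_mul]; exact add_mem ha ha

lemma three_mul_mem {i : ZMod 2} {a : A} (ha : a ∈ G i) : 3 * a ∈ G i := by
  rw [three_mul_eq]; exact add_mem (add_mem ha ha) ha

/-- Homogeneity of the relations makes their ideal stable under parity, which is needed for the
grading of the quotient. -/
lemma rel3_homogeneous
    (hG : ∀ (i j : ZMod 2) (a b : A), a ∈ G i → b ∈ G j → a * b ∈ G (i + j))
    {θ t : Fin 2 → A} (hθ : ∀ i, θ i ∈ G 1) (ht : ∀ i, t i ∈ G 0) :
    ∀ r ∈ rel3 θ t, ∃ i, r ∈ G i := by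
  have oe : ∀ a b, a ∈ G 1 → b ∈ G 0 → a * b ∈ G 1 := fun a b => hG 1 0 a b
  rintro r (rfl | rfl | rfl)
  · exact ⟨0, hG 1 1 _ _ (hθ 0) (hθ 1)⟩
  · exact ⟨1, sub_mem (oe _ _ (two_mul_mem (hθ 0)) (ht 0)) (oe _ _ (oe _ _ (hθ 1) (ht 0)) (ht 1))⟩
  · refine ⟨1, sub_mem (add_mem (oe _ _ (hθ 0) (ht 1)) (oe _ _ (two_mul_mem (hθ 1)) (ht 0))) ?_⟩
    rw [pow_two, ← mul_assoc]
    exact oe _ _ (oe _ _ (hθ 1) (ht 1)) (ht 1)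

lemma rel4_homogeneous
    (hG : ∀ (i j : ZMod 2) (a b : A), a ∈ G i → b ∈ G j → a * b ∈ G (i + j))
    {θ t : Fin 3 → A} (hθ : ∀ i, θ i ∈ G 1) (ht : ∀ i, t i ∈ G 0) :
    ∀ r ∈ rel4 θ t, ∃ i, r ∈ G i := by
  have oo : ∀ i j, θ i * θ j ∈ G 0 := fun i j => hG 1 1 _ _ (hθ i) (hθ j)
  have ee : ∀ i j, θ i * θ j * t 0 ∈ G 0 ∧ θ i * θ j * t 1 ∈ G 0 ∧ θ i * θ j * t 2 ∈ G 0 :=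
    fun i j => ⟨hG 0 0 _ _ (oo i j) (ht 0), hG 0 0 _ _ (oo i j) (ht 1), hG 0 0 _ _ (oo i j) (ht 2)⟩
  have oe : ∀ a i, a ∈ G 1 → a * t i ∈ G 1 := fun a i ha => hG 1 0 a _ ha (ht i)
  rintro r (rfl | rfl | rfl | rfl | rfl | rfl)
  · exact ⟨0, (ee 1 2).1⟩
  · exact ⟨0, add_mem (neg_mem (oo 0 1)) (ee 1 2).2.1⟩
  · refine ⟨0, add_mem ?_ (ee 1 2).2.2⟩
    rw [neg_mul, neg_mul, mul_assoc]
    exact neg_mem (two_mul_mem (oo 0 2))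
  all_goals
    refine ⟨1, ?_⟩
    simp only [neg_mul, pow_succ, pow_zero, one_mul, ← mul_assoc]
    repeat' first
      | exact hθ _
      | apply two_mul_mem
      | apply three_mul_mem
      | apply oe
      | apply neg_mem
      | apply sub_mem
      | apply add_mem

end Homogeneous

variable [CharZero K]

/-! ### The miniversal deformations -/

/-- A normal form with base `K[[θ, t]] / (R)` is miniversal if over every formal base, the relations
and the remaining components are implied by the vanishing of the square. -/
lemma isMiniversal_of_normalForm {n : ℕ} {R : Set (Free K n)} (hR : ∀ r ∈ R, freeAug K n r = 0)
    (hσ : ∀ r ∈ R, parity K n r ∈ TwoSidedIdeal.span R) {γ₀ δ₀ : (Base R)⟦X⟧}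
    (hγ : γ₀ ∈ SerMem (baseGrading R 0)) (hδ : δ₀ ∈ SerMem (baseGrading R 1))
    (hγ0 : PowerSeries.coeff 0 γ₀ = 0)
    (h1 : dX (alphaSer (theta R)) * alphaSer (theta R) + betaSer (tt R) * γ₀ = 0)
    (h2 : dX (alphaSer (theta R)) * betaSer (tt R) - dX (betaSer (tt R)) * alphaSer (theta R)
      + betaSer (tt R) * δ₀ = 0)
    (hrel : ∀ {B : Type v} [Ring B] [Algebra K B] {ℬ : ZMod 2 → Submodule K B} {η : B →ₐ[K] K}
      (_ : IsFormalBase ℬ η) (θ t : Fin n → B) (γ δ : B⟦X⟧),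
      (∀ i, θ i ∈ ℬ 1) → (∀ i, t i ∈ ℬ 0) →
      (∀ i, η (t i) = 0) → PowerSeries.coeff 0 γ = 0 →
      dX (alphaSer θ) * alphaSer θ + betaSer t * γ = 0 →
      dX (alphaSer θ) * betaSer t - dX (betaSer t) * alphaSer θ + betaSer t * δ = 0 →
      (∀ g : Free K n →ₐ[K] B, (∀ i, g (freeTheta K n i) = θ i) →
        (∀ i, g (freeT K n i) = t i) → ∀ r ∈ R, g r = 0) ∧
      ∀ f : Base R →ₐ[K] B, (∀ i, f (theta R i) = θ i) → (∀ i, f (tt R i) = t i) →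
        PowerSeries.map (f : Base R →+* B) γ₀ = γ ∧ PowerSeries.map (f : Base R →+* B) δ₀ = δ) :
    IsMiniversal.{u, u, v} (baseGrading R) (baseAug R hR) (dPsi K (n + 1))
      (coder (ser (alphaSer (theta R)) (betaSer (tt R)) γ₀ δ₀)) := by
  have hA := isFormalBase_base hR hσ
  have hdef : IsDeformation (baseGrading R) (baseAug R hR) (dPsi K (n + 1))
      (coder (ser (alphaSer (theta R)) (betaSer (tt R)) γ₀ δ₀)) :=
    hA.isDeformation (serMem_alphaSer theta_mem) (hA.serMem_betaSer tt_mem) hγ hδ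
      (isWeierstrass_betaSer (aug_tt hR)) (coeff_zero_alphaSer _) hγ0 h1 h2
  refine ⟨hA, hdef, fun B _ _ ℬ η δ' hB hδ' => ?_, fun B _ _ ℬ η δ' hB hδ' f₁ f₂ => ?_⟩
  · refine hB.exists_baseHom_equivalent hR ?_ hδ'
    intro θ t γ δ hθ ht htη hγ h1 h2
    obtain ⟨e1, e2⟩ := hrel hB θ t γ δ hθ ht htη hγ h1 h2
    refine ⟨fun g hgθ hgt _ => e1 g hgθ hgt, fun f hfθ hft => ?_⟩
    rw [map_ser_params f hfθ hft, (e2 f hfθ hft).1, (e2 f hfθ hft).2]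
  · exact hB.baseHom_unique hR hγ0 hdef.proj hδ'

theorem isMiniversal_two :
    IsMiniversal.{u, u, v} (baseGrading (R2 K)) (baseAug (R2 K) (aug_R2 K)) (dPsi K 2)
      (coder (firstOrder K 1 (theta (R2 K)) (tt (R2 K)))) := by
  have hσ : ∀ r ∈ R2 K, parity K 1 r ∈ TwoSidedIdeal.span (R2 K) := by
    rintro r hr
    have h := freeGrading_mul (freeTheta_mem (K := K) (0 : Fin 1)) (freeT_mem (K := K) (0 : Fin 1))
    have e : r = freeTheta K 1 0 * freeT K 1 0 := hr
    rw [← e] at h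
    exact parity_mem_of_homogeneous hr h
  have hrel : theta (R2 K) 0 * tt (R2 K) 0 = 0 := eq_zero_rel2 rfl
  obtain ⟨q1, q2⟩ := (isFormalBase_base (aug_R2 K) hσ).square_one (θ := theta (R2 K))
    (t := tt (R2 K)) theta_mem
  rw [firstOrder_eq_ser]
  refine isMiniversal_of_normalForm (aug_R2 K) hσ (zero_mem _) (serMem_deltaSer theta_mem)
    (map_zero _) q1 (by rw [q2, hrel]; exact quad_eq_zero_iff.2 ⟨rfl, rfl, rfl⟩) ?_
  intro B _ _ ℬ η hB θ t γ δ hθ ht htη hγ0 h1 h2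
  obtain ⟨q1, q2⟩ := hB.square_one (t := t) hθ
  have hW := isWeierstrass_betaSer htη
  have hγ := (hB.eq_of_remainder hW h1 q1 fun k => map_zero _).1
  have hδ := hB.eq_of_remainder hW h2 q2 fun k => by
    cases k with
    | zero => simp [quad]
    | succ k => rw [show 1 + (k + 1) = 2 + k by omega]; exact coeff_quad_of_two_le rfl
  have hr := (quad_eq_zero_iff.1 hδ.2).1
  refine ⟨fun g hgθ hgt r hr' => ?_, fun f hfθ hft => ⟨by rw [map_zero, hγ], ?_⟩⟩
  · have e : r = freeTheta K 1 0 * freeT K 1 0 := hr'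
    rw [e, map_mul, hgθ, hgt, hr]
  · rw [map_deltaSer, ← hδ.1]
    congr 1
    exact funext hfθ

end Cases
end LInfty
end

noncomputable section
namespace LInfty
open PowerSeries

/-! ### Miniversal deformations for `L = 3` and `L = 4` -/

section Cases

variable {K : Type u} [Field K]

lemma serMem_delta3 {A : Type v} [Ring A] [Algebra K A] {𝒜 : ZMod 2 → Submodule K A}
    {ε : A →ₐ[K] K} (h : IsLocalBase 𝒜 ε) {θ t : Fin 2 → A} (hθ : ∀ i, θ i ∈ 𝒜 1)
    (ht : ∀ i, t i ∈ 𝒜 0) : delta3 K θ t ∈ SerMem (𝒜 1) :=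
  add_mem (serMem_deltaSer hθ) (serMem_monomial (neg_mem (h.mul_mem 1 0 _ _ (hθ 1) (ht 1))) _)

lemma serMem_delta4 {A : Type v} [Ring A] [Algebra K A] {𝒜 : ZMod 2 → Submodule K A}
    {ε : A →ₐ[K] K} (h : IsLocalBase 𝒜 ε) {θ t : Fin 3 → A} (hθ : ∀ i, θ i ∈ 𝒜 1)
    (ht : ∀ i, t i ∈ 𝒜 0) : delta4 K θ t ∈ SerMem (𝒜 1) := by
  have oe : ∀ i j, θ i * t j ∈ 𝒜 1 := fun i j => h.mul_mem 1 0 _ _ (hθ i) (ht j)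
  refine add_mem (add_mem (add_mem (serMem_deltaSer hθ) (serMem_monomial (neg_mem ?_) _))
    (serMem_monomial (neg_mem (oe 2 2)) _)) (serMem_monomial ?_ _)
  · refine add_mem (oe 1 2) ?_
    rw [mul_assoc]
    exact two_mul_mem (oe 2 1)
  · rw [pow_two, ← mul_assoc]
    exact h.mul_mem 1 0 _ _ (oe 2 2) (ht 2)

variable [CharZero K]

theorem isMiniversal_three :
    IsMiniversal.{u, u, v} (baseGrading (R3 K)) (baseAug (R3 K) (aug_R3 K)) (dPsi K 3)
      (coder (d32 K (theta (R3 K)) (tt (R3 K)))) := by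
  have hσ : ∀ r ∈ R3 K, parity K 2 r ∈ TwoSidedIdeal.span (R3 K) := by
    intro r hr
    obtain ⟨i, hi⟩ := rel3_homogeneous (G := freeGrading K 2) (θ := freeTheta K 2)
      (t := freeT K 2) (fun _ _ _ _ => freeGrading_mul) freeTheta_mem freeT_mem r hr
    exact parity_mem_of_homogeneous hr hi
  have hA := isFormalBase_base (aug_R3 K) hσ
  have r1 : theta (R3 K) 0 * theta (R3 K) 1 = 0 := eq_zero_rel3 (.inl rfl)
  have r2 := eq_zero_rel3 (K := K) (.inr (.inl rfl))
  have r3 := eq_zero_rel3 (K := K) (.inr (.inr rfl))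
  obtain ⟨q1, q2⟩ := hA.square_two (θ := theta (R3 K)) (t := tt (R3 K)) theta_mem tt_mem
  rw [r1, mul_zero, mul_zero, map_zero, quad_eq_zero_iff.2 ⟨rfl, rfl, rfl⟩] at q1
  rw [quad_eq_zero_iff.2 ⟨r2, r3, rfl⟩] at q2
  rw [d32_eq_ser]
  refine isMiniversal_of_normalForm (aug_R3 K) hσ (zero_mem _)
    (serMem_delta3 hA.toIsLocalBase theta_mem tt_mem) (map_zero _) q1 q2 ?_
  intro B _ _ ℬ η hB θ t γ δ hθ ht htη hγ0 h1 h2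
  obtain ⟨q1, q2⟩ := hB.square_two hθ ht
  have hW := isWeierstrass_betaSer htη
  have hγ := hB.eq_of_remainder hW h1 q1 fun k => coeff_quad_of_two_le rfl
  have hδ := hB.eq_of_remainder hW h2 q2 fun k => coeff_quad_of_two_le rfl
  -- The quotient of the first division is the constant `θ_1 θ_2`, whereas `γ` has no constant term.
  have s1 : θ 0 * θ 1 = 0 := by
    rw [← hγ0, ← hγ.1, PowerSeries.coeff_monomial, if_pos rfl]
  obtain ⟨s2, s3, -⟩ := quad_eq_zero_iff.1 hδ.2
  have hs : ∀ r ∈ rel3 θ t, r = 0 := by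
    rintro r (rfl | rfl | rfl) <;> assumption
  refine ⟨fun g hgθ hgt r hr => hs _ ?_, fun f hfθ hft => ⟨?_, ?_⟩⟩
  · have := Set.mem_image_of_mem (g : Free K 2 →+* B) hr
    rw [R3, image_rel3] at this
    rwa [← funext hgθ, ← funext hgt]
  · rw [map_zero, ← hγ.1, s1, map_zero]
  · rw [map_delta3, ← hδ.1, ← funext hfθ, ← funext hft]

theorem isMiniversal_four :
    IsMiniversal.{u, u, v} (baseGrading (R4 K)) (baseAug (R4 K) (aug_R4 K)) (dPsi K 4)
      (coder (d43 K (theta (R4 K)) (tt (R4 K)))) := by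
  have hσ : ∀ r ∈ R4 K, parity K 3 r ∈ TwoSidedIdeal.span (R4 K) := by
    intro r hr
    obtain ⟨i, hi⟩ := rel4_homogeneous (G := freeGrading K 3) (θ := freeTheta K 3)
      (t := freeT K 3) (fun _ _ _ _ => freeGrading_mul) freeTheta_mem freeT_mem r hr
    exact parity_mem_of_homogeneous hr hi
  have hA := isFormalBase_base (aug_R4 K) hσ
  have r1 := eq_zero_rel4 (K := K) (.inl rfl)
  have r2 := eq_zero_rel4 (K := K) (.inr (.inl rfl))
  have r3 := eq_zero_rel4 (K := K) (.inr (.inr (.inl rfl)))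
  have r4 := eq_zero_rel4 (K := K) (.inr (.inr (.inr (.inl rfl))))
  have r5 := eq_zero_rel4 (K := K) (.inr (.inr (.inr (.inr (.inl rfl)))))
  have r6 := eq_zero_rel4 (K := K) (.inr (.inr (.inr (.inr (.inr rfl)))))
  obtain ⟨q1, q2⟩ := hA.square_three (θ := theta (R4 K)) (t := tt (R4 K)) theta_mem tt_mem
  have r3' : 2 * theta (R4 K) 0 * theta (R4 K) 2 - theta (R4 K) 1 * theta (R4 K) 2 * tt (R4 K) 2
      = 0 := by
    rw [← neg_eq_zero, ← r3, neg_mul, neg_mul]; abel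
  rw [r3', map_zero, add_zero, mul_zero, mul_zero, mul_zero, add_zero, add_zero, r1, r2,
    quad_eq_zero_iff.2 ⟨rfl, rfl, rfl⟩] at q1
  rw [quad_eq_zero_iff.2 ⟨neg_eq_zero.2 r4, neg_eq_zero.2 r5, neg_eq_zero.2 r6⟩] at q2
  rw [d43_eq_ser]
  refine isMiniversal_of_normalForm (aug_R4 K) hσ
    (serMem_monomial (hA.mul_mem 1 1 _ _ (theta_mem 1) (theta_mem 2)) 1)
    (serMem_delta4 hA.toIsLocalBase theta_mem tt_mem)
    (by rw [PowerSeries.coeff_monomial, if_neg (by omega)]) q1 q2 ?_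
  intro B _ _ ℬ η hB θ t γ δ hθ ht htη hγ0 h1 h2
  obtain ⟨q1, q2⟩ := hB.square_three hθ ht
  have hW := isWeierstrass_betaSer htη
  have hγ := hB.eq_of_remainder hW h1 q1 fun k => coeff_quad_of_three_le
  have hδ := hB.eq_of_remainder hW h2 q2 fun k => coeff_quad_of_three_le
  -- This relation is not a remainder: it is the vanishing of the constant term of the quotient `γ`.
  have s3 : 2 * θ 0 * θ 2 - θ 1 * θ 2 * t 2 = 0 := by
    rw [← hγ0, ← hγ.1, map_add, PowerSeries.coeff_monomial, PowerSeries.coeff_monomial, if_pos rfl,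
      if_neg (by omega), zero_add]
  -- The constant coefficient of the remainder is a multiple of the expression in `s3` and gives
  -- nothing new.
  obtain ⟨-, s1, s2⟩ := quad_eq_zero_iff.1 hγ.2
  rw [s3, mul_zero, add_zero] at s1 s2
  obtain ⟨s4, s5, s6⟩ := quad_eq_zero_iff.1 hδ.2
  rw [neg_eq_zero] at s4 s5 s6
  have s3' : -2 * θ 0 * θ 2 + θ 1 * θ 2 * t 2 = 0 := by
    rw [← neg_eq_zero, ← s3, neg_mul, neg_mul]; abel
  have hs : ∀ r ∈ rel4 θ t, r = 0 := by
    rintro r (rfl | rfl | rfl | rfl | rfl | rfl) <;> assumption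
  refine ⟨fun g hgθ hgt r hr => hs _ ?_, fun f hfθ hft => ⟨?_, ?_⟩⟩
  · have := Set.mem_image_of_mem (g : Free K 3 →+* B) hr
    rw [R4, image_rel4] at this
    rwa [← funext hgθ, ← funext hgt]
  · rw [← hγ.1, s3, map_zero, add_zero, map_monomial', map_mul, ← funext hfθ]
    rfl
  · rw [map_delta4, ← hδ.1, ← funext hfθ, ← funext hft]

end Cases

/-! ### The relations for `L = 3` -/

section Relations

variable (K : Type u) [Field K]

lemma theta_mem_augIdeal {n : ℕ} (i : Fin n) : freeTheta K n i ∈ augIdeal (freeAug K n) :=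
  freeAug_theta K n i

lemma t_mem_augIdeal {n : ℕ} (i : Fin n) : freeT K n i ∈ augIdeal (freeAug K n) :=
  freeAug_t K n i

lemma theta_mul_t_mul_t_mem {n : ℕ} (i j k : Fin n) :
    freeTheta K n i * freeT K n j * freeT K n k ∈ mPow K n 3 := by
  show _ ∈ augIdeal (freeAug K n) ^ (1 + 1 + 1)
  rw [pow_succ, pow_succ, pow_one]
  exact Submodule.mul_mem_mul (Submodule.mul_mem_mul (theta_mem_augIdeal K i) (t_mem_augIdeal K j))
    (t_mem_augIdeal K k)

/-- Write `x`, `y` for the two variables. The coefficient of `y ^ 2` in the first equation says that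
`q` has no linear term in `y`, but the coefficient of `x y` in the second says that twice this term
is 1. -/
lemma power_series_aux {p q : MvPowerSeries (Fin 2) K}
    (e0 : p * MvPowerSeries.X 0 + q * MvPowerSeries.X 1 = 0)
    (e1 : q * (2 * MvPowerSeries.X 0) = MvPowerSeries.X 0 * MvPowerSeries.X 1) : False := by
  have c0 := congrArg (MvPowerSeries.coeff (Finsupp.single 1 1 + Finsupp.single 1 1)) e0
  have e1' : (q + q) * MvPowerSeries.X 0 = MvPowerSeries.X 1 * MvPowerSeries.X 0 := by
    linear_combination e1
  have c1 := congrArg (MvPowerSeries.coeff (Finsupp.single 1 1 + Finsupp.single 0 1)) e1'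
  have hle : ¬ (Finsupp.single (0 : Fin 2) 1 ≤ Finsupp.single 1 1 + Finsupp.single 1 1) := by
    intro h
    simpa using h 0
  rw [map_add, MvPowerSeries.X_def, MvPowerSeries.X_def, MvPowerSeries.coeff_add_mul_monomial,
    MvPowerSeries.coeff_mul_monomial, if_neg hle, zero_add, mul_one, map_zero] at c0
  rw [MvPowerSeries.X_def, MvPowerSeries.X_def, MvPowerSeries.coeff_add_mul_monomial,
    MvPowerSeries.coeff_add_mul_monomial, map_add, c0, MvPowerSeries.coeff_monomial_same] at c1
  simp at c1

/-- The element `θ_2 t_1 t_2` is not a combination of the quadratic relations. -/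
lemma cubic_not_mem : freeTheta K 2 1 * freeT K 2 0 * freeT K 2 1 ∉
    TwoSidedIdeal.span (R3Quadratic K) := by
  let P := MvPowerSeries (Fin 2) K
  let x : P := MvPowerSeries.X 0
  let y : P := MvPowerSeries.X 1
  -- Killing products of two odd variables leaves linear algebra over `P`: the relation `θ_1 θ_2`
  -- disappears, the other two become the vectors `(x, 0)` and `(y, 2x)`, and `(0, x y)` must be
  -- shown not to be a combination of them.
  let φ : Free K 2 →ₐ[P] TrivSqZeroExt P (Fin 2 → P) := ExteriorAlgebra.toTrivSqZeroExt
  have hθ : ∀ i, φ (freeTheta K 2 i) = TrivSqZeroExt.inr (Pi.single i 1) := fun i =>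
    ExteriorAlgebra.toTrivSqZeroExt_ι _
  have ht : ∀ i, φ (freeT K 2 i) = TrivSqZeroExt.inl (MvPowerSeries.X i) := fun i => φ.commutes _
  let a : TrivSqZeroExt P (Fin 2 → P) := TrivSqZeroExt.inr ![x, 0]
  let b : TrivSqZeroExt P (Fin 2 → P) := TrivSqZeroExt.inr ![y, 2 * x]
  let I : Ideal (TrivSqZeroExt P (Fin 2 → P)) := Ideal.span {a, b}
  intro h
  have hker : TwoSidedIdeal.span (R3Quadratic K)
      ≤ TwoSidedIdeal.ker ((Ideal.Quotient.mk I).comp (φ : Free K 2 →+* _)) := by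
    refine TwoSidedIdeal.span_le.2 fun r hr => (TwoSidedIdeal.mem_ker _).2 ?_
    rw [RingHom.comp_apply, Ideal.Quotient.eq_zero_iff_mem]
    rcases hr with rfl | rfl | rfl
    · have : φ (freeTheta K 2 0 * freeTheta K 2 1) = 0 := by
        rw [map_mul, hθ, hθ, TrivSqZeroExt.inr_mul_inr]
      exact this ▸ zero_mem I
    · have : φ (freeTheta K 2 0 * freeT K 2 0) = a := by
        rw [map_mul, hθ, ht]
        refine TrivSqZeroExt.ext (by simp [a]) (funext fun i => ?_)
        fin_cases i <;> simp [a, x]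
      exact this ▸ Ideal.subset_span (by simp)
    · have : φ (freeTheta K 2 0 * freeT K 2 1 + 2 * freeTheta K 2 1 * freeT K 2 0) = b := by
        rw [two_mul, add_mul, map_add, map_add, map_mul, map_mul, hθ, hθ, ht, ht]
        refine TrivSqZeroExt.ext (by simp [b]) (funext fun i => ?_)
        fin_cases i <;> simp [b, x, y, two_mul]
      exact this ▸ Ideal.subset_span (by simp)
  have h1 := (TwoSidedIdeal.mem_ker _).1 (hker h)
  rw [RingHom.comp_apply, Ideal.Quotient.eq_zero_iff_mem, Ideal.mem_span_pair] at h1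
  obtain ⟨c, d, hcd⟩ := h1
  have e : φ (freeTheta K 2 1 * freeT K 2 0 * freeT K 2 1) = TrivSqZeroExt.inr ![0, x * y] := by
    rw [map_mul, map_mul, hθ, ht, ht]
    refine TrivSqZeroExt.ext (by simp) (funext fun i => ?_)
    fin_cases i
    · simp
    · simp [x, y, mul_comm]
  have hcd' := congrArg TrivSqZeroExt.snd (hcd.trans e)
  have e0 : c.fst * x + d.fst * y = 0 := by simpa [a, b] using congrFun hcd' 0
  have e1 : d.fst * (2 * x) = x * y := by simpa [a, b] using congrFun hcd' 1
  exact power_series_aux K e0 e1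

/-- The two sets of relations differ by cubic terms and by the factor 2 in `2 θ_1 t_1`, which is
invertible. -/
lemma span_R3_union [CharZero K] :
    TwoSidedIdeal.span (R3 K ∪ mPow K 2 3) = TwoSidedIdeal.span (R3Quadratic K ∪ mPow K 2 3) := by
  have hcub : ∀ (T : Set (Free K 2)) {x}, x ∈ mPow K 2 3 → x ∈ TwoSidedIdeal.span (T ∪ mPow K 2 3) :=
    fun T x hx => TwoSidedIdeal.subset_span (.inr hx)
  have h1 := theta_mul_t_mul_t_mem K (1 : Fin 2) 0 1
  have h2 : freeTheta K 2 1 * freeT K 2 1 ^ 2 ∈ mPow K 2 3 := by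
    rw [pow_two, ← mul_assoc]
    exact theta_mul_t_mul_t_mem K 1 1 1
  apply le_antisymm <;> refine TwoSidedIdeal.span_le.2 ?_
  · rintro r ((rfl | rfl | rfl) | hr)
    · exact TwoSidedIdeal.subset_span (.inl (.inl rfl))
    · refine sub_mem ?_ (hcub _ h1)
      rw [mul_assoc]
      exact TwoSidedIdeal.mul_mem_left _ _ _ (TwoSidedIdeal.subset_span (.inl (.inr (.inl rfl))))
    · exact sub_mem (TwoSidedIdeal.subset_span (.inl (.inr (.inr rfl)))) (hcub _ h2)
    · exact hcub _ hr
  · rintro r ((rfl | rfl | rfl) | hr)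
    · exact TwoSidedIdeal.subset_span (.inl (.inl rfl))
    · have h3 : 2 * freeTheta K 2 0 * freeT K 2 0 ∈ TwoSidedIdeal.span (R3 K ∪ mPow K 2 3) := by
        have := add_mem (TwoSidedIdeal.subset_span (s := R3 K ∪ mPow K 2 3)
          (.inl (.inr (.inl rfl)))) (hcub (R3 K) h1)
        rwa [sub_add_cancel] at this
      have h4 := TwoSidedIdeal.mul_mem_left _ (algebraMap K (Free K 2) 2⁻¹) _ h3
      have e : algebraMap K (Free K 2) 2⁻¹ * (2 * freeTheta K 2 0 * freeT K 2 0)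
          = freeTheta K 2 0 * freeT K 2 0 := by
        rw [mul_assoc 2, ← mul_assoc, ← map_ofNat (algebraMap K (Free K 2)) 2, ← map_mul,
          inv_mul_cancel₀ two_ne_zero, map_one, one_mul]
      rwa [e] at h4
    · have := add_mem (TwoSidedIdeal.subset_span (s := R3 K ∪ mPow K 2 3)
          (.inl (.inr (.inr rfl)))) (hcub (R3 K) h2)
      rwa [sub_add_cancel] at this
    · exact hcub _ hr

/-- If the ideals agreed, subtracting the second relation of `R_3` from `2 θ_1 t_1` would put `θ_2
t_1 t_2` into the quadratic ideal. -/
lemma span_R3_ne : TwoSidedIdeal.span (R3 K) ≠ TwoSidedIdeal.span (R3Quadratic K) := by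
  intro h
  have h1 : 2 * freeTheta K 2 0 * freeT K 2 0 - freeTheta K 2 1 * freeT K 2 0 * freeT K 2 1
      ∈ TwoSidedIdeal.span (R3Quadratic K) := by
    rw [← h]
    exact TwoSidedIdeal.subset_span (.inr (.inl rfl))
  have h2 : 2 * freeTheta K 2 0 * freeT K 2 0 ∈ TwoSidedIdeal.span (R3Quadratic K) := by
    rw [mul_assoc]
    exact TwoSidedIdeal.mul_mem_left _ _ _ (TwoSidedIdeal.subset_span (.inr (.inl rfl)))
  have h3 := sub_mem h2 h1
  rw [sub_sub_cancel] at h3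
  exact cubic_not_mem K h3

end Relations
end LInfty
end

theorem mainTheorem3 (K : Type u) [Field K] [CharZero K] :
    -- `L = 1`: the codifferential is rigid
    IsMiniversal.{u, u, v} (groundGrading K) (AlgHom.id K K) (dPsi K 1) (dPsi K 1) ∧
    -- the universal infinitesimal deformations, with base `K[[θ, t]] / 𝔪 ^ 2`, for `L = 2, 3, 4`
    (∀ n : ℕ, 1 ≤ n → n ≤ 3 →
      IsUniversalInfinitesimal.{u, u, v} (baseGrading (mPow K n 2))
        (baseAug (mPow K n 2) (aug_mPow K n 1)) (dPsi K (n + 1))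
        (coder (firstOrder K n (theta (mPow K n 2)) (tt (mPow K n 2))))) ∧
    -- `L = 2`
    IsMiniversal.{u, u, v} (baseGrading (R2 K)) (baseAug (R2 K) (aug_R2 K)) (dPsi K 2)
      (coder (firstOrder K 1 (theta (R2 K)) (tt (R2 K)))) ∧
    -- `L = 3`
    IsMiniversal.{u, u, v} (baseGrading (R3 K)) (baseAug (R3 K) (aug_R3 K)) (dPsi K 3)
      (coder (d32 K (theta (R3 K)) (tt (R3 K)))) ∧
    -- modulo `𝔪 ^ 3` the relations `R_3` become the quadratic ones, but they differ from these
    TwoSidedIdeal.span (R3 K ∪ mPow K 2 3) = TwoSidedIdeal.span (R3Quadratic K ∪ mPow K 2 3) ∧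
    TwoSidedIdeal.span (R3 K) ≠ TwoSidedIdeal.span (R3Quadratic K) ∧
    -- `L = 4`
    IsMiniversal.{u, u, v} (baseGrading (R4 K)) (baseAug (R4 K) (aug_R4 K)) (dPsi K 4)
      (coder (d43 K (theta (R4 K)) (tt (R4 K)))) :=
  ⟨isMiniversal_dPsi_one, fun n _ _ => isUniversalInfinitesimal_firstOrder n, isMiniversal_two,
    isMiniversal_three, span_R3_union K, span_R3_ne K, isMiniversal_four⟩
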